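/- An instance of the multiperiod binary knapsack problem with soft capacity constraints (MPBKP-S) consists of $n$ items with rewards $r_i\in\mathbb N$, sizes $q_i\in\mathbb N$ and deadlines $d_i\in\{1,\dots,T\}$, of non-decreasing cumulative capacities $c_1\le\dots\le c_T$ in $\mathbb N$, and of penalty rates $B_1,\dots,B_T\in\mathbb N$ with $B_t\,q_i>r_i$ whenever $d_i\le t$ (so sizes are positive and $B_t>r_i/q_i$); let $n\ge 1$ and $T\le n$. The problem is to maximize the profit $$\sum_{i\in S} r_i-\sum_{t=1}^T B_t\,y_t\quad\text{over } S\subseteq\{1,\dots,n\},\ y\in\mathbb R_{\ge 0}^T\quad\text{subject to}\quad \sum_{i\in S:\,d_i\le t} q_i-\sum_{s=1}^t y_s\le c_t\quad(1\le t\le T).$$ Let $\mathrm{OPT}$ be the optimal value. Then MPBKP-S admits an FPTAS. Precisely, there is a single deterministic algorithm (a fixed word RAM program) that, given any such instance and any rational $\epsilon\in(0,1)$ (as numerator and denominator), outputs a set $S$ of items for which some feasible $(S,y)$ has profit $P$ with $\mathrm{OPT}\le(1+\epsilon)P$, and whose running time is $$O\!\left(\frac{n\log (n+1)}{\epsilon}\cdot\min\left\{\frac{T}{\epsilon},\,n\right\}\right),$$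 with an absolute implied constant. Running time is the number of unit-cost steps on a word RAM (addition, truncated subtraction, multiplication, integer division, comparison, and memory access) whose words have $O(\log M)$ bits, where $M$ is $2$ plus the sum of all numbers in the input ($n$, $T$, numerator and denominator of $\epsilon$, and all $c_t,B_t,r_i,q_i,d_i$). -/

import Mathlib

/-! ### Word RAM programs

A program is a piece of finite code over finitely many scalar variables and finitely many arrays,
with unit-cost arithmetic on natural numbers below a word bound `W`. -/

namespace WordRAM

/-- Unit-cost word operations. `sub` is truncated at `0`, `div` is the integer quotient (`0` if the
divisor is `0`), and the comparisons return `1` for true and `0` for false. -/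
inductive Op where
  | add | sub | mul | div | lt | eq

def Op.apply : Op → ℕ → ℕ → ℕ
  | .add, a, b => a + b
  | .sub, a, b => a - b
  | .mul, a, b => a * b
  | .div, a, b => a / b
  | .lt, a, b => if a < b then 1 else 0
  | .eq, a, b => if a = b then 1 else 0

/-- Expressions: literals, scalar variables, array cells (`load a i` is cell `i` of array number
`a`), and binary operations. -/
inductive Exp where
  | lit (k : ℕ)
  | var (x : ℕ)
  | load (a : ℕ) (i : Exp)
  | bin (o : Op) (e₁ e₂ : Exp)

/-- Commands. In `cond` and `loop`, a nonzero value of the expression means true. -/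
inductive Cmd where
  | skip
  | assign (x : ℕ) (e : Exp)
  | write (a : ℕ) (i e : Exp)
  | seq (p₁ p₂ : Cmd)
  | cond (e : Exp) (p₁ p₂ : Cmd)
  | loop (e : Exp) (p : Cmd)

/-- Contents of the scalar variables and of the array cells. -/
structure State where
  var : ℕ → ℕ
  arr : ℕ → ℕ → ℕ

def State.setVar (s : State) (x v : ℕ) : State :=
  { s with var := Function.update s.var x v }

def State.setCell (s : State) (a i v : ℕ) : State :=
  { s with arr := Function.update s.arr a (Function.update (s.arr a) i v) }

def Exp.eval (s : State) : Exp → ℕ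
  | .lit k => k
  | .var x => s.var x
  | .load a i => s.arr a (i.eval s)
  | .bin o e₁ e₂ => o.apply (e₁.eval s) (e₂.eval s)

/-- Every value that occurs in the evaluation of the expression (cell indices included) is a word,
that is, less than `W`. -/
def Exp.Fits (W : ℕ) (s : State) : Exp → Prop
  | .lit k => k < W
  | .var x => s.var x < W
  | .load a i => i.Fits W s ∧ s.arr a (i.eval s) < W
  | .bin o e₁ e₂ => e₁.Fits W s ∧ e₂.Fits W s ∧ o.apply (e₁.eval s) (e₂.eval s) < W

/-- Number of steps of an evaluation: one for each literal, variable, memory access and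
operation. -/
def Exp.cost : Exp → ℕ
  | .lit _ => 1
  | .var _ => 1
  | .load _ i => i.cost + 1
  | .bin _ e₁ e₂ => e₁.cost + e₂.cost + 1

/-- `Exec W p s s' t`: on words less than `W`, the program `p` started in `s` halts in `s'` after
exactly `t` steps. A run that would leave the range of words does not count as an execution. -/
inductive Exec (W : ℕ) : Cmd → State → State → ℕ → Prop where
  | skip (s : State) : Exec W .skip s s 1
  | assign (x : ℕ) (e : Exp) (s : State) (he : e.Fits W s) :
      Exec W (.assign x e) s (s.setVar x (e.eval s)) (e.cost + 1)
  | write (a : ℕ) (i e : Exp) (s : State) (hi : i.Fits W s) (he : e.Fits W s) :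
      Exec W (.write a i e) s (s.setCell a (i.eval s) (e.eval s)) (i.cost + e.cost + 1)
  | seq (p₁ p₂ : Cmd) (s s₁ s₂ : State) (t₁ t₂ : ℕ)
      (h₁ : Exec W p₁ s s₁ t₁) (h₂ : Exec W p₂ s₁ s₂ t₂) :
      Exec W (.seq p₁ p₂) s s₂ (t₁ + t₂)
  | cond_true (e : Exp) (p₁ p₂ : Cmd) (s s' : State) (t : ℕ) (he : e.Fits W s)
      (hne : e.eval s ≠ 0) (h : Exec W p₁ s s' t) :
      Exec W (.cond e p₁ p₂) s s' (e.cost + 1 + t)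
  | cond_false (e : Exp) (p₁ p₂ : Cmd) (s s' : State) (t : ℕ) (he : e.Fits W s)
      (hz : e.eval s = 0) (h : Exec W p₂ s s' t) :
      Exec W (.cond e p₁ p₂) s s' (e.cost + 1 + t)
  | loop_true (e : Exp) (p : Cmd) (s s₁ s₂ : State) (t₁ t₂ : ℕ) (he : e.Fits W s)
      (hne : e.eval s ≠ 0) (h₁ : Exec W p s s₁ t₁) (h₂ : Exec W (.loop e p) s₁ s₂ t₂) :
      Exec W (.loop e p) s s₂ (e.cost + 1 + t₁ + t₂)
  | loop_false (e : Exp) (p : Cmd) (s : State) (he : e.Fits W s) (hz : e.eval s = 0) :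
      Exec W (.loop e p) s s (e.cost + 1)

end WordRAM

/-! ### The multiperiod binary knapsack problem with soft capacity constraints -/

/-- An instance with `n` items and `T` periods. Periods are numbered from `0`, and `c t` is the
cumulative capacity up to and including period `t`. -/
structure MPBKPS (n T : ℕ) where
  /-- rewards -/
  r : Fin n → ℕ
  /-- sizes -/
  q : Fin n → ℕ
  /-- deadlines -/
  d : Fin n → Fin T
  /-- cumulative capacities -/
  c : Fin T → ℕ
  /-- penalty rates -/
  B : Fin T → ℕ
  c_mono : Monotone c
  /-- `B t > r i / q i` whenever `d i ≤ t`; in particular sizes are positive -/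
  lt_B : ∀ i t, d i ≤ t → r i < B t * q i

namespace MPBKPS

variable {n T : ℕ}

/-- The set `S` of selected items together with overflows `y` satisfies the soft capacity
constraints. -/
def Feasible (I : MPBKPS n T) (S : Finset (Fin n)) (y : Fin T → ℝ) : Prop :=
  (∀ t, 0 ≤ y t) ∧
    ∀ t, (∑ i ∈ S with I.d i ≤ t, (I.q i : ℝ)) - ∑ s ∈ Finset.Iic t, y s ≤ (I.c t : ℝ)

/-- Total reward minus total penalty. -/
noncomputable def profit (I : MPBKPS n T) (S : Finset (Fin n)) (y : Fin T → ℝ) : ℝ :=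
  ∑ i ∈ S, (I.r i : ℝ) - ∑ t, (I.B t : ℝ) * y t

/-- `S` is an `α`-approximate solution: with suitable overflows, `α` times its profit is at least
the profit of every feasible solution. -/
def IsApprox (I : MPBKPS n T) (α : ℝ) (S : Finset (Fin n)) : Prop :=
  ∃ y, I.Feasible S y ∧ ∀ S' y', I.Feasible S' y' → I.profit S' y' ≤ α * I.profit S y

/-- The sum of all numbers in the input `(I, ε)`, plus `2`. -/
def magnitude (I : MPBKPS n T) (ε : ℚ) : ℕ :=
  2 + n + T + ε.num.natAbs + ε.den + ∑ t, (I.c t + I.B t) + ∑ i, (I.r i + I.q i + I.d i)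

/-- A finite sequence as the contents of an array, with `0` in all other cells. -/
def cells {m : ℕ} (f : Fin m → ℕ) (j : ℕ) : ℕ :=
  if h : j < m then f ⟨j, h⟩ else 0

/-- The initial state on input `(I, ε)`: scalar variables `0, 1, 2, 3` hold `n`, `T` and the
numerator and denominator of `ε`; arrays `0, 1, 2, 3, 4` hold `c`, `B`, `r`, `q`, `d`; everything
else is `0`. -/
def input (I : MPBKPS n T) (ε : ℚ) : WordRAM.State where
  var x :=
    match x with
    | 0 => n
    | 1 => T
    | 2 => ε.num.natAbs
    | 3 => ε.den
    | _ => 0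
  arr a :=
    match a with
    | 0 => cells I.c
    | 1 => cells I.B
    | 2 => cells I.r
    | 3 => cells I.q
    | 4 => cells fun i => (I.d i : ℕ)
    | _ => fun _ => 0

/-- The output: the set of items whose cell in array `5` holds a nonzero value. -/
def output (n : ℕ) (s : WordRAM.State) : Finset (Fin n) :=
  {i | s.arr 5 i ≠ 0}

end MPBKPS

/-! Overflow can be removed from the problem. Overflow bought in period s relieves all constraints
from s on, so overflow needed in period t costs the lowest rate up to t, and buying it only when it
is needed is optimal because these lowest rates decrease with t (`sum_excess_le`,
`exists_overflow`). The best profit `val S` of a set S therefore comes from a sequential process on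
pairs (profit, load), which may also be run item by item in deadline order
(`run_comp_eq_run_periodSum`).

Let p₀ be the largest profit of at most one item. Then p₀ ≤ OPT ≤ n p₀ (`Sorts.val_le`), so if p₀ >
0 one of the at most log₂ n + 1 guesses V = p₀ 2^j has V ≤ OPT < 2V. For each guess a dynamic
program rounds profits down to multiples of V / K and stores the least load for each of the 2K + 1
scaled profits. It loses V / K per added object. With single items there may be n such losses, which
gives only the bound with n in the minimum.

To get T / ε instead, items are bundled. Within a period they are sorted by reward per size;
consecutive items that are small (reward at most V / H) or forced (worth their full penalty) are
merged until a bundle has reward above V / H. All forced items of a period lie in its first bundle.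
By the greedy argument for fractional knapsack, a prefix of bundles replaces any choice of small
items that includes all forced ones, at a loss of 2V / H per period (`Bundled.exists_threshold`);
including all forced items costs nothing. Altogether a union of bundles loses at most 2TV / H
(`Bundled.exists_selection`).

If unprofitable additions are omitted, at most 2H + 3T bundles are kept (`Bundled.card_kept_le`).
Per period at most one contains a forced item, at most one groupable bundle has reward at most V /
H, and at most one without forced items overflows, since the load is then full and anything unforced
costs more than it brings. The other bundles bring more than V / H each without overflow, and their
total is at most 2V. With H ≥ 8T / ε and K ≥ 4 min(2H + 3T, n) / ε the bundling and the rounding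
lose at most εV / 4 each, which suffices (`Sorts.isApprox`).

The table has n + 1 rows of length O(min(T / ε, n) / ε) and is filled O(log(n + 1)) times; merge
sort is no more expensive. The program is verified with `Runs`, a total correctness triple with a
time bound: commands without loops are treated by weakest preconditions, loops by counted
invariants, unmodified memory by a syntactic frame rule. Memory stays below `wordBound`, and the
leaf count of an expression bounds its intermediate values. -/

namespace WordRAM

/-! ### Notation for expressions -/

instance : Add Exp := ⟨.bin .add⟩
instance : Sub Exp := ⟨.bin .sub⟩
instance : Mul Exp := ⟨.bin .mul⟩
instance : Div Exp := ⟨.bin .div⟩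

/-- The test `e₁ < e₂`. -/
def Exp.lt (e₁ e₂ : Exp) : Exp := .bin .lt e₁ e₂
/-- The test `e₁ = e₂`. -/
def Exp.eq (e₁ e₂ : Exp) : Exp := .bin .eq e₁ e₂
/-- The negation of a test. -/
def Exp.not (e : Exp) : Exp := .bin .eq e (.lit 0)

section eval
variable (s : State) (a b : Exp)
@[simp] theorem eval_add : (a + b).eval s = a.eval s + b.eval s := rfl
@[simp] theorem eval_sub : (a - b).eval s = a.eval s - b.eval s := rfl
@[simp] theorem eval_mul : (a * b).eval s = a.eval s * b.eval s := rfl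
@[simp] theorem eval_div : (a / b).eval s = a.eval s / b.eval s := rfl
@[simp] theorem eval_lt : (a.lt b).eval s = if a.eval s < b.eval s then 1 else 0 := rfl
@[simp] theorem eval_eq : (a.eq b).eval s = if a.eval s = b.eval s then 1 else 0 := rfl
@[simp] theorem eval_not : a.not.eval s = if a.eval s = 0 then 1 else 0 := rfl
@[simp] theorem eval_lit (k : ℕ) : Exp.eval s (.lit k) = k := rfl
@[simp] theorem eval_var (x : ℕ) : Exp.eval s (.var x) = s.var x := rfl
@[simp] theorem eval_load (x : ℕ) : Exp.eval s (.load x a) = s.arr x (a.eval s) := rfl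
end eval

theorem ite_one_ne_zero {p : Prop} [Decidable p] : (if p then 1 else 0 : ℕ) ≠ 0 ↔ p := by
  by_cases h : p <;> simp [h]

theorem ite_one_eq_zero {p : Prop} [Decidable p] : (if p then 1 else 0 : ℕ) = 0 ↔ ¬ p := by
  by_cases h : p <;> simp [h]

section update
variable (s : State) (a x v i : ℕ)
@[simp] theorem setVar_var (y : ℕ) : (s.setVar x v).var y = if y = x then v else s.var y := by
  simp [State.setVar, Function.update_apply]
@[simp] theorem setVar_arr : (s.setVar x v).arr = s.arr := rfl
@[simp] theorem setCell_var : (s.setCell a i v).var = s.var := rfl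
@[simp] theorem setCell_arr (b j : ℕ) :
    (s.setCell a i v).arr b j = if b = a ∧ j = i then v else s.arr b j := by
  by_cases h : b = a
  · subst h; by_cases h' : j = i <;> simp [State.setCell, h']
  · simp [State.setCell, h]
end update

/-! ### Words -/

/-- An exponent that bounds the values of an expression over a bounded state. -/
def Exp.leaves : Exp → ℕ
  | .lit k => k + 1
  | .var _ => 1
  | .load _ i => i.leaves
  | .bin _ e₁ e₂ => e₁.leaves + e₂.leaves

/-- All scalar variables and all cells are less than `U`. -/
def State.Bdd (U : ℕ) (s : State) : Prop :=
  (∀ x, s.var x < U) ∧ ∀ a i, s.arr a i < U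

theorem Exp.leaves_pos : ∀ e : Exp, 0 < e.leaves
  | .lit k => k.succ_pos
  | .var _ => Nat.one_pos
  | .load _ i => i.leaves_pos
  | .bin _ e₁ _ => Nat.add_pos_left e₁.leaves_pos _

theorem pow_add_pow_le {U a b : ℕ} (hU : 2 ≤ U) (ha : 0 < a) (hb : 0 < b) :
    U ^ a + U ^ b ≤ U ^ (a + b) := by
  have h1 : 2 ≤ U ^ a := hU.trans (Nat.le_self_pow ha.ne' U)
  have h2 : 2 ≤ U ^ b := hU.trans (Nat.le_self_pow hb.ne' U)
  rw [pow_add]; nlinarith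

theorem Op.apply_lt {U a b x y : ℕ} (hU : 2 ≤ U) (ha : 0 < a) (hb : 0 < b)
    (hx : x < U ^ a) (hy : y < U ^ b) (o : Op) : o.apply x y < U ^ (a + b) := by
  have h := pow_add_pow_le hU ha hb
  have h1 : 1 < U ^ (a + b) := Nat.one_lt_pow (by omega) (by omega)
  cases o <;> simp only [Op.apply]
  · omega
  · omega
  · rw [pow_add]; exact Nat.mul_lt_mul'' hx hy
  · have := Nat.div_le_self x y; omega
  · split <;> omega
  · split <;> omega

/-- Multiplication is the worst operation, and it adds exponents. A literal k gets exponent k + 1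
because k < U ^ k. A loaded value is a cell and so below U whatever its index. -/
theorem Exp.eval_lt_pow {U : ℕ} (hU : 2 ≤ U) {s : State} (hs : s.Bdd U) :
    ∀ e : Exp, e.eval s < U ^ e.leaves
  | .lit k => (Nat.lt_pow_self (by omega)).trans (Nat.pow_lt_pow_right (by omega) k.lt_succ_self)
  | .var x => by simpa [Exp.leaves] using hs.1 x
  | .load a i => (hs.2 a _).trans_le (Nat.le_self_pow i.leaves_pos.ne' U)
  | .bin o e₁ e₂ =>
      Op.apply_lt hU e₁.leaves_pos e₂.leaves_pos (eval_lt_pow hU hs e₁) (eval_lt_pow hU hs e₂) o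

/-- Subexpressions have no more leaves than the whole, so one power of U covers every intermediate
value and every cell index. -/
theorem Exp.fits {U W : ℕ} (hU : 2 ≤ U) {s : State} (hs : s.Bdd U) :
    ∀ e : Exp, U ^ e.leaves ≤ W → e.Fits W s
  | .lit k, h => (eval_lt_pow hU hs (.lit k)).trans_le h
  | .var x, h => (eval_lt_pow hU hs (.var x)).trans_le h
  | .load a i, h => ⟨i.fits hU hs h, (eval_lt_pow hU hs (.load a i)).trans_le h⟩
  | .bin o e₁ e₂, h =>
      ⟨e₁.fits hU hs ((Nat.pow_le_pow_right (by omega) (Nat.le_add_right _ _)).trans h),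
        e₂.fits hU hs ((Nat.pow_le_pow_right (by omega) (Nat.le_add_left _ _)).trans h),
        (eval_lt_pow hU hs (.bin o e₁ e₂)).trans_le h⟩

theorem State.Bdd.setVar {U : ℕ} {s : State} (hs : s.Bdd U) {x v : ℕ} (hv : v < U) :
    (s.setVar x v).Bdd U :=
  ⟨fun y => by rw [setVar_var]; split; exacts [hv, hs.1 y], hs.2⟩

theorem State.Bdd.setCell {U : ℕ} {s : State} (hs : s.Bdd U) {a i v : ℕ} (hv : v < U) :
    (s.setCell a i v).Bdd U :=
  ⟨hs.1, fun b j => by rw [setCell_arr]; split; exacts [hv, hs.2 b j]⟩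

/-! ### Frames -/

/-- The command may assign to the scalar variable `x`. -/
def Cmd.assigns (x : ℕ) : Cmd → Bool
  | .skip => false
  | .assign y _ => x == y
  | .write _ _ _ => false
  | .seq p q => p.assigns x || q.assigns x
  | .cond _ p q => p.assigns x || q.assigns x
  | .loop _ p => p.assigns x

/-- The command may write to the array `a`. -/
def Cmd.writes (a : ℕ) : Cmd → Bool
  | .skip => false
  | .assign _ _ => false
  | .write b _ _ => a == b
  | .seq p q => p.writes a || q.writes a
  | .cond _ p q => p.writes a || q.writes a
  | .loop _ p => p.writes a

/-- The states differ only in variables and arrays that the command may modify. -/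
structure Frame (p : Cmd) (s s' : State) : Prop where
  var : ∀ x, p.assigns x = false → s'.var x = s.var x
  arr : ∀ a, p.writes a = false → s'.arr a = s.arr a

theorem Frame.refl (p : Cmd) (s : State) : Frame p s s := ⟨fun _ _ => rfl, fun _ _ => rfl⟩

theorem Frame.trans {p : Cmd} {s₁ s₂ s₃ : State} (h : Frame p s₁ s₂) (h' : Frame p s₂ s₃) :
    Frame p s₁ s₃ :=
  ⟨fun x hx => (h'.var x hx).trans (h.var x hx), fun a ha => (h'.arr a ha).trans (h.arr a ha)⟩

theorem Frame.mono {p p' : Cmd} {s s' : State} (h : Frame p s s')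
    (hv : ∀ x, p'.assigns x = false → p.assigns x = false)
    (ha : ∀ a, p'.writes a = false → p.writes a = false) : Frame p' s s' :=
  ⟨fun x hx => h.var x (hv x hx), fun a h' => h.arr a (ha a h')⟩

/-- Turns "this register is untouched" into a Boolean computation on the syntax, so that later such
side goals close by `rfl`. -/
theorem Exec.frame {W : ℕ} {p : Cmd} {s s' : State} {t : ℕ} (h : Exec W p s s' t) :
    Frame p s s' := by
  induction h with
  | skip s => exact .refl _ _
  | assign x e s _ =>
    refine ⟨fun y hy => ?_, fun a _ => rfl⟩
    have : y ≠ x := by simpa [Cmd.assigns] using hy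
    simp [this]
  | write a i e s _ _ =>
    refine ⟨fun y _ => rfl, fun b hb => ?_⟩
    have : b ≠ a := by simpa [Cmd.writes] using hb
    funext j; simp [this]
  | seq p₁ p₂ s s₁ s₂ t₁ t₂ _ _ ih₁ ih₂ =>
    exact (ih₁.mono (fun x hx => by simp_all [Cmd.assigns]) (fun x hx => by simp_all [Cmd.writes])).trans
      (ih₂.mono (fun x hx => by simp_all [Cmd.assigns]) (fun x hx => by simp_all [Cmd.writes]))
  | cond_true e p₁ p₂ s s' t _ _ _ ih =>
    exact ih.mono (fun x hx => by simp_all [Cmd.assigns]) (fun x hx => by simp_all [Cmd.writes])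
  | cond_false e p₁ p₂ s s' t _ _ _ ih =>
    exact ih.mono (fun x hx => by simp_all [Cmd.assigns]) (fun x hx => by simp_all [Cmd.writes])
  | loop_true e p s s₁ s₂ t₁ t₂ _ _ _ _ ih₁ ih₂ =>
    exact Frame.trans (ih₁.mono (fun _ hx => hx) (fun _ hx => hx)) ih₂
  | loop_false e p s _ _ => exact .refl _ _

/-! ### Total correctness with time bounds -/

/-- Exponent of the word bound: no expression of the programs below has more leaves. -/
def maxLeaves : ℕ := 64

/-- Started in `s`, the program halts within `b` steps in a state that is bounded by `U` and
satisfies `Q`. -/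
def Runs (U : ℕ) (p : Cmd) (s : State) (b : ℕ) (Q : State → Prop) : Prop :=
  ∃ s' t, Exec (U ^ maxLeaves) p s s' t ∧ t ≤ b ∧ s'.Bdd U ∧ Q s'

variable {U : ℕ} {s : State} {Q : State → Prop}

theorem Exp.fits_of_leaves (hU : 2 ≤ U) (hs : s.Bdd U) {e : Exp} (he : e.leaves ≤ maxLeaves) :
    e.Fits (U ^ maxLeaves) s :=
  e.fits hU hs (Nat.pow_le_pow_right (by omega) he)

theorem Runs.mono {p : Cmd} {b b' : ℕ} {Q' : State → Prop} (h : Runs U p s b Q) (hb : b ≤ b')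
    (hQ : ∀ s', s'.Bdd U → Frame p s s' → Q s' → Q' s') : Runs U p s b' Q' := by
  obtain ⟨s', t, he, ht, hB, hs'⟩ := h
  exact ⟨s', t, he, ht.trans hb, hB, hQ s' hB he.frame hs'⟩

theorem Runs.seq {p₁ p₂ : Cmd} {b₁ b₂ : ℕ} {Q₁ : State → Prop} (h₁ : Runs U p₁ s b₁ Q₁)
    (h₂ : ∀ s₁, s₁.Bdd U → Frame p₁ s s₁ → Q₁ s₁ → Runs U p₂ s₁ b₂ Q) :
    Runs U (.seq p₁ p₂) s (b₁ + b₂) Q := by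
  obtain ⟨s₁, t₁, he₁, ht₁, hB₁, hq₁⟩ := h₁
  obtain ⟨s₂, t₂, he₂, ht₂, hB₂, hq₂⟩ := h₂ s₁ hB₁ he₁.frame hq₁
  exact ⟨s₂, _, .seq _ _ _ _ _ _ _ he₁ he₂, by omega, hB₂, hq₂⟩

theorem Runs.cond (hU : 2 ≤ U) (hs : s.Bdd U) {e : Exp} {p₁ p₂ : Cmd} {b : ℕ}
    (he : e.leaves ≤ maxLeaves) (h₁ : e.eval s ≠ 0 → Runs U p₁ s b Q)
    (h₂ : e.eval s = 0 → Runs U p₂ s b Q) : Runs U (.cond e p₁ p₂) s (e.cost + 1 + b) Q := by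
  by_cases h : e.eval s = 0
  · obtain ⟨s', t, hx, ht, hB, hq⟩ := h₂ h
    exact ⟨s', _, .cond_false _ _ _ _ _ _ (e.fits_of_leaves hU hs he) h hx, by omega, hB, hq⟩
  · obtain ⟨s', t, hx, ht, hB, hq⟩ := h₁ h
    exact ⟨s', _, .cond_true _ _ _ _ _ _ (e.fits_of_leaves hU hs he) h hx, by omega, hB, hq⟩

/-- A loop that makes exactly `N` rounds. -/
theorem Runs.loop (hU : 2 ≤ U) {e : Exp} {p : Cmd} (he : e.leaves ≤ maxLeaves)
    (I : ℕ → State → Prop) (N b : ℕ) (hs : s.Bdd U) (h₀ : I 0 s)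
    (hbody : ∀ i s', i < N → s'.Bdd U → Frame p s s' → I i s' →
      e.eval s' ≠ 0 ∧ Runs U p s' b (I (i + 1)))
    (hend : ∀ s', s'.Bdd U → Frame p s s' → I N s' → e.eval s' = 0) :
    Runs U (.loop e p) s (N * (e.cost + 1 + b) + (e.cost + 1)) (I N) := by
  have key : ∀ m i s', i + m = N → s'.Bdd U → Frame p s s' → I i s' →
      Runs U (.loop e p) s' (m * (e.cost + 1 + b) + (e.cost + 1)) (I N) := by
    intro m
    induction m with
    | zero =>
      intro i s' him hB hF hI
      obtain rfl : i = N := by omega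
      exact ⟨s', _, .loop_false _ _ _ (e.fits_of_leaves hU hB he) (hend s' hB hF hI), by omega,
        hB, hI⟩
    | succ m ih =>
      intro i s' him hB hF hI
      obtain ⟨hne, s₁, t₁, hx₁, ht₁, hB₁, hI₁⟩ := hbody i s' (by omega) hB hF hI
      obtain ⟨s₂, t₂, hx₂, ht₂, hB₂, hI₂⟩ :=
        ih (i + 1) s₁ (by omega) hB₁ (hF.trans hx₁.frame) hI₁
      refine ⟨s₂, _, .loop_true _ _ _ _ _ _ _ (e.fits_of_leaves hU hB he) hne hx₁ hx₂, ?_, hB₂,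
        hI₂⟩
      rw [Nat.succ_mul]; omega
  exact key N 0 s (by omega) hs (.refl _ _) h₀

/-- Weakest precondition of a command without loops. -/
def wp (U : ℕ) : Cmd → (State → Prop) → State → Prop
  | .skip, Q, s => Q s
  | .assign x e, Q, s => e.eval s < U ∧ Q (s.setVar x (e.eval s))
  | .write a i e, Q, s => e.eval s < U ∧ Q (s.setCell a (i.eval s) (e.eval s))
  | .seq p q, Q, s => wp U p (wp U q Q) s
  | .cond e p q, Q, s => (e.eval s ≠ 0 → wp U p Q s) ∧ (e.eval s = 0 → wp U q Q s)
  | .loop _ _, _, _ => False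

/-- A command without loops all of whose expressions are small. -/
def Cmd.straight : Cmd → Bool
  | .skip => true
  | .assign _ e => e.leaves ≤ maxLeaves
  | .write _ i e => i.leaves ≤ maxLeaves && e.leaves ≤ maxLeaves
  | .seq p q => p.straight && q.straight
  | .cond e p q => e.leaves ≤ maxLeaves && p.straight && q.straight
  | .loop _ _ => false

/-- Time bound of a command without loops. -/
def Cmd.time : Cmd → ℕ
  | .skip => 1
  | .assign _ e => e.cost + 1
  | .write _ i e => i.cost + e.cost + 1
  | .seq p q => p.time + q.time
  | .cond e p q => e.cost + 1 + max p.time q.time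
  | .loop _ _ => 0

/-- Only stored values have to be shown to be below U; intermediate values may be larger and are
controlled by the leaf count in `Cmd.straight`. -/
theorem Runs.of_wp_time (hU : 2 ≤ U) {p : Cmd} (hp : p.straight = true) (hs : s.Bdd U)
    (h : wp U p Q s) : Runs U p s p.time Q := by
  induction p generalizing s Q with
  | skip => exact ⟨s, _, .skip s, le_rfl, hs, h⟩
  | assign x e =>
    exact ⟨_, _, .assign x e s (e.fits_of_leaves hU hs (by simpa [Cmd.straight] using hp)), le_rfl,
      hs.setVar h.1, h.2⟩
  | write a i e =>
    simp only [Cmd.straight, Bool.and_eq_true, decide_eq_true_eq] at hp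
    exact ⟨_, _, .write a i e s (i.fits_of_leaves hU hs hp.1) (e.fits_of_leaves hU hs hp.2), le_rfl,
      hs.setCell h.1, h.2⟩
  | seq p q ihp ihq =>
    simp only [Cmd.straight, Bool.and_eq_true] at hp
    exact (ihp hp.1 hs h).seq fun s₁ hB _ hq => ihq hp.2 hB hq
  | cond e p q ihp ihq =>
    simp only [Cmd.straight, Bool.and_eq_true, decide_eq_true_eq] at hp
    refine Runs.cond hU hs hp.1.1 (fun h0 => ?_) fun h0 => ?_
    · exact (ihp hp.1.2 hs (h.1 h0)).mono (le_max_left _ _) fun _ _ _ hq => hq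
    · exact (ihq hp.2 hs (h.2 h0)).mono (le_max_right _ _) fun _ _ _ hq => hq
  | loop e p => simp [Cmd.straight] at hp

theorem Runs.of_wp (hU : 2 ≤ U) {p : Cmd} {b : ℕ} (hp : p.straight = true) (hb : p.time ≤ b)
    (hs : s.Bdd U) (h : wp U p Q s) : Runs U p s b Q :=
  (Runs.of_wp_time hU hp hs h).mono hb fun _ _ _ hq => hq

end WordRAM

/-! ### Sequential evaluation

A state `(P, L)` consists of the profit so far and of the load, that is, the total size so far minus
the overflow so far. -/

namespace Sequential

/-- Adding reward `r` and size `q` under capacity `c` and penalty rate `b`. -/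
def step (b c r q : ℕ) (x : ℤ × ℕ) : ℤ × ℕ :=
  (x.1 + r - b * ((x.2 + q - c : ℕ) : ℤ), min (x.2 + q) c)

/-- The state after the first `k` additions. -/
def run (b c r q : ℕ → ℕ) : ℕ → ℤ × ℕ
  | 0 => (0, 0)
  | k + 1 => step (b k) (c k) (r k) (q k) (run b c r q k)

/-- Cutting the load to c in between does not change the total overflow. Hence the grouping of the
additions within one period is irrelevant. -/
theorem step_step (b c r q r' q' : ℕ) (x : ℤ × ℕ) :
    step b c r' q' (step b c r q x) = step b c (r + r') (q + q') x := by
  have h : x.2 + (q + q') - c = (x.2 + q - c) + (min (x.2 + q) c + q' - c) := by omega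
  ext
  · simp only [step, h]; push_cast; ring
  · simp only [step]; omega

theorem step_zero {b c : ℕ} {x : ℤ × ℕ} (h : x.2 ≤ c) : step b c 0 0 x = x := by
  ext
  · simp [step, Nat.sub_eq_zero_of_le h]
  · simp [step, h]

variable {b c r q r' q' : ℕ → ℕ}

theorem run_congr {k : ℕ} (hr : ∀ j < k, r j = r' j) (hq : ∀ j < k, q j = q' j) :
    run b c r q k = run b c r' q' k := by
  induction k with
  | zero => rfl
  | succ k ih =>
    rw [run, run, ih (fun j hj => hr j (by omega)) (fun j hj => hq j (by omega)), hr k (by omega),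
      hq k (by omega)]

theorem run_load_le {N : ℕ} (hc : ∀ i j, i ≤ j → j < N → c i ≤ c j) {k : ℕ} (hk : k < N) :
    (run b c r q k).2 ≤ c k := by
  cases k with
  | zero => exact Nat.zero_le _
  | succ k => exact (min_le_right _ _).trans (hc k (k + 1) (by omega) hk)

/-- An empty addition could act only on a load above the capacity, which nondecreasing capacities
exclude. -/
theorem run_eq_of_zero {N k : ℕ} (hc : ∀ i j, i ≤ j → j < N → c i ≤ c j) (hk : k ≤ N)
    (hr : ∀ j, k ≤ j → j < N → r j = 0) (hq : ∀ j, k ≤ j → j < N → q j = 0) :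
    run b c r q N = run b c r q k := by
  suffices h : ∀ m, k + m ≤ N → run b c r q (k + m) = run b c r q k by
    simpa [Nat.add_sub_cancel' hk] using h (N - k) (by omega)
  intro m hm
  induction m with
  | zero => rfl
  | succ m ih =>
    rw [← add_assoc, run, hr _ (by omega) (by omega), hq _ (by omega) (by omega),
      step_zero (run_load_le hc (by omega)), ih (by omega)]

/-- The sum of `f` over the first `n` positions whose period is `τ`. -/
def periodSum (t f : ℕ → ℕ) (n τ : ℕ) : ℕ := ∑ j ∈ Finset.range n with t j = τ, f j

theorem periodSum_succ (t f : ℕ → ℕ) (n τ : ℕ) :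
    periodSum t f (n + 1) τ = periodSum t f n τ + if t n = τ then f n else 0 := by
  simp only [periodSum, Finset.sum_filter, Finset.sum_range_succ]

theorem periodSum_eq_zero {t f : ℕ → ℕ} {n τ : ℕ} (h : ∀ j < n, t j ≠ τ) :
    periodSum t f n τ = 0 := by
  rw [periodSum, Finset.filter_false_of_mem, Finset.sum_empty]
  intro j hj; exact h j (Finset.mem_range.1 hj)

/-- Additions may be collected by period. -/
theorem run_comp_eq_run_periodSum {t : ℕ → ℕ} {n T : ℕ}
    (hc : ∀ i j, i ≤ j → j < T → c i ≤ c j) (ht : ∀ i j, i ≤ j → j < n → t i ≤ t j)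
    (hT : ∀ k < n, t k < T) :
    run (fun k => b (t k)) (fun k => c (t k)) r q n =
      run b c (periodSum t r n) (periodSum t q n) T := by
  suffices h : ∀ k ≤ n, run (fun k => b (t k)) (fun k => c (t k)) r q k =
      run b c (periodSum t r k) (periodSum t q k) T from h n le_rfl
  intro k hk
  induction k with
  | zero => exact (run_eq_of_zero hc (Nat.zero_le _) (fun _ _ _ => rfl) fun _ _ _ => rfl).symm
  | succ k ih =>
    have hz : ∀ f : ℕ → ℕ, ∀ m, m ≤ k + 1 → ∀ j, t k + 1 ≤ j → periodSum t f m j = 0 := by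
      intro f m hm j hj
      refine periodSum_eq_zero fun i hi h => ?_
      have := ht i k (by omega) (by omega)
      omega
    have hs : ∀ f : ℕ → ℕ, ∀ j < t k, periodSum t f k j = periodSum t f (k + 1) j := by
      intro f j hj
      rw [periodSum_succ, if_neg (by omega), add_zero]
    have hk' := hT k (by omega)
    -- Periods after t k are still empty, so the run over all T periods can be cut after t k, where
    -- `step_step` absorbs the new item.
    rw [run, ih (by omega),
      run_eq_of_zero hc hk' (fun j hj _ => hz r k (by omega) j hj)
        (fun j hj _ => hz q k (by omega) j hj),
      run_eq_of_zero hc hk' (fun j hj _ => hz r (k + 1) le_rfl j hj)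
        (fun j hj _ => hz q (k + 1) le_rfl j hj),
      run, run, step_step, periodSum_succ, periodSum_succ, if_pos rfl, if_pos rfl,
      run_congr (hs r) (hs q)]

/-- `y` is at least as good as `x` up to a loss of `l / H`, provided that overflow can be bought at
the rate `b`. -/
def Better (b H l : ℕ) (x y : ℤ × ℕ) : Prop :=
  H * (x.1 + b * ((y.2 - x.2 : ℕ) : ℤ)) ≤ H * y.1 + l

/-- The addition to x is first enlarged to (r₁, q₁), where the extra size is worth its penalty, and
then exchanged for (r', q') of at most that size with loss l' / H. Additional overflow of y is paid
from the credit for its larger load. -/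
theorem Better.step {b b' c H l l' r q r' q' r₁ q₁ : ℕ} {x y : ℤ × ℕ} (h : Better b H l x y)
    (hb : b' ≤ b) (hq₁ : q ≤ q₁) (hr₁ : r + b' * (q₁ - q) ≤ r₁) (hr : H * r₁ ≤ H * r' + l')
    (hq : q' ≤ q₁) :
    Better b' H (l + l') (step b' c r q x) (step b' c r' q' y) := by
  -- The overflow of y and its new excess load are covered by the overflow of x, the old excess load
  -- and the extra size.
  have key : (y.2 + q' - c) + (min (y.2 + q') c - min (x.2 + q) c) ≤
      (x.2 + q - c) + (y.2 - x.2) + (q₁ - q) := by omega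
  have h1 := Nat.mul_le_mul_left (H * b') key
  have h2 := Nat.mul_le_mul_left H (Nat.mul_le_mul_right (y.2 - x.2) hb)
  have h3 := Nat.mul_le_mul_left H hr₁
  simp only [Better, Sequential.step] at h ⊢
  zify at h1 h2 h3 hr
  push_cast
  linarith

/-! ### Overflow -/

/-- The overflow in round `t`. -/
def excess (b c r q : ℕ → ℕ) (t : ℕ) : ℕ := (run b c r q t).2 + q t - c t

theorem run_fst (k : ℕ) : (run b c r q k).1 =
    ∑ t ∈ Finset.range k, (r t : ℤ) - ∑ t ∈ Finset.range k, (b t : ℤ) * excess b c r q t := by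
  induction k with
  | zero => simp [run]
  | succ k ih =>
    rw [Finset.sum_range_succ, Finset.sum_range_succ, run, step, ih, excess]; ring

/-- Conservation of size: whatever is added is either still load or has become overflow. -/
theorem run_snd (k : ℕ) : (run b c r q k).2 + ∑ t ∈ Finset.range k, excess b c r q t =
    ∑ t ∈ Finset.range k, q t := by
  induction k with
  | zero => simp [run]
  | succ k ih =>
    rw [Finset.sum_range_succ, Finset.sum_range_succ, ← ih, run, step, excess]
    simp only; omega

/-- The lazily bought overflow is cheapest. -/
theorem sum_excess_le {T : ℕ} {B : ℕ → ℕ} {y : ℕ → ℝ} (hb : Antitone b) (hB : ∀ t, b t ≤ B t)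
    (hy : ∀ t, 0 ≤ y t)
    (hf : ∀ t < T, (∑ s ∈ Finset.range (t + 1), (q s : ℝ)) - ∑ s ∈ Finset.range (t + 1), y s ≤ c t) :
    ∑ t ∈ Finset.range T, (b t : ℝ) * excess b c r q t ≤ ∑ t ∈ Finset.range T, (B t : ℝ) * y t := by
  -- Potential argument: what y has bought in advance of the lazy strategy is valued at the current
  -- rate b k. As the rates fall, this value can only decrease.
  suffices h : ∀ k ≤ T, (∑ t ∈ Finset.range k, (excess b c r q t : ℝ)) ≤ ∑ t ∈ Finset.range k, y t ∧
      ∑ t ∈ Finset.range k, (b t : ℝ) * excess b c r q t + b k * (∑ t ∈ Finset.range k, y t -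
        ∑ t ∈ Finset.range k, (excess b c r q t : ℝ)) ≤ ∑ t ∈ Finset.range k, (B t : ℝ) * y t by
    obtain ⟨h1, h2⟩ := h T le_rfl
    have := mul_nonneg (Nat.cast_nonneg (α := ℝ) (b T)) (sub_nonneg.2 h1)
    linarith
  intro k hk
  induction k with
  | zero => simp
  | succ k ih =>
    obtain ⟨h1, h2⟩ := ih (by omega)
    have hfk := hf k (by omega)
    have hs : ((run b c r q k).2 : ℝ) + ∑ t ∈ Finset.range k, (excess b c r q t : ℝ) =
        ∑ t ∈ Finset.range k, (q t : ℝ) := by exact_mod_cast run_snd (b := b) (c := c) (r := r) k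
    have hyk := hy k
    have hle : (∑ t ∈ Finset.range (k + 1), (excess b c r q t : ℝ)) ≤
        ∑ t ∈ Finset.range (k + 1), y t := by
      rw [Finset.sum_range_succ] at hfk ⊢
      rw [Finset.sum_range_succ] at hfk ⊢
      -- Without overflow the advance of y does not shrink. With overflow the load becomes exactly c
      -- k, and the k-th constraint on y gives the bound.
      rcases le_total ((run b c r q k).2 + q k) (c k) with h | h
      · have : excess b c r q k = 0 := Nat.sub_eq_zero_of_le h
        rw [this]; push_cast; linarith
      · have : (excess b c r q k : ℝ) = (run b c r q k).2 + q k - c k := by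
          rw [excess]; push_cast [h]; ring
        rw [this]; linarith
    refine ⟨hle, ?_⟩
    have e1 : (b (k + 1) : ℝ) * (∑ t ∈ Finset.range (k + 1), y t -
        ∑ t ∈ Finset.range (k + 1), (excess b c r q t : ℝ)) ≤ b k * (∑ t ∈ Finset.range (k + 1), y t -
        ∑ t ∈ Finset.range (k + 1), (excess b c r q t : ℝ)) :=
      mul_le_mul_of_nonneg_right (by exact_mod_cast hb (Nat.le_succ k)) (sub_nonneg.2 hle)
    have e2 : (b k : ℝ) * y k ≤ B k * y k :=
      mul_le_mul_of_nonneg_right (by exact_mod_cast hB k) hyk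
    rw [Finset.sum_range_succ, Finset.sum_range_succ (fun t => (B t : ℝ) * y t)]
    rw [Finset.sum_range_succ, Finset.sum_range_succ (fun t => (excess b c r q t : ℝ))] at e1 ⊢
    linarith

/-- The lazily bought overflow can be bought at the rates `B` when `b t` is one of the rates up to
`t`. -/
theorem exists_overflow (T : ℕ) {B : ℕ → ℕ} (hB : ∀ t, ∃ s ≤ t, B s = b t) :
    ∃ y : ℕ → ℝ, (∀ t, 0 ≤ y t) ∧
      (∀ t < T, (∑ s ∈ Finset.range (t + 1), (q s : ℝ)) - ∑ s ∈ Finset.range (t + 1), y s ≤ c t) ∧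
      ∑ t ∈ Finset.range T, (B t : ℝ) * y t =
        ∑ t ∈ Finset.range T, (b t : ℝ) * excess b c r q t := by
  choose σ hσ hBσ using hB
  set x := excess b c r q
  -- The overflow of round t is bought in period σ t ≤ t, whose rate is the one charged; this is
  -- early enough for every constraint from t on.
  refine ⟨fun s => ∑ t ∈ Finset.range T with σ t = s, (x t : ℝ), fun t => by positivity,
    fun t ht => ?_, ?_⟩
  · have h1 : ∑ u ∈ Finset.range (t + 1), (x u : ℝ) ≤
        ∑ s ∈ Finset.range (t + 1), ∑ u ∈ Finset.range T with σ u = s, (x u : ℝ) := by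
      rw [← Finset.sum_fiberwise_of_maps_to (s := Finset.range (t + 1)) (t := Finset.range (t + 1))
        (g := σ)]
      · refine Finset.sum_le_sum fun s _ => Finset.sum_le_sum_of_subset_of_nonneg ?_ ?_
        · refine Finset.filter_subset_filter _ fun u hu => ?_
          simp only [Finset.mem_range] at hu ⊢; omega
        · intros; positivity
      · intro u hu
        have := hσ u
        simp only [Finset.mem_range] at hu ⊢; omega
    have h2 : ((run b c r q (t + 1)).2 : ℝ) + ∑ u ∈ Finset.range (t + 1), (x u : ℝ) =
        ∑ u ∈ Finset.range (t + 1), (q u : ℝ) := by exact_mod_cast run_snd (t + 1)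
    have h3 : ((run b c r q (t + 1)).2 : ℝ) ≤ c t := by exact_mod_cast min_le_right _ _
    linarith
  · have h1 : ∑ t ∈ Finset.range T, (b t : ℝ) * x t =
        ∑ s ∈ Finset.range T, ∑ t ∈ Finset.range T with σ t = s, (b t : ℝ) * x t := by
      rw [Finset.sum_fiberwise_of_maps_to]
      intro u hu
      have := hσ u
      simp only [Finset.mem_range] at hu ⊢; omega
    rw [h1]
    refine Finset.sum_congr rfl fun s _ => ?_
    rw [Finset.mul_sum]
    refine Finset.sum_congr rfl fun t ht => ?_
    rw [← (Finset.mem_filter.1 ht).2, hBσ]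

end Sequential

/-! ### Values of sets of items -/

namespace MPBKPS

open Sequential

/-- Prefix minimum. -/
def prefixMin (f : ℕ → ℕ) : ℕ → ℕ
  | 0 => f 0
  | t + 1 => min (prefixMin f t) (f (t + 1))

theorem prefixMin_antitone (f : ℕ → ℕ) : Antitone (prefixMin f) :=
  antitone_nat_of_succ_le fun _ => min_le_left _ _

theorem prefixMin_le (f : ℕ → ℕ) : ∀ t, prefixMin f t ≤ f t
  | 0 => le_rfl
  | _ + 1 => min_le_right _ _

theorem exists_prefixMin_eq (f : ℕ → ℕ) (t : ℕ) : ∃ s ≤ t, f s = prefixMin f t := by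
  induction t with
  | zero => exact ⟨0, le_rfl, rfl⟩
  | succ t ih =>
    rcases le_total (prefixMin f t) (f (t + 1)) with h | h
    · obtain ⟨s, hs, e⟩ := ih
      exact ⟨s, by omega, by rw [e, prefixMin, min_eq_left h]⟩
    · exact ⟨t + 1, le_rfl, by rw [prefixMin, min_eq_right h]⟩

theorem cells_of_lt {m : ℕ} (f : Fin m → ℕ) {j : ℕ} (h : j < m) : cells f j = f ⟨j, h⟩ := dif_pos h

theorem cells_fin {m : ℕ} (f : Fin m → ℕ) (j : Fin m) : cells f j = f j := dif_pos j.2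

variable {n T : ℕ} (I : MPBKPS n T)

/-- The lowest penalty rate up to period `t`. -/
def rate (t : ℕ) : ℕ := prefixMin (cells I.B) t

/-- The total of `f` over the items of `S` with deadline `t`. -/
def dueSum (f : Fin n → ℕ) (S : Finset (Fin n)) (t : ℕ) : ℕ := ∑ i ∈ S with (I.d i : ℕ) = t, f i

/-- The largest profit with the set `S` of items. -/
def val (S : Finset (Fin n)) : ℤ :=
  (run I.rate (cells I.c) (I.dueSum I.r S) (I.dueSum I.q S) T).1

theorem sum_range_dueSum (f : Fin n → ℕ) (S : Finset (Fin n)) :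
    ∑ t ∈ Finset.range T, I.dueSum f S t = ∑ i ∈ S, f i := by
  unfold dueSum
  rw [Finset.sum_fiberwise_of_maps_to]
  intro i _; simp

theorem sum_range_succ_dueSum (f : Fin n → ℕ) (S : Finset (Fin n)) (t : Fin T) :
    ∑ s ∈ Finset.range (t + 1), I.dueSum f S s = ∑ i ∈ S with I.d i ≤ t, f i := by
  unfold dueSum
  rw [← Finset.sum_fiberwise_of_maps_to (s := S.filter fun i => I.d i ≤ t)
    (t := Finset.range (t + 1)) (g := fun i => (I.d i : ℕ))]
  · refine Finset.sum_congr rfl fun s hs => Finset.sum_congr ?_ fun _ _ => rfl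
    ext i
    have := Finset.mem_range.1 hs
    simp only [Finset.mem_filter, Fin.le_def, and_assoc]
    constructor
    · rintro ⟨h1, h2⟩; exact ⟨h1, by omega, h2⟩
    · rintro ⟨h1, _, h2⟩; exact ⟨h1, h2⟩
  · intro i hi
    have := (Finset.mem_filter.1 hi).2
    simp only [Fin.le_def] at this
    simp only [Finset.mem_range]; omega

theorem sum_Iic_eq_range (y : ℕ → ℝ) (t : Fin T) :
    ∑ s ∈ Finset.Iic t, y s = ∑ s ∈ Finset.range (t + 1), y s := by
  refine Finset.sum_bij (fun s _ => (s : ℕ)) ?_ ?_ ?_ ?_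
  · intro s hs; simp only [Finset.mem_Iic, Fin.le_def] at hs; simp; omega
  · intro a _ b _ h; exact Fin.ext h
  · intro s hs
    have hs := Finset.mem_range.1 hs
    exact ⟨⟨s, by omega⟩, by simp only [Finset.mem_Iic, Fin.le_def]; omega, rfl⟩
  · intros; rfl

theorem feasible_iff (S : Finset (Fin n)) (y : ℕ → ℝ) (hy : ∀ t, 0 ≤ y t) :
    I.Feasible S (fun t => y t) ↔ ∀ t < T, (∑ s ∈ Finset.range (t + 1), (I.dueSum I.q S s : ℝ)) -
      ∑ s ∈ Finset.range (t + 1), y s ≤ cells I.c t := by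
  have key : ∀ t : Fin T, (∑ s ∈ Finset.range (t + 1), (I.dueSum I.q S s : ℝ)) =
      ∑ i ∈ S with I.d i ≤ t, (I.q i : ℝ) := fun t => by
    exact_mod_cast I.sum_range_succ_dueSum I.q S t
  constructor
  · intro h t ht
    have := h.2 ⟨t, ht⟩
    rwa [sum_Iic_eq_range, ← key, ← cells_fin I.c] at this
  · intro h
    refine ⟨fun t => hy t, fun t => ?_⟩
    have := h t t.2
    rwa [key, cells_fin, ← sum_Iic_eq_range] at this

theorem profit_eq (S : Finset (Fin n)) (y : ℕ → ℝ) : I.profit S (fun t => y t) =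
    ∑ t ∈ Finset.range T, (I.dueSum I.r S t : ℝ) -
      ∑ t ∈ Finset.range T, (cells I.B t : ℝ) * y t := by
  have h1 : ∑ t ∈ Finset.range T, (I.dueSum I.r S t : ℝ) = ∑ i ∈ S, (I.r i : ℝ) := by
    exact_mod_cast I.sum_range_dueSum I.r S
  rw [h1, profit, ← Fin.sum_univ_eq_sum_range (fun t => (cells I.B t : ℝ) * y t)]
  simp only [cells_fin]

theorem val_eq (S : Finset (Fin n)) : (I.val S : ℝ) =
    ∑ t ∈ Finset.range T, (I.dueSum I.r S t : ℝ) - ∑ t ∈ Finset.range T,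
      (I.rate t : ℝ) * excess I.rate (cells I.c) (I.dueSum I.r S) (I.dueSum I.q S) t := by
  rw [val, run_fst]; push_cast; rfl

theorem profit_le_val {S : Finset (Fin n)} {y : Fin T → ℝ} (h : I.Feasible S y) :
    I.profit S y ≤ I.val S := by
  obtain ⟨y', hy, rfl⟩ : ∃ y' : ℕ → ℝ, (∀ t, 0 ≤ y' t) ∧ y = fun t : Fin T => y' t := by
    refine ⟨fun t => if h : t < T then y ⟨t, h⟩ else 0, fun t => ?_, ?_⟩
    · dsimp only; split
      · exact h.1 _
      · exact le_rfl
    · funext t; simp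
  rw [profit_eq, val_eq]
  have := sum_excess_le (r := I.dueSum I.r S) (prefixMin_antitone (cells I.B))
    (prefixMin_le (cells I.B)) hy ((I.feasible_iff S y' hy).1 h)
  simp only [rate] at this ⊢
  unfold rate
  linarith

theorem exists_profit_eq_val (S : Finset (Fin n)) :
    ∃ y, I.Feasible S y ∧ I.profit S y = I.val S := by
  obtain ⟨y, hy, hf, hc⟩ := exists_overflow (c := cells I.c) (r := I.dueSum I.r S)
    (q := I.dueSum I.q S) T (exists_prefixMin_eq (cells I.B))
  refine ⟨fun t => y t, (I.feasible_iff S y hy).2 hf, ?_⟩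
  rw [profit_eq, val_eq, hc]; rfl

/-- Eliminates the real overflows: from here on only the integers `val S` are compared. -/
theorem isApprox_of_val {α : ℝ} {S : Finset (Fin n)} (h : ∀ S', (I.val S' : ℝ) ≤ α * I.val S) :
    I.IsApprox α S := by
  obtain ⟨y, hy, e⟩ := I.exists_profit_eq_val S
  exact ⟨y, hy, fun S' y' h' => (I.profit_le_val h').trans (e ▸ h S')⟩

end MPBKPS

/-! ### Bundling of small items

Positions `0, 1, …` carry items with periods `t`, rewards `r`, sizes `q` and penalty rates `b`. An
item is groupable if it is worth taking even at the penalty rate or if its reward is at most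
`V / H`. Consecutive groupable items of a period are merged into bundles of reward about `V / H`; a
bundle is identified with the position of its first item. -/

namespace Sequential

/-- The item is worth taking even if all of it is overflow. -/
def Forced (r q b : ℕ → ℕ) (k : ℕ) : Prop := b k * q k ≤ r k

/-- The item may be merged with others. -/
def Groupable (r q b : ℕ → ℕ) (H V k : ℕ) : Prop := Forced r q b k ∨ r k * H ≤ V

instance (r q b : ℕ → ℕ) (k : ℕ) : Decidable (Forced r q b k) := inferInstanceAs (Decidable (_ ≤ _))
instance (r q b : ℕ → ℕ) (H V k : ℕ) : Decidable (Groupable r q b H V k) :=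
  inferInstanceAs (Decidable (_ ∨ _))

/-- The first `k` items are distributed over bundles: item `j` belongs to the bundle `bid j`, and
the bundles have total rewards `R` and total sizes `Q`. -/
structure Bundled (t r q b : ℕ → ℕ) (H V k : ℕ) (bid R Q : ℕ → ℕ) : Prop where
  le : ∀ j < k, bid j ≤ j
  period : ∀ j < k, t (bid j) = t j
  idem : ∀ j < k, bid (bid j) = bid j
  sum_r : ∀ z < k, R z = ∑ j ∈ Finset.range k with bid j = z, r j
  sum_q : ∀ z < k, Q z = ∑ j ∈ Finset.range k with bid j = z, q j
  single : ∀ j < k, ¬ Groupable r q b H V j → bid j = j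
  group : ∀ j < k, Groupable r q b H V j → Groupable r q b H V (bid j)
  mono : ∀ i j, i < j → j < k → t i = t j → Groupable r q b H V i → Groupable r q b H V j →
    bid i ≤ bid j
  small : ∀ z < k, Groupable r q b H V z → R z * H ≤ 2 * V ∨ ∀ j < k, bid j = z → Forced r q b j
  full : ∀ i j, i < j → j < k → t i = t j → Groupable r q b H V i → Groupable r q b H V j →
    bid i < bid j → V < R (bid i) * H
  forced : ∀ i j, i < k → j < k → t i = t j → Forced r q b j → bid j ≤ i

/-- `cur` is `z + 1` for the bundle `z` of period `τ` that was opened last, and `0` if there is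
none. -/
structure OpenBundle (t r q b : ℕ → ℕ) (H V k : ℕ) (bid : ℕ → ℕ) (τ cur : ℕ) : Prop where
  zero : cur = 0 → ∀ j < k, Groupable r q b H V j → t j ≠ τ
  succ : ∀ z, cur = z + 1 → z < k ∧ bid z = z ∧ Groupable r q b H V z ∧ t z = τ ∧
    ∀ j < k, Groupable r q b H V j → t j = τ → bid j ≤ z

variable {t r q b : ℕ → ℕ} {H V k τ cur : ℕ} {bid R Q : ℕ → ℕ}

theorem Bundled.zero : Bundled t r q b H V 0 bid R Q := by
  constructor <;> intros <;> omega

theorem OpenBundle.new (h : ∀ j < k, t j ≠ τ) : OpenBundle t r q b H V k bid τ 0 :=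
  ⟨fun _ j hj _ => h j hj, fun _ hz => by omega⟩

theorem sum_filter_update {f : ℕ → ℕ} {lead y : ℕ} :
    ∑ j ∈ Finset.range (k + 1) with Function.update bid k lead j = y, f j =
      ∑ j ∈ Finset.range k with bid j = y, f j + if lead = y then f k else 0 := by
  rw [Finset.sum_filter, Finset.sum_range_succ, Finset.sum_filter, Function.update_self]
  congr 1
  refine Finset.sum_congr rfl fun j hj => ?_
  rw [Function.update_of_ne (Finset.mem_range.1 hj).ne]

theorem sum_filter_eq_zero {f : ℕ → ℕ} {y : ℕ} (h : ∀ j < k, bid j ≠ y) :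
    ∑ j ∈ Finset.range k with bid j = y, f j = 0 := by
  rw [Finset.filter_false_of_mem, Finset.sum_empty]
  intro j hj; exact h j (Finset.mem_range.1 hj)

/-- The earlier bundles of a period are full. -/
theorem Bundled.lt_of_openBundle (h : Bundled t r q b H V k bid R Q) {z : ℕ}
    (ho : OpenBundle t r q b H V k bid τ (z + 1)) {i : ℕ} (hi : i < k) (ht : t i = τ)
    (hg : Groupable r q b H V i) (hlt : bid i < z) : V < R (bid i) * H := by
  obtain ⟨hz, hbz, hgz, htz, -⟩ := ho.succ z rfl
  rcases lt_trichotomy i z with hiz | rfl | hiz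
  · exact h.full i z hiz hz (ht.trans htz.symm) hg hgz (by omega)
  · omega
  · have := h.mono z i hiz hi (htz.trans ht.symm) hgz hg
    omega

/-- The next item is added to the open bundle. -/
theorem Bundled.join (h : Bundled t r q b H V k bid R Q) {z : ℕ}
    (ho : OpenBundle t r q b H V k bid (t k) (z + 1))
    (hs : ∀ j < k, t j = t k → Forced r q b k → Forced r q b j)
    (hg : Groupable r q b H V k) (hj : Forced r q b k ∨ R z * H ≤ V) {R' Q' : ℕ → ℕ}
    (hR : ∀ j, R' j = if j = z then R z + r k else if j = k then 0 else R j)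
    (hQ : ∀ j, Q' j = if j = z then Q z + q k else if j = k then 0 else Q j) :
    Bundled t r q b H V (k + 1) (Function.update bid k z) R' Q' ∧
      OpenBundle t r q b H V (k + 1) (Function.update bid k z) (t k) (z + 1) := by
  obtain ⟨hz, hbz, hgz, htz, hmz⟩ := ho.succ z rfl
  have ek : Function.update bid k z k = z := Function.update_self ..
  have ej : ∀ j < k, Function.update bid k z j = bid j := fun j hj =>
    Function.update_of_ne hj.ne ..
  have hle := h.le
  have hRle : ∀ j < k, R j ≤ R' j := fun j hj => by
    rw [hR]; split_ifs <;> first | omega | (subst_vars; omega)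
  have cases : ∀ j < k + 1, j < k ∨ j = k := fun j hj => by omega
  have hsum : ∀ (f F F' : ℕ → ℕ), (∀ y < k, F y = ∑ j ∈ Finset.range k with bid j = y, f j) →
      (∀ j, F' j = if j = z then F z + f k else if j = k then 0 else F j) → ∀ y < k + 1,
      F' y = ∑ j ∈ Finset.range (k + 1) with Function.update bid k z j = y, f j := by
    intro f F F' hF hF' y hy
    rw [sum_filter_update, hF']
    rcases cases y hy with hy | rfl
    · by_cases hyz : y = z
      · subst hyz; simp [hF y hy]
      · rw [if_neg hyz, if_neg hy.ne, if_neg (Ne.symm hyz), hF y hy, add_zero]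
    · rw [if_neg hz.ne', if_pos rfl, if_neg hz.ne,
        sum_filter_eq_zero fun j hj => ((hle j hj).trans_lt hj).ne]
  refine ⟨⟨?_, ?_, ?_, hsum r R R' h.sum_r hR, hsum q Q Q' h.sum_q hQ, ?_, ?_, ?_, ?_, ?_, ?_⟩,
    by simp, ?_⟩
  · intro j hj
    rcases cases j hj with hj | rfl
    · rw [ej j hj]; exact hle j hj
    · rw [ek]; exact hz.le
  · intro j hj
    rcases cases j hj with hj | rfl
    · rw [ej j hj]; exact h.period j hj
    · rw [ek]; exact htz
  · intro j hj
    rcases cases j hj with hj | rfl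
    · rw [ej j hj, ej _ ((hle j hj).trans_lt hj)]; exact h.idem j hj
    · rw [ek, ej z hz]; exact hbz
  · intro j hj hn
    rcases cases j hj with hj | rfl
    · rw [ej j hj]; exact h.single j hj hn
    · exact absurd hg hn
  · intro j hj hn
    rcases cases j hj with hj | rfl
    · rw [ej j hj]; exact h.group j hj hn
    · rw [ek]; exact hgz
  · intro i j hij hj htij hgi hgj
    rcases cases j hj with hj | rfl
    · rw [ej j hj, ej i (by omega)]; exact h.mono i j hij hj htij hgi hgj
    · rw [ek, ej i hij]; exact hmz i hij hgi htij
  · intro y hy hgy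
    rcases cases y hy with hy | rfl
    · by_cases hyz : y = z
      · subst hyz
        -- Forced items come first in a period, so a bundle that a forced item joins consists of
        -- forced items. Otherwise the bundle had reward at most V / H and gains at most V / H.
        by_cases hf : Forced r q b k
        · right
          intro j hj hjz
          rcases cases j hj with hj | rfl
          · rw [ej j hj] at hjz
            exact hs j hj (by rw [← h.period j hj, hjz, htz]) hf
          · exact hf
        · left
          rw [hR, if_pos rfl, Nat.add_mul, two_mul]
          exact Nat.add_le_add (hj.resolve_left hf) (hg.resolve_left hf)
      · rcases h.small y hy hgy with h' | h'
        · left; rwa [hR, if_neg hyz, if_neg hy.ne]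
        · right
          intro j hj hjy
          rcases cases j hj with hj | rfl
          · rw [ej j hj] at hjy; exact h' j hj hjy
          · rw [ek] at hjy; exact absurd hjy.symm hyz
    · left
      rw [hR, if_neg hz.ne', if_pos rfl]; simp
  · intro i j hij hj htij hgi hgj hlt
    have hi : i < k := by omega
    rw [ej i hi] at hlt ⊢
    refine lt_of_lt_of_le ?_ (Nat.mul_le_mul_right H (hRle _ ((hle i hi).trans_lt hi)))
    rcases cases j hj with hj | rfl
    · rw [ej j hj] at hlt
      exact h.full i j hij hj htij hgi hgj hlt
    · rw [ek] at hlt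
      exact h.lt_of_openBundle ho hi htij hgi hlt
  · intro i j hi hj htij hfj
    rcases cases j hj with hj | rfl
    · rw [ej j hj]
      rcases cases i hi with hi | rfl
      · exact h.forced i j hi hj htij hfj
      · have := hle j hj; omega
    · rw [ek]
      rcases cases i hi with hi | rfl
      · have := h.forced i z hi hz (htij.trans htz.symm) (hs z hz htz hfj)
        omega
      · exact hz.le
  · rintro _ ⟨rfl⟩
    refine ⟨by omega, by rw [ej z hz, hbz], hgz, htz, fun j hj hgj htj => ?_⟩
    rcases cases j hj with hj | rfl
    · rw [ej j hj]; exact hmz j hj hgj htj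
    · rw [ek]

/-- The next item starts a bundle. -/
theorem Bundled.start (h : Bundled t r q b H V k bid R Q)
    (ho : OpenBundle t r q b H V k bid (t k) cur)
    (hs : ∀ j < k, t j = t k → Forced r q b k → Forced r q b j)
    (hj : Groupable r q b H V k → ∀ z, cur = z + 1 → ¬ (Forced r q b k ∨ R z * H ≤ V))
    {R' Q' : ℕ → ℕ} (hR : ∀ j, R' j = if j = k then r k else R j)
    (hQ : ∀ j, Q' j = if j = k then q k else Q j) :
    Bundled t r q b H V (k + 1) (Function.update bid k k) R' Q' ∧
      OpenBundle t r q b H V (k + 1) (Function.update bid k k) (t k)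
        (if Groupable r q b H V k then k + 1 else cur) := by
  have ek : Function.update bid k k k = k := Function.update_self ..
  have ej : ∀ j < k, Function.update bid k k j = bid j := fun j hj =>
    Function.update_of_ne hj.ne ..
  have hle := h.le
  have cases : ∀ j < k + 1, j < k ∨ j = k := fun j hj => by omega
  have hsum : ∀ (f F F' : ℕ → ℕ), (∀ y < k, F y = ∑ j ∈ Finset.range k with bid j = y, f j) →
      (∀ j, F' j = if j = k then f k else F j) → ∀ y < k + 1,
      F' y = ∑ j ∈ Finset.range (k + 1) with Function.update bid k k j = y, f j := by
    intro f F F' hF hF' y hy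
    rw [sum_filter_update, hF']
    rcases cases y hy with hy | rfl
    · rw [if_neg hy.ne, if_neg hy.ne', hF y hy, add_zero]
    · rw [if_pos rfl, if_pos rfl,
        sum_filter_eq_zero fun j hj => ((hle j hj).trans_lt hj).ne, zero_add]
  have hR' : ∀ j < k, R' j = R j := fun j hj => by rw [hR, if_neg hj.ne]
  refine ⟨⟨?_, ?_, ?_, hsum r R R' h.sum_r hR, hsum q Q Q' h.sum_q hQ, ?_, ?_, ?_, ?_, ?_, ?_⟩,
    ?_, ?_⟩
  · intro j hj
    rcases cases j hj with hj | rfl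
    · rw [ej j hj]; exact hle j hj
    · rw [ek]
  · intro j hj
    rcases cases j hj with hj | rfl
    · rw [ej j hj]; exact h.period j hj
    · rw [ek]
  · intro j hj
    rcases cases j hj with hj | rfl
    · rw [ej j hj, ej _ ((hle j hj).trans_lt hj)]; exact h.idem j hj
    · rw [ek, ek]
  · intro j hj hn
    rcases cases j hj with hj | rfl
    · rw [ej j hj]; exact h.single j hj hn
    · exact ek
  · intro j hj hn
    rcases cases j hj with hj | rfl
    · rw [ej j hj]; exact h.group j hj hn
    · rwa [ek]
  · intro i j hij hj htij hgi hgj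
    rcases cases j hj with hj | rfl
    · rw [ej j hj, ej i (by omega)]; exact h.mono i j hij hj htij hgi hgj
    · rw [ek, ej i hij]; exact (hle i hij).trans hij.le
  · intro y hy hgy
    rcases cases y hy with hy | rfl
    · rw [hR' y hy]
      refine (h.small y hy hgy).imp_right fun h' j hj hjy => ?_
      rcases cases j hj with hj | rfl
      · rw [ej j hj] at hjy; exact h' j hj hjy
      · rw [ek] at hjy; omega
    · rcases hgy with hf | hsm
      · right
        intro j hj hjy
        rcases cases j hj with hj | rfl
        · rw [ej j hj] at hjy
          have := hle j hj; omega
        · exact hf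
      · left
        rw [hR, if_pos rfl]; omega
  · intro i j hij hj htij hgi hgj hlt
    have hi : i < k := by omega
    rw [ej i hi] at hlt ⊢
    rw [hR' _ ((hle i hi).trans_lt hi)]
    rcases cases j hj with hj | rfl
    · rw [ej j hj] at hlt
      exact h.full i j hij hj htij hgi hgj hlt
    · cases cur with
      | zero => exact absurd htij (ho.zero rfl i hi hgi)
      | succ z =>
        -- A groupable item starts a bundle only if the open bundle refused it, hence that bundle
        -- has reward above V / H.
        have hz := hj hgj z rfl
        have := (ho.succ z rfl).2.2.2.2 i hi hgi htij
        rcases this.lt_or_eq with hlt | heq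
        · exact h.lt_of_openBundle ho hi htij hgi hlt
        · rw [heq]; exact not_le.1 fun h' => hz (.inr h')
  · intro i j hi hj htij hfj
    rcases cases j hj with hj | rfl
    · rw [ej j hj]
      rcases cases i hi with hi | rfl
      · exact h.forced i j hi hj htij hfj
      · have := hle j hj; omega
    · rw [ek]
      rcases cases i hi with hi | rfl
      · have hfi := hs i hi htij hfj
        cases cur with
        | zero => exact absurd htij (ho.zero rfl i hi (.inl hfi))
        | succ z => exact absurd (.inl hfj) (hj (.inl hfj) z rfl)
      · exact le_rfl
  · intro h0 j hj hgj
    rcases cases j hj with hj | rfl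
    · refine ho.zero ?_ j hj hgj
      by_contra hne
      split_ifs at h0; exact hne h0
    · rw [if_pos hgj] at h0; omega
  · intro z hz
    split_ifs at hz with hgk
    · obtain rfl : k = z := by omega
      refine ⟨by omega, ek, hgk, rfl, fun j hj _ _ => ?_⟩
      rcases cases j hj with hj | rfl
      · rw [ej j hj]; have := hle j hj; omega
      · rw [ek]
    · obtain ⟨hzk, hbz, hgz, htz, hmz⟩ := ho.succ z hz
      refine ⟨by omega, by rw [ej z hzk, hbz], hgz, htz, fun j hj hgj htj => ?_⟩
      rcases cases j hj with hj | rfl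
      · rw [ej j hj]; exact hmz j hj hgj htj
      · exact absurd hgj hgk

/-! ### Restriction to unions of bundles -/

/-- The densest items of large enough total size have the largest reward. -/
theorem sum_le_sum_of_density {ι : Type*} [DecidableEq ι] {X Y : Finset ι} {r q : ι → ℕ}
    (hq : ∀ i ∈ X, 0 < q i) (hd : ∀ i ∈ X, i ∉ Y → ∀ j ∈ Y, j ∉ X → r i * q j ≤ r j * q i)
    (h : ∑ i ∈ X, q i ≤ ∑ i ∈ Y, q i) : ∑ i ∈ X, r i ≤ ∑ i ∈ Y, r i := by
  have split : ∀ f : ι → ℕ, ∑ i ∈ X, f i = ∑ i ∈ X \ Y, f i + ∑ i ∈ X ∩ Y, f i ∧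
      ∑ i ∈ Y, f i = ∑ i ∈ Y \ X, f i + ∑ i ∈ X ∩ Y, f i := fun f =>
    ⟨by rw [add_comm, Finset.sum_inter_add_sum_sdiff],
      by rw [add_comm, Finset.inter_comm, Finset.sum_inter_add_sum_sdiff]⟩
  have hq' : ∑ i ∈ X \ Y, q i ≤ ∑ i ∈ Y \ X, q i := by
    have := (split q).1; have := (split q).2; omega
  suffices ∑ i ∈ X \ Y, r i ≤ ∑ i ∈ Y \ X, r i by
    have := (split r).1; have := (split r).2; omega
  -- The density inequality summed over all pairs; together with `hq'` the size of Y \ X can be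
  -- cancelled.
  have hm : (∑ i ∈ X \ Y, r i) * ∑ j ∈ Y \ X, q j ≤ (∑ j ∈ Y \ X, r j) * ∑ i ∈ X \ Y, q i := by
    rw [Finset.sum_mul_sum, Finset.sum_mul_sum, Finset.sum_comm]
    refine Finset.sum_le_sum fun j hj => Finset.sum_le_sum fun i hi => ?_
    rw [Finset.mem_sdiff] at hi hj
    exact hd i hi.1 hi.2 j hj.1 hj.2
  rcases Nat.eq_zero_or_pos (∑ j ∈ Y \ X, q j) with h0 | hpos
  · have hx : X \ Y = ∅ := by
      by_contra hne
      obtain ⟨i, hi⟩ := Finset.nonempty_iff_ne_empty.2 hne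
      have h1 := Finset.single_le_sum (f := q) (fun _ _ => Nat.zero_le _) hi
      have h2 := hq i (Finset.mem_sdiff.1 hi).1
      omega
    simp [hx]
  · exact Nat.le_of_mul_le_mul_right (hm.trans (Nat.mul_le_mul_left _ hq')) hpos

/-- Bundles do not cross periods, so the items of a period can be summed along the fibres of `bid`.
-/
theorem periodSum_bundles {n : ℕ} (hle : ∀ j < n, bid j ≤ j) (hp : ∀ j < n, t (bid j) = t j)
    {f F : ℕ → ℕ} (hF : ∀ z < n, F z = ∑ j ∈ Finset.range n with bid j = z, f j) (a : ℕ → Prop)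
    [DecidablePred a] (τ : ℕ) :
    periodSum t (fun z => if a z then F z else 0) n τ =
      periodSum t (fun j => if a (bid j) then f j else 0) n τ := by
  unfold periodSum
  rw [← Finset.sum_fiberwise_of_maps_to (s := (Finset.range n).filter fun j => t j = τ)
    (t := (Finset.range n).filter fun j => t j = τ) (g := bid)
    (f := fun j => if a (bid j) then f j else 0)]
  · refine Finset.sum_congr rfl fun z hz => ?_
    simp only [Finset.mem_filter, Finset.mem_range] at hz
    rw [Finset.filter_filter]
    dsimp only
    by_cases ha : a z
    · rw [if_pos ha, hF z hz.1]
      refine Finset.sum_congr ?_ fun j hj => ?_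
      · ext j
        simp only [Finset.mem_filter, Finset.mem_range]
        constructor
        · rintro ⟨h1, h2⟩; exact ⟨h1, by rw [← hp j h1, h2, hz.2], h2⟩
        · rintro ⟨h1, _, h2⟩; exact ⟨h1, h2⟩
      · have := (Finset.mem_filter.1 hj).2.2
        rw [if_pos (this ▸ ha)]
    · rw [if_neg ha, Finset.sum_eq_zero]
      intro j hj
      have := (Finset.mem_filter.1 hj).2.2
      rw [if_neg (this ▸ ha)]
  · intro j hj
    simp only [Finset.mem_filter, Finset.mem_range] at hj ⊢
    exact ⟨(hle j hj.1).trans_lt hj.1, by rw [hp j hj.1, hj.2]⟩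

/-- Within a period, a union of bundles replaces a set of groupable items that contains all forced
ones. -/
theorem Bundled.exists_threshold {n : ℕ} (h : Bundled t r q b H V n bid R Q)
    (hq : ∀ j < n, 0 < q j) (hd : ∀ i j, i < j → j < n → t i = t j → r j * q i ≤ r i * q j) (τ : ℕ)
    {G X : Finset ℕ} (hG : ∀ j, j ∈ G ↔ j < n ∧ t j = τ ∧ Groupable r q b H V j) (hX : X ⊆ G)
    (hF : ∀ j ∈ G, Forced r q b j → j ∈ X) :
    ∃ m, (∑ j ∈ G with bid j < m, q j ≤ ∑ j ∈ X, q j) ∧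
      H * ∑ j ∈ X, r j ≤ H * ∑ j ∈ G with bid j < m, r j + 2 * V := by
  -- If all groupable items of the period together are no larger than X, all of them are taken.
  by_cases hall : ∀ m, ∑ j ∈ G with bid j < m, q j ≤ ∑ j ∈ X, q j
  · refine ⟨n, hall n, ?_⟩
    have : G.filter (fun j => bid j < n) = G := Finset.filter_true_of_mem fun j hj =>
      (h.le j ((hG j).1 hj).1).trans_lt ((hG j).1 hj).1
    rw [this]
    exact (Nat.mul_le_mul_left H (Finset.sum_le_sum_of_subset hX)).trans (Nat.le_add_right _ _)
  push Not at hall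
  -- m is the critical bundle: the bundles before it fit into the size of X, and with it they do
  -- not.
  obtain ⟨m, hm⟩ : ∃ m, (∑ j ∈ X, q j < ∑ j ∈ G with bid j < m + 1, q j) ∧
      ∑ j ∈ G with bid j < m, q j ≤ ∑ j ∈ X, q j := by
    classical
    have hmin := fun m => Nat.find_min hall (m := m)
    have hspec := Nat.find_spec hall
    generalize Nat.find hall = N at hmin hspec
    cases N with
    | zero => simp at hspec
    | succ m => exact ⟨m, hspec, not_lt.1 (hmin m m.lt_succ_self)⟩
  refine ⟨m, hm.2, ?_⟩
  set Y := G.filter fun j => bid j < m + 1 with hY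
  set Z := (Finset.range n).filter fun j => bid j = m with hZ
  have hYZ : ∀ f : ℕ → ℕ, ∑ j ∈ Y, f j ≤ ∑ j ∈ G with bid j < m, f j + ∑ j ∈ Z, f j := by
    intro f
    refine (Finset.sum_le_sum_of_subset (t := (G.filter fun j => bid j < m) ∪ Z) ?_).trans
      ((Nat.le_add_right _ _).trans (Finset.sum_union_inter).le)
    intro j hj
    rw [hY, Finset.mem_filter] at hj
    rw [Finset.mem_union, Finset.mem_filter, hZ, Finset.mem_filter, Finset.mem_range]
    by_cases hjm : bid j < m
    · exact .inl ⟨hj.1, hjm⟩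
    · exact .inr ⟨((hG j).1 hj.1).1, by omega⟩
  -- With the critical bundle, Y is a prefix in the order of density and is larger than X, hence
  -- brings at least as much.
  have hXY : ∑ j ∈ X, r j ≤ ∑ j ∈ Y, r j := by
    refine sum_le_sum_of_density (fun i hi => hq i ((hG i).1 (hX hi)).1) ?_ hm.1.le
    intro i hi hiY j hj hjX
    rw [hY, Finset.mem_filter] at hj
    have hi' := (hG i).1 (hX hi)
    have hj' := (hG j).1 hj.1
    rcases lt_trichotomy i j with hij | rfl | hij
    · refine absurd (Finset.mem_filter.2 ⟨hX hi, ?_⟩) hiY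
      exact (h.mono i j hij hj'.1 (hi'.2.1.trans hj'.2.1.symm) hi'.2.2 hj'.2.2).trans_lt hj.2
    · exact absurd hi hjX
    · exact hd j i hij hi'.1 (hj'.2.1.trans hi'.2.1.symm)
  obtain ⟨i, hi, him⟩ : ∃ i ∈ G, bid i = m := by
    by_contra hne
    push Not at hne
    have : Y = G.filter fun j => bid j < m := Finset.filter_congr fun j hj => by
      have := hne j hj; omega
    rw [this] at hm; omega
  have hi' := (hG i).1 hi
  have hmn : m < n := him ▸ (h.le i hi'.1).trans_lt hi'.1
  have hR : ∑ j ∈ Z, r j = R m := (h.sum_r m hmn).symm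
  rcases h.small m hmn (him ▸ h.group i hi'.1 hi'.2.2) with hsm | hfc
  · have h1 := Nat.mul_le_mul_left H (hXY.trans (hYZ r))
    rw [hR, Nat.mul_add] at h1
    linarith
  -- A critical bundle of forced items only would be the first one of the period. Then Y would lie
  -- in X, but Y is larger than X.
  · exfalso
    have hsub : Y ⊆ X := by
      intro j hj
      rw [hY, Finset.mem_filter] at hj
      have hj' := (hG j).1 hj.1
      refine hF j hj.1 (hfc j hj'.1 ?_)
      have := h.forced (bid j) i ((h.le j hj'.1).trans_lt hj'.1) hi'.1
        (by rw [h.period j hj'.1, hj'.2.1, hi'.2.1]) (hfc i hi'.1 him)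
      omega
    have := Finset.sum_le_sum_of_subset (f := q) hsub
    omega

/-- Some union of bundles is almost as good as the set `S` of items. -/
theorem Bundled.exists_selection {n T : ℕ} {β c : ℕ → ℕ}
    (h : Bundled t r q (fun k => β (t k)) H V n bid R Q) (hβ : Antitone β)
    (hq : ∀ j < n, 0 < q j) (hd : ∀ i j, i < j → j < n → t i = t j → r j * q i ≤ r i * q j)
    (S : ℕ → Prop) [DecidablePred S] :
    ∃ a : ℕ → Prop, ∃ _ : DecidablePred a,
      H * (run β c (periodSum t (fun j => if S j then r j else 0) n)
        (periodSum t (fun j => if S j then q j else 0) n) T).1 ≤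
      H * (run β c (periodSum t (fun z => if a z then R z else 0) n)
        (periodSum t (fun z => if a z then Q z else 0) n) T).1 + (T * (2 * V) : ℕ) := by
  classical
  let G : ℕ → Finset ℕ := fun τ => {j ∈ Finset.range n | t j = τ ∧
    Groupable r q (fun k => β (t k)) H V j}
  let X : ℕ → Finset ℕ := fun τ => {j ∈ G τ | S j ∨ Forced r q (fun k => β (t k)) j}
  have hG : ∀ τ j, j ∈ G τ ↔ j < n ∧ t j = τ ∧ Groupable r q (fun k => β (t k)) H V j :=
    fun τ j => by simp [G]
  choose m hm1 hm2 using fun τ => h.exists_threshold hq hd τ (hG τ) (Finset.filter_subset _ _ :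
    X τ ⊆ G τ) (fun j hj hf => Finset.mem_filter.2 ⟨hj, .inr hf⟩)
  -- Groupable bundles are selected by the threshold of their period. The other items form bundles
  -- of their own and are selected as in S.
  let a : ℕ → Prop := fun z => if Groupable r q (fun k => β (t k)) H V z then z < m (t z) else S z
  refine ⟨a, inferInstance, ?_⟩
  let P : ℕ → Finset ℕ := fun τ => {j ∈ Finset.range n | t j = τ}
  let A : ℕ → Finset ℕ := fun τ => {j ∈ P τ | S j}
  let A' : ℕ → Finset ℕ := fun τ => {j ∈ P τ | S j ∨ Forced r q (fun k => β (t k)) j}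
  let N : ℕ → Finset ℕ := fun τ => {j ∈ P τ | ¬ Groupable r q (fun k => β (t k)) H V j ∧ S j}
  let Y : ℕ → Finset ℕ := fun τ => {j ∈ G τ | bid j < m τ}
  have sumA : ∀ (f : ℕ → ℕ) τ, periodSum t (fun j => if S j then f j else 0) n τ =
      ∑ j ∈ A τ, f j := fun f τ => (Finset.sum_filter _ _).symm
  have sumA' : ∀ (f : ℕ → ℕ) τ, ∑ j ∈ A' τ, f j = ∑ j ∈ X τ, f j + ∑ j ∈ N τ, f j := by
    intro f τ
    rw [← Finset.sum_union]
    · refine Finset.sum_congr ?_ fun _ _ => rfl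
      ext j
      simp only [A', P, X, G, N, Finset.mem_union, Finset.mem_filter, Finset.mem_range]
      have : Forced r q (fun k => β (t k)) j → Groupable r q (fun k => β (t k)) H V j := .inl
      tauto
    · rw [Finset.disjoint_left]
      intro j hj hj'
      simp only [X, G, N, Finset.mem_filter] at hj hj'
      exact hj'.2.1 hj.1.2.2
  have sumB : ∀ (f F : ℕ → ℕ) τ, (∀ z < n, F z = ∑ j ∈ Finset.range n with bid j = z, f j) →
      periodSum t (fun z => if a z then F z else 0) n τ = ∑ j ∈ Y τ, f j + ∑ j ∈ N τ, f j := by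
    intro f F τ hF
    rw [periodSum_bundles h.le h.period hF, periodSum, ← Finset.sum_filter, ← Finset.sum_union]
    · refine Finset.sum_congr ?_ fun _ _ => rfl
      ext j
      simp only [P, Y, G, N, Finset.mem_union, Finset.mem_filter, Finset.mem_range]
      by_cases hj : j < n
      · by_cases hτ : t j = τ
        · by_cases hg : Groupable r q (fun k => β (t k)) H V j
          · simp [hj, hτ, hg, a, h.group j hj hg, h.period j hj]
          · simp [hj, hτ, hg, a, h.single j hj hg]
        · simp [hτ]
      · simp [hj]
    · rw [Finset.disjoint_left]
      intro j hj hj'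
      simp only [Y, G, N, Finset.mem_filter] at hj hj'
      exact hj'.2.1 hj.1.2.2
  have hsub : ∀ τ, A τ ⊆ A' τ := fun τ j hj => by
    simp only [A, A', Finset.mem_filter] at hj ⊢; exact ⟨hj.1, .inl hj.2⟩
  have main : ∀ k, Better (β k) H (k * (2 * V))
      (run β c (periodSum t (fun j => if S j then r j else 0) n)
        (periodSum t (fun j => if S j then q j else 0) n) k)
      (run β c (periodSum t (fun z => if a z then R z else 0) n)
        (periodSum t (fun z => if a z then Q z else 0) n) k) := by
    intro k
    induction k with
    | zero => simp [Better, run]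
    | succ k ih =>
      have hb : Better (β k) H ((k + 1) * (2 * V)) (run β c
          (periodSum t (fun j => if S j then r j else 0) n)
          (periodSum t (fun j => if S j then q j else 0) n) (k + 1))
          (run β c (periodSum t (fun z => if a z then R z else 0) n)
          (periodSum t (fun z => if a z then Q z else 0) n) (k + 1)) := by
        rw [Nat.succ_mul]
        -- The intermediate selection is S together with all forced items, each of which pays for
        -- its own overflow.
        refine ih.step (r₁ := ∑ j ∈ A' k, r j) (q₁ := ∑ j ∈ A' k, q j) le_rfl ?_ ?_ ?_ ?_
        · rw [sumA]; exact Finset.sum_le_sum_of_subset (hsub k)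
        · rw [sumA, sumA, ← Finset.sum_sdiff (hsub k), ← Finset.sum_sdiff (hsub k),
            Nat.add_sub_cancel, add_comm, Finset.mul_sum]
          refine Nat.add_le_add_right (Finset.sum_le_sum fun j hj => ?_) _
          simp only [A, A', P, Finset.mem_sdiff, Finset.mem_filter] at hj
          have hf : Forced r q (fun k => β (t k)) j := by tauto
          rw [← hj.1.1.2]; exact hf
        · rw [sumA', sumB r R k h.sum_r, Nat.mul_add, Nat.mul_add]
          have := hm2 k
          simp only [Y, X] at this ⊢; omega
        · rw [sumA', sumB q Q k h.sum_q]
          exact Nat.add_le_add_right (hm1 k) _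
      -- The credit for the load difference may be lowered to the rate of the next period.
      have e : (H * β (k + 1) : ℤ) ≤ H * β k := by
        exact_mod_cast Nat.mul_le_mul_left H (hβ k.le_succ)
      have e' := mul_le_mul_of_nonneg_right e (Nat.cast_nonneg (α := ℤ)
        ((run β c (periodSum t (fun z => if a z then R z else 0) n)
          (periodSum t (fun z => if a z then Q z else 0) n) (k + 1)).2 -
        (run β c (periodSum t (fun j => if S j then r j else 0) n)
        (periodSum t (fun j => if S j then q j else 0) n) (k + 1)).2))
      unfold Better at hb ⊢
      linarith
  have := main T
  unfold Better at this
  have h0 : (0 : ℤ) ≤ H * (β T * (((run β c (periodSum t (fun z => if a z then R z else 0) n)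
      (periodSum t (fun z => if a z then Q z else 0) n) T).2 -
      (run β c (periodSum t (fun j => if S j then r j else 0) n)
        (periodSum t (fun j => if S j then q j else 0) n) T).2 : ℕ) : ℤ)) := by positivity
  linarith

end Sequential

namespace Sequential

/-! ### Omitting unprofitable additions -/

/-- The state after the first `k` additions of `a` when those without profit are left out. -/
def pruned (b c R Q : ℕ → ℕ) (a : ℕ → Prop) [DecidablePred a] : ℕ → ℤ × ℕ
  | 0 => (0, 0)
  | k + 1 => if a k ∧ 0 < R k ∧ b k * ((pruned b c R Q a k).2 + Q k - c k) ≤ R k then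
      step (b k) (c k) (R k) (Q k) (pruned b c R Q a k) else pruned b c R Q a k

/-- The additions that are not left out. -/
def Kept (b c R Q : ℕ → ℕ) (a : ℕ → Prop) [DecidablePred a] (k : ℕ) : Prop :=
  a k ∧ 0 < R k ∧ b k * ((pruned b c R Q a k).2 + Q k - c k) ≤ R k

instance (b c R Q : ℕ → ℕ) (a : ℕ → Prop) [DecidablePred a] :
    DecidablePred (Kept b c R Q a) := fun _ => inferInstanceAs (Decidable (_ ∧ _))

section
variable {b c R Q : ℕ → ℕ} {a : ℕ → Prop} [DecidablePred a] {n : ℕ}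

theorem pruned_succ (k : ℕ) : pruned b c R Q a (k + 1) = if Kept b c R Q a k then
    step (b k) (c k) (R k) (Q k) (pruned b c R Q a k) else pruned b c R Q a k := rfl

/-- Leaving an addition out is the same as adding nothing, since the load is within capacity. So
pruning amounts to another selection, namely `Kept`. -/
theorem pruned_eq_run (hc : ∀ i j, i ≤ j → j < n → c i ≤ c j) {k : ℕ} (hk : k ≤ n) :
    pruned b c R Q a k = run b c (fun j => if Kept b c R Q a j then R j else 0)
      (fun j => if Kept b c R Q a j then Q j else 0) k := by
  induction k with
  | zero => rfl
  | succ k ih =>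
    rw [pruned_succ, run, ← ih (by omega)]
    split_ifs with h
    · rfl
    · rw [step_zero]
      rw [ih (by omega)]; exact run_load_le hc hk

theorem pruned_load_le (hc : ∀ i j, i ≤ j → j < n → c i ≤ c j) {k : ℕ} (hk : k < n) :
    (pruned b c R Q a k).2 ≤ c k := by
  rw [pruned_eq_run hc hk.le]; exact run_load_le hc hk

/-- Every kept addition pays for its overflow. A bound on the final profit thus holds for all
prefixes, which makes the cap of the table harmless. -/
theorem pruned_fst_mono : Monotone fun k => (pruned b c R Q a k).1 := by
  refine monotone_nat_of_le_succ fun k => ?_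
  rw [pruned_succ]
  split_ifs with h
  · have : ((b k * ((pruned b c R Q a k).2 + Q k - c k) : ℕ) : ℤ) ≤ R k := by
      exact_mod_cast h.2.2
    push_cast [step] at this ⊢
    linarith
  · exact le_rfl

theorem pruned_load_mono (hc : ∀ i j, i ≤ j → j < n → c i ≤ c j) {i j : ℕ} (hij : i ≤ j)
    (hj : j ≤ n) : (pruned b c R Q a i).2 ≤ (pruned b c R Q a j).2 := by
  induction j, hij using Nat.le_induction with
  | base => exact le_rfl
  | succ j hij ih =>
    refine (ih (by omega)).trans ?_
    rw [pruned_succ]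
    split_ifs
    · exact le_min (Nat.le_add_right _ _) (pruned_load_le hc hj)
    · exact le_rfl

/-- The two claims need each other: a smaller load makes every later overflow smaller, so an
addition that is unprofitable at the pruned load is also unprofitable at the larger one. -/
theorem run_le_pruned (hc : ∀ i j, i ≤ j → j < n → c i ≤ c j) {k : ℕ} (hk : k ≤ n) :
    (run b c (fun j => if a j then R j else 0) (fun j => if a j then Q j else 0) k).1 ≤
        (pruned b c R Q a k).1 ∧
      (pruned b c R Q a k).2 ≤
        (run b c (fun j => if a j then R j else 0) (fun j => if a j then Q j else 0) k).2 := by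
  induction k with
  | zero => exact ⟨le_rfl, le_rfl⟩
  | succ k ih =>
    obtain ⟨h1, h2⟩ := ih (by omega)
    have hl := pruned_load_le (b := b) (R := R) (Q := Q) (a := a) hc hk
    rw [run, pruned_succ]
    set x := run b c (fun j => if a j then R j else 0) (fun j => if a j then Q j else 0) k
    set y := pruned b c R Q a k
    by_cases ha : a k
    · simp only [ha, if_true]
      have hm : b k * (y.2 + Q k - c k) ≤ b k * (x.2 + Q k - c k) :=
        Nat.mul_le_mul_left _ (by omega)
      zify at hm
      split_ifs with h
      · simp only [step]; exact ⟨by linarith, by omega⟩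
      · have hn : (R k : ℤ) ≤ b k * ((y.2 + Q k - c k : ℕ) : ℤ) := by
          by_contra hlt
          push Not at hlt
          have hlt' : b k * (y.2 + Q k - c k) < R k := by zify; exact hlt
          exact h ⟨ha, by omega, hlt'.le⟩
        simp only [step]; exact ⟨by linarith, by omega⟩
    · have hn : ¬ Kept b c R Q a k := fun h => ha h.1
      simp only [ha, hn, if_false, step]
      have : (0 : ℤ) ≤ b k * ((x.2 + 0 - c k : ℕ) : ℤ) := by positivity
      push_cast
      exact ⟨by linarith, by omega⟩

/-- Profitable additions without overflow bring their full reward. -/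
theorem sum_le_pruned (k : ℕ) :
    ((∑ j ∈ Finset.range k with Kept b c R Q a j ∧ (pruned b c R Q a j).2 + Q j ≤ c j, R j : ℕ) : ℤ) ≤
      (pruned b c R Q a k).1 := by
  induction k with
  | zero => simp [pruned]
  | succ k ih =>
    rw [Finset.sum_filter, Finset.sum_range_succ, ← Finset.sum_filter]
    by_cases h : Kept b c R Q a k ∧ (pruned b c R Q a k).2 + Q k ≤ c k
    · rw [if_pos h, pruned_succ, if_pos h.1]
      simp only [step, Nat.sub_eq_zero_of_le h.2]
      push_cast at ih ⊢
      linarith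
    · rw [if_neg h, add_zero]
      exact ih.trans (pruned_fst_mono k.le_succ)

end

theorem card_le_of_injOn_period {t : ℕ → ℕ} {T : ℕ} {s : Finset ℕ} (ht : ∀ k ∈ s, t k < T)
    (h : ∀ i ∈ s, ∀ j ∈ s, t i = t j → i < j → False) : s.card ≤ T := by
  rw [← Finset.card_range T]
  refine Finset.card_le_card_of_injOn t (fun k hk => by simpa using ht k hk) ?_
  intro i hi j hj e
  rcases lt_trichotomy i j with hij | hij | hij
  · exact (h i hi j hj e hij).elim
  · exact hij
  · exact (h j hj i hi e.symm hij).elim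

/-- The number of profitable bundles. -/
theorem Bundled.card_kept_le {t r q R Q bid β c : ℕ → ℕ} {H V n T : ℕ}
    (h : Bundled t r q (fun k => β (t k)) H V n bid R Q)
    (hc : ∀ i j, i ≤ j → j < T → c i ≤ c j) (ht : ∀ i j, i ≤ j → j < n → t i ≤ t j)
    (hT : ∀ k < n, t k < T) (hV : 0 < V) (a : ℕ → Prop) [DecidablePred a]
    (hP : (pruned (fun k => β (t k)) (fun k => c (t k)) R Q a n).1 ≤ 2 * V) :
    ((Finset.range n).filter (Kept (fun k => β (t k)) (fun k => c (t k)) R Q a)).card ≤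
      min (2 * H + 3 * T) n := by
  classical
  have hc' : ∀ i j, i ≤ j → j < n → c (t i) ≤ c (t j) := fun i j hij hj =>
    hc _ _ (ht i j hij hj) (hT j hj)
  set b := fun k => β (t k) with hb
  set c' := fun k => c (t k) with hcdef
  set C := (Finset.range n).filter (Kept b c' R Q a) with hC
  have hCn : C.card ≤ n := (Finset.card_filter_le _ _).trans (Finset.card_range n).le
  refine le_min ?_ hCn
  have memC : ∀ k, k ∈ C → k < n ∧ Kept b c' R Q a k := fun k hk => by simpa [hC] using hk
  have lead : ∀ k ∈ C, bid k = k := by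
    intro k hk
    obtain ⟨hk, hK⟩ := memC k hk
    have hpos := hK.2.1
    rw [h.sum_r k hk] at hpos
    obtain ⟨j, hj, -⟩ := Finset.exists_ne_zero_of_sum_ne_zero hpos.ne'
    rw [Finset.mem_filter, Finset.mem_range] at hj
    rw [← hj.2, h.idem j hj.1]
  let C₁ := C.filter fun k => ∃ j < n, bid j = k ∧ Forced r q b j
  let C₂ := C.filter fun k => Groupable r q b H V k ∧ R k * H ≤ V
  let C₃ := C.filter fun k => (∀ j < n, bid j = k → ¬ Forced r q b j) ∧
    c' k < (pruned b c' R Q a k).2 + Q k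
  let C₄ := C.filter fun k => V < R k * H ∧ (pruned b c' R Q a k).2 + Q k ≤ c' k
  have hcov : C ⊆ C₁ ∪ (C₂ ∪ (C₃ ∪ C₄)) := by
    intro k hk
    simp only [C₁, C₂, C₃, C₄, Finset.mem_union, Finset.mem_filter, hk, true_and]
    by_cases h1 : ∃ j < n, bid j = k ∧ Forced r q b j
    · exact .inl h1
    by_cases h2 : Groupable r q b H V k ∧ R k * H ≤ V
    · exact .inr (.inl h2)
    right; right
    rcases lt_or_ge (c' k) ((pruned b c' R Q a k).2 + Q k) with h3 | h3
    · exact .inl ⟨fun j hj hjk hf => h1 ⟨j, hj, hjk, hf⟩, h3⟩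
    · refine .inr ⟨?_, h3⟩
      by_cases hg : Groupable r q b H V k
      · exact not_le.1 fun hle => h2 ⟨hg, hle⟩
      · have hk' := (memC k hk).1
        have hle : r k ≤ R k := by
          rw [h.sum_r k hk']
          exact Finset.single_le_sum (f := r) (fun _ _ => Nat.zero_le _)
            (Finset.mem_filter.2 ⟨Finset.mem_range.2 hk', lead k hk⟩)
        have : V < r k * H := not_le.1 fun hle => hg (.inr hle)
        exact this.trans_le (Nat.mul_le_mul_right H hle)
  have hTC : ∀ s ⊆ C, ∀ k ∈ s, t k < T := fun s hs k hk => hT k (memC k (hs hk)).1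
  -- All forced items of a period share its first bundle.
  have c₁ : C₁.card ≤ T := by
    refine card_le_of_injOn_period (hTC _ (Finset.filter_subset _ _)) ?_
    intro i hi j hj e hij
    simp only [C₁, Finset.mem_filter] at hi hj
    obtain ⟨-, j', hj'n, hj'e, hj'f⟩ := hj
    have := h.forced i j' (memC i hi.1).1 hj'n
      (by rw [e, ← hj'e, h.period j' hj'n]) hj'f
    omega
  -- Among the groupable bundles of a period only the last one can fail to exceed V / H.
  have c₂ : C₂.card ≤ T := by
    refine card_le_of_injOn_period (hTC _ (Finset.filter_subset _ _)) ?_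
    intro i hi j hj e hij
    simp only [C₂, Finset.mem_filter] at hi hj
    have := h.full i j hij (memC j hj.1).1 e hi.2.1 hj.2.1
      (by rw [lead i hi.1, lead j hj.1]; exact hij)
    rw [lead i hi.1] at this
    omega
  have c₃ : C₃.card ≤ T := by
    refine card_le_of_injOn_period (hTC _ (Finset.filter_subset _ _)) ?_
    intro i hi j hj e hij
    simp only [C₃, Finset.mem_filter] at hi hj
    obtain ⟨hjn, hjK⟩ := memC j hj.1
    -- The earlier bundle i of the same period has filled the capacity, so all of bundle j would be
    -- overflow.
    have h1 : c' j ≤ (pruned b c' R Q a j).2 := by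
      refine le_trans ?_ (pruned_load_mono (n := n) hc' hij hjn.le)
      rw [pruned_succ, if_pos (memC i hi.1).2]
      simp only [step, hcdef] at hi ⊢
      rw [← e]; omega
    have h2 : (pruned b c' R Q a j).2 + Q j - c' j = Q j := by
      have := pruned_load_le (b := b) (R := R) (Q := Q) (a := a) hc' hjn
      simp only [hcdef] at h1 this ⊢
      omega
    have h3 := hjK.2.2
    rw [h2, h.sum_r j hjn, h.sum_q j hjn, Finset.mul_sum] at h3
    -- No item of bundle j is forced, so the penalty for its whole size exceeds its reward and it
    -- would not have been kept.
    refine absurd h3 (not_le.2 (Finset.sum_lt_sum_of_nonempty ⟨j, ?_⟩ fun i hi => ?_))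
    · exact Finset.mem_filter.2 ⟨Finset.mem_range.2 hjn, lead j hj.1⟩
    · rw [Finset.mem_filter, Finset.mem_range] at hi
      have hf := hj.2.1 i hi.1 hi.2
      have ht : t j = t i := by rw [← hi.2, h.period i hi.1]
      simp only [Forced, hb, not_le] at hf ⊢
      rwa [ht]
  have c₄ : C₄.card ≤ 2 * H := by
    -- Each of these bundles brings more than V / H in full, and their total is at most the pruned
    -- profit, hence at most 2V.
    have h1 : ∑ k ∈ C₄, V ≤ ∑ k ∈ C₄, R k * H := Finset.sum_le_sum fun k hk => by
      simp only [C₄, Finset.mem_filter] at hk; exact hk.2.1.le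
    have h2 : ∑ k ∈ C₄, R k ≤ ∑ j ∈ Finset.range n with
        Kept b c' R Q a j ∧ (pruned b c' R Q a j).2 + Q j ≤ c' j, R j := by
      refine Finset.sum_le_sum_of_subset fun k hk => ?_
      simp only [C₄, Finset.mem_filter] at hk
      exact Finset.mem_filter.2 ⟨Finset.mem_range.2 (memC k hk.1).1, (memC k hk.1).2, hk.2.2⟩
    have h3 : ∑ k ∈ C₄, R k ≤ 2 * V := by
      have := (sum_le_pruned (b := b) (c := c') (R := R) (Q := Q) (a := a) n).trans hP
      have : ∑ j ∈ Finset.range n with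
        Kept b c' R Q a j ∧ (pruned b c' R Q a j).2 + Q j ≤ c' j, R j ≤ 2 * V := by
        exact_mod_cast this
      omega
    rw [Finset.sum_const, smul_eq_mul, ← Finset.sum_mul] at h1
    have h4 := h1.trans (Nat.mul_le_mul_right H h3)
    refine Nat.le_of_mul_le_mul_right (h4.trans_eq ?_) hV
    ring
  have u₁ := Finset.card_le_card hcov
  have u₂ := Finset.card_union_le C₁ (C₂ ∪ (C₃ ∪ C₄))
  have u₃ := Finset.card_union_le C₂ (C₃ ∪ C₄)
  have u₄ := Finset.card_union_le C₃ C₄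
  omega

/-! ### Dynamic programming over scaled profits

Profits are rounded down to multiples of `V / K`. Row `k` of the table refers to the first `k`
bundles; the cell `(k, s)` holds `L + 1` if the scaled profit `s` is reached with load `L`, and `0`
if it is not reached. -/

/-- Overflow when bundle `k` is added to a cell with entry `x`. -/
def overflow (c Q : ℕ → ℕ) (k x : ℕ) : ℕ := x - 1 + Q k - c k

/-- Scaled profit after bundle `k` is added to the cell `s` with entry `x`. -/
def target (b c R Q : ℕ → ℕ) (K V cap k s x : ℕ) : ℕ :=
  min (s + (R k - b k * overflow c Q k x) * K / V) cap

/-- The table `Ld` of loads and the table `ch` of choices are correct up to row `k`. -/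
structure Table (b c R Q : ℕ → ℕ) (K V cap k : ℕ) (Ld ch : ℕ → ℕ → ℕ) : Prop where
  base : Ld 0 0 = 1
  base_zero : ∀ s ≤ cap, s ≠ 0 → Ld 0 s = 0
  sound : ∀ j < k, ∀ s ≤ cap, Ld (j + 1) s ≠ 0 → (ch (j + 1) s = 0 ∧ Ld (j + 1) s = Ld j s) ∨
    ∃ s₀ ≤ cap, ch (j + 1) s = s₀ + 1 ∧ Ld j s₀ ≠ 0 ∧ b j * overflow c Q j (Ld j s₀) ≤ R j ∧
      s = target b c R Q K V cap j s₀ (Ld j s₀) ∧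
      Ld (j + 1) s = Ld j s₀ + Q j - overflow c Q j (Ld j s₀)
  keep : ∀ j < k, ∀ s ≤ cap, Ld j s ≠ 0 → Ld (j + 1) s ≠ 0 ∧ Ld (j + 1) s ≤ Ld j s
  push : ∀ j < k, ∀ s ≤ cap, Ld j s ≠ 0 → b j * overflow c Q j (Ld j s) ≤ R j →
    Ld (j + 1) (target b c R Q K V cap j s (Ld j s)) ≠ 0 ∧
    Ld (j + 1) (target b c R Q K V cap j s (Ld j s)) ≤ Ld j s + Q j - overflow c Q j (Ld j s)

section
variable {b c R Q : ℕ → ℕ} {K V cap n : ℕ} {Ld ch : ℕ → ℕ → ℕ}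

theorem Table.zero_ne (h : Table b c R Q K V cap n Ld ch) {k : ℕ} (hk : k ≤ n) : Ld k 0 ≠ 0 := by
  induction k with
  | zero => rw [h.base]; exact one_ne_zero
  | succ k ih => exact (h.keep k (by omega) 0 (Nat.zero_le _) (ih (by omega))).1

/-- Following the choices backwards yields a selection with the promised profit. -/
theorem Table.backtrack (h : Table b c R Q K V cap n Ld ch)
    (hc : ∀ i j, i ≤ j → j < n → c i ≤ c j) {bt : ℕ → ℕ} (hn : Ld n (bt n) ≠ 0)
    (hcap : bt n ≤ cap) (hbt : ∀ k < n, bt k =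
      if ch (k + 1) (bt (k + 1)) = 0 then bt (k + 1) else ch (k + 1) (bt (k + 1)) - 1) :
    (bt n * V : ℤ) ≤ (run b c (fun k => if ch (k + 1) (bt (k + 1)) ≠ 0 then R k else 0)
      (fun k => if ch (k + 1) (bt (k + 1)) ≠ 0 then Q k else 0) n).1 * K := by
  -- The path is followed from row n downwards to see that its cells are reached; the values are
  -- then compared upwards from row 0, with the stored load exactly that of the run.
  have down : ∀ m k, k + m = n → Ld k (bt k) ≠ 0 ∧ bt k ≤ cap := by
    intro m
    induction m with
    | zero => rintro k rfl; exact ⟨hn, hcap⟩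
    | succ m ih =>
      intro k hk
      obtain ⟨h1, h2⟩ := ih (k + 1) (by omega)
      rcases h.sound k (by omega) _ h2 h1 with ⟨e1, e2⟩ | ⟨s₀, hs, e1, e2, -⟩
      · rw [hbt k (by omega), if_pos e1, ← e2]; exact ⟨h1, h2⟩
      · rw [hbt k (by omega), e1, if_neg s₀.succ_ne_zero]; exact ⟨e2, hs⟩
  suffices ∀ k ≤ n, (run b c (fun k => if ch (k + 1) (bt (k + 1)) ≠ 0 then R k else 0)
      (fun k => if ch (k + 1) (bt (k + 1)) ≠ 0 then Q k else 0) k).2 + 1 = Ld k (bt k) ∧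
      (bt k * V : ℤ) ≤ (run b c (fun k => if ch (k + 1) (bt (k + 1)) ≠ 0 then R k else 0)
      (fun k => if ch (k + 1) (bt (k + 1)) ≠ 0 then Q k else 0) k).1 * K from (this n le_rfl).2
  intro k hk
  induction k with
  | zero =>
    have h0 : bt 0 = 0 := by
      by_contra hne
      have := down n 0 (by omega)
      exact this.1 (h.base_zero _ this.2 hne)
    rw [h0]; simp [run, h.base]
  | succ k ih =>
    obtain ⟨i1, i2⟩ := ih (by omega)
    obtain ⟨h1, h2⟩ := down (n - (k + 1)) (k + 1) (by omega)
    have hb := hbt k (by omega)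
    rw [run]
    have hl := run_load_le (b := b) (r := fun k => if ch (k + 1) (bt (k + 1)) ≠ 0 then R k else 0)
      (q := fun k => if ch (k + 1) (bt (k + 1)) ≠ 0 then Q k else 0) hc (k := k) (by omega)
    set x := run b c (fun k => if ch (k + 1) (bt (k + 1)) ≠ 0 then R k else 0)
      (fun k => if ch (k + 1) (bt (k + 1)) ≠ 0 then Q k else 0) k
    rcases h.sound k (by omega) _ h2 h1 with ⟨e1, e2⟩ | ⟨s₀, hs, e1, e2, e3, e4, e5⟩
    · rw [if_pos e1] at hb
      simp only [e1, ne_eq, not_true_eq_false, if_false]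
      rw [step_zero hl, e2, ← hb]; exact ⟨i1, i2⟩
    · rw [e1, if_neg s₀.succ_ne_zero, Nat.add_sub_cancel] at hb
      subst hb
      have hne : ch (k + 1) (bt (k + 1)) ≠ 0 := by rw [e1]; exact (bt k).succ_ne_zero
      simp only [hne, ne_eq, not_false_eq_true, if_true, step]
      have ho : overflow c Q k (Ld k (bt k)) = x.2 + Q k - c k := by rw [overflow, ← i1]; rfl
      rw [ho] at e3 e5
      refine ⟨by omega, ?_⟩
      have h4 : bt (k + 1) ≤ bt k + (R k - b k * (x.2 + Q k - c k)) * K / V := by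
        conv_lhs => rw [e4, target, ho]
        exact min_le_left _ _
      have h5 := Nat.mul_le_mul_right V h4
      have h6 := Nat.div_mul_le_self ((R k - b k * (x.2 + Q k - c k)) * K) V
      rw [Nat.add_mul] at h5
      have h7 : bt (k + 1) * V ≤ bt k * V + (R k - b k * (x.2 + Q k - c k)) * K := by omega
      zify [e3] at h7
      linarith

/-- The table follows every pruned selection up to one rounding error per addition. -/
theorem Table.complete (h : Table b c R Q K V cap n Ld ch) (hV : 0 < V) (hcap : cap = 2 * K)
    (a : ℕ → Prop) [DecidablePred a] (hP : (pruned b c R Q a n).1 ≤ 2 * V) {k : ℕ} (hk : k ≤ n) :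
    ∃ s ≤ cap, Ld k s ≠ 0 ∧ Ld k s ≤ (pruned b c R Q a k).2 + 1 ∧ (pruned b c R Q a k).1 * K ≤
      (s + ((Finset.range k).filter (Kept b c R Q a)).card) * V := by
  induction k with
  | zero => exact ⟨0, Nat.zero_le _, by rw [h.base]; exact one_ne_zero, by simp [h.base],
      by simp [pruned]⟩
  | succ k ih =>
    obtain ⟨s, hs, h1, h2, h3⟩ := ih (by omega)
    have hPk := (pruned_fst_mono (b := b) (c := c) (R := R) (Q := Q) (a := a) hk).trans hP
    dsimp only at hPk
    rw [Finset.range_add_one, Finset.filter_insert]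
    rw [pruned_succ] at hPk ⊢
    split_ifs at hPk ⊢ with hK
    · have ho : overflow c Q k (Ld k s) ≤ (pruned b c R Q a k).2 + Q k - c k := by
        unfold overflow; omega
      have hm := Nat.mul_le_mul_left (b k) ho
      have hal : b k * overflow c Q k (Ld k s) ≤ R k := hm.trans hK.2.2
      obtain ⟨p1, p2⟩ := h.push k (by omega) s hs h1 hal
      refine ⟨_, min_le_right _ _, p1, p2.trans ?_, ?_⟩
      · simp only [step, overflow]; omega
      · rw [Finset.card_insert_of_notMem (by simp)]
        have hD : ((R k - b k * overflow c Q k (Ld k s) : ℕ) : ℤ) =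
            R k - b k * overflow c Q k (Ld k s) := by push_cast [hal]; ring
        generalize R k - b k * overflow c Q k (Ld k s) = D at hD
        -- Below the cap, the rounding loses less than one unit V / K, charged to the newly kept
        -- bundle. At the cap 2K nothing is lost, since the profit is at most 2V.
        rcases le_total (s + D * K / V) cap with hle | hle
        · rw [min_eq_left hle]
          have hd := Nat.lt_div_mul_add hV (a := D * K)
          generalize D * K / V = E at hd
          zify at hd hm
          simp only [step]
          push_cast at hd hm ⊢
          have hm' := mul_le_mul_of_nonneg_right hm (Nat.cast_nonneg (α := ℤ) K)
          rw [hD] at hd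
          linarith
        · rw [min_eq_right hle, hcap]
          have hK0 : (0 : ℤ) ≤ K := Nat.cast_nonneg _
          have hm := mul_le_mul_of_nonneg_right hPk hK0
          push_cast
          have : (0 : ℤ) ≤ (((Finset.range k).filter (Kept b c R Q a)).card + 1) * V := by
            positivity
          linarith
    · obtain ⟨p1, p2⟩ := h.keep k (by omega) s hs h1
      exact ⟨s, hs, p1, p2.trans h2, h3⟩

end

end Sequential

namespace MPBKPS

open Sequential

variable {n T : ℕ} (I : MPBKPS n T)

/-! ### Items in sorted order -/

/-- Item `i` may precede item `j`: it has an earlier deadline, or the same deadline and at least the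
same reward per size. -/
def Precedes (d r q : ℕ → ℕ) (i j : ℕ) : Prop := d i < d j ∨ d i = d j ∧ r j * q i ≤ r i * q j

/-- Deadlines as a sequence of numbers. -/
def due (k : ℕ) : ℕ := cells (fun i => (I.d i : ℕ)) k

/-- `ord` lists the items by deadline and by reward per size. -/
structure Sorts (ord : ℕ → ℕ) : Prop where
  perm : ((List.range n).map ord).Perm (List.range n)
  sorted : ∀ i j, i < j → j < n → Precedes I.due (cells I.r) (cells I.q) (ord i) (ord j)

/-- Membership in a set of items given by number. -/
def Has (S : Finset (Fin n)) (i : ℕ) : Prop := ∃ h : i < n, ⟨i, h⟩ ∈ S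

instance (S : Finset (Fin n)) : DecidablePred (Has S) := fun _ => inferInstanceAs (Decidable (∃ _, _))

variable {I} {ord : ℕ → ℕ}

theorem Sorts.lt (h : I.Sorts ord) {k : ℕ} (hk : k < n) : ord k < n :=
  List.mem_range.1 (h.perm.subset (List.mem_map.2 ⟨k, List.mem_range.2 hk, rfl⟩))

theorem Sorts.inj (h : I.Sorts ord) {i j : ℕ} (hi : i < n) (hj : j < n) (e : ord i = ord j) :
    i = j := by
  have hn : ((List.range n).map ord).Nodup := h.perm.nodup_iff.2 List.nodup_range
  exact List.inj_on_of_nodup_map hn (List.mem_range.2 hi) (List.mem_range.2 hj) e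

theorem Sorts.sum_comp (h : I.Sorts ord) (f : ℕ → ℕ) :
    ∑ k ∈ Finset.range n, f (ord k) = ∑ i ∈ Finset.range n, f i := by
  have := (h.perm.map f).sum_eq
  rwa [List.map_map] at this

theorem due_lt {k : ℕ} (hk : k < n) : I.due k < T := by
  rw [due, cells_of_lt _ hk]; exact (I.d _).2

theorem Sorts.due_mono (h : I.Sorts ord) (i j : ℕ) (hij : i ≤ j) (hj : j < n) :
    I.due (ord i) ≤ I.due (ord j) := by
  rcases hij.lt_or_eq with hij | rfl
  · rcases h.sorted i j hij hj with h | h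
    · exact h.le
    · exact h.1.le
  · exact le_rfl

theorem Sorts.density (h : I.Sorts ord) (i j : ℕ) (hij : i < j) (hj : j < n)
    (e : I.due (ord i) = I.due (ord j)) :
    cells I.r (ord j) * cells I.q (ord i) ≤ cells I.r (ord i) * cells I.q (ord j) := by
  rcases h.sorted i j hij hj with h | h
  · omega
  · exact h.2

theorem cells_q_pos {i : ℕ} (hi : i < n) : 0 < cells I.q i := by
  rw [cells_of_lt _ hi]
  have := I.lt_B ⟨i, hi⟩ _ le_rfl
  exact Nat.pos_of_ne_zero fun h0 => by rw [h0] at this; omega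

theorem cells_c_mono (i j : ℕ) (hij : i ≤ j) (hj : j < T) : cells I.c i ≤ cells I.c j := by
  rw [cells_of_lt _ (hij.trans_lt hj), cells_of_lt _ hj]
  exact I.c_mono hij

/-- Forced means that the reward per size is at least the rate of the period, and earlier items of
the period are at least as dense. -/
theorem Sorts.forced_of_lt (h : I.Sorts ord) {β : ℕ → ℕ} {j k : ℕ} (hjk : j < k) (hk : k < n)
    (e : I.due (ord j) = I.due (ord k))
    (hf : Forced (fun k => cells I.r (ord k)) (fun k => cells I.q (ord k))
      (fun k => β (I.due (ord k))) k) :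
    Forced (fun k => cells I.r (ord k)) (fun k => cells I.q (ord k))
      (fun k => β (I.due (ord k))) j := by
  unfold Forced at hf ⊢
  dsimp only at hf ⊢
  rw [e]
  have hd := h.density j k hjk hk e
  have hq := cells_q_pos (I := I) (h.lt hk)
  refine Nat.le_of_mul_le_mul_right ?_ hq
  calc β (I.due (ord k)) * cells I.q (ord j) * cells I.q (ord k)
      = β (I.due (ord k)) * cells I.q (ord k) * cells I.q (ord j) := by ring
    _ ≤ cells I.r (ord k) * cells I.q (ord j) := Nat.mul_le_mul_right _ hf
    _ ≤ _ := hd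

theorem Sorts.dueSum_eq (h : I.Sorts ord) (f : Fin n → ℕ) (S : Finset (Fin n)) (τ : ℕ) :
    I.dueSum f S τ = periodSum (fun k => I.due (ord k))
      (fun k => if Has S (ord k) then cells f (ord k) else 0) n τ := by
  rw [periodSum, Finset.sum_filter,
    h.sum_comp fun i => if I.due i = τ then (if Has S i then cells f i else 0) else 0,
    ← Fin.sum_univ_eq_sum_range fun i =>
      if I.due i = τ then (if Has S i then cells f i else 0) else 0, dueSum, Finset.sum_filter,
    ← Finset.sum_filter_add_sum_filter_not Finset.univ (· ∈ S)]
  rw [Finset.sum_eq_zero (s := Finset.univ.filter (· ∉ S)), add_zero, Finset.filter_univ_mem]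
  · refine Finset.sum_congr rfl fun i hi => ?_
    have : Has S i := ⟨i.2, hi⟩
    simp [this, due, cells_fin]
  · intro i hi
    have : ¬ Has S i := fun ⟨_, h⟩ => (Finset.mem_filter.1 hi).2 h
    simp [this]

theorem Sorts.val_eq (h : I.Sorts ord) (S : Finset (Fin n)) : I.val S =
    (run I.rate (cells I.c) (periodSum (fun k => I.due (ord k))
      (fun k => if Has S (ord k) then cells I.r (ord k) else 0) n)
      (periodSum (fun k => I.due (ord k))
      (fun k => if Has S (ord k) then cells I.q (ord k) else 0) n) T).1 := by
  rw [val, run_congr (fun τ _ => h.dueSum_eq I.r S τ) (fun τ _ => h.dueSum_eq I.q S τ)]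

/-- The value of a union of bundles. -/
theorem Sorts.val_eq_run_bundles (h : I.Sorts ord) {H V : ℕ} {bid R Q : ℕ → ℕ}
    (hb : Bundled (fun k => I.due (ord k)) (fun k => cells I.r (ord k)) (fun k => cells I.q (ord k))
      (fun k => I.rate (I.due (ord k))) H V n bid R Q) (a : ℕ → Prop) [DecidablePred a]
    {S : Finset (Fin n)} (hS : ∀ k < n, Has S (ord k) ↔ a (bid k)) :
    I.val S = (run (fun k => I.rate (I.due (ord k))) (fun k => cells I.c (I.due (ord k)))
      (fun k => if a k then R k else 0) (fun k => if a k then Q k else 0) n).1 := by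
  have key : ∀ f F : ℕ → ℕ, (∀ z < n, F z = ∑ j ∈ Finset.range n with bid j = z, f j) → ∀ τ,
      periodSum (fun k => I.due (ord k)) (fun k => if Has S (ord k) then f k else 0) n τ =
      periodSum (fun k => I.due (ord k)) (fun k => if a k then F k else 0) n τ := by
    intro f F hF τ
    rw [periodSum_bundles hb.le hb.period hF]
    refine Finset.sum_congr rfl fun k hk => ?_
    rw [Finset.mem_filter, Finset.mem_range] at hk
    simp only [hS k hk.1]
  rw [h.val_eq, run_comp_eq_run_periodSum (b := I.rate) (t := fun k => I.due (ord k))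
    cells_c_mono h.due_mono (fun k hk => due_lt (h.lt hk)),
    run_congr (fun τ _ => key _ R hb.sum_r τ) (fun τ _ => key _ Q hb.sum_q τ)]

/-- Realizes a selection of positions by a set of items, so that bounds on the optimum apply to it.
-/
theorem Sorts.exists_has_iff (h : I.Sorts ord) (a : ℕ → Prop) :
    ∃ S : Finset (Fin n), ∀ k < n, Has S (ord k) ↔ a k := by
  classical
  refine ⟨Finset.univ.filter fun i : Fin n => ∃ k < n, ord k = i ∧ a k, fun k hk => ?_⟩
  simp only [Has, Finset.mem_filter, Finset.mem_univ, true_and]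
  constructor
  · rintro ⟨_, j, hj, e, ha⟩
    exact h.inj hj hk e ▸ ha
  · intro ha; exact ⟨h.lt hk, k, hk, rfl, ha⟩

/-! ### Bounds on the optimal value -/

/-- At any load an item causes at least as much overflow as it does alone, so no addition gains more
than p₀. -/
theorem Sorts.val_le (h : I.Sorts ord) {p₀ : ℕ} (hp : ∀ i < n, cells I.r i ≤
    p₀ + I.rate (I.due i) * (cells I.q i - cells I.c (I.due i))) (S : Finset (Fin n)) :
    I.val S ≤ n * p₀ := by
  rw [h.val_eq, ← run_comp_eq_run_periodSum (b := I.rate) (t := fun k => I.due (ord k))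
    cells_c_mono h.due_mono (fun k hk => due_lt (h.lt hk))]
  suffices ∀ k ≤ n, (run (fun k => I.rate (I.due (ord k))) (fun k => cells I.c (I.due (ord k)))
      (fun k => if Has S (ord k) then cells I.r (ord k) else 0)
      (fun k => if Has S (ord k) then cells I.q (ord k) else 0) k).1 ≤ k * p₀ from this n le_rfl
  intro k hk
  induction k with
  | zero => simp [run]
  | succ k ih =>
    have ih := ih (by omega)
    rw [run]
    generalize run (fun k => I.rate (I.due (ord k))) (fun k => cells I.c (I.due (ord k)))
      (fun k => if Has S (ord k) then cells I.r (ord k) else 0)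
      (fun k => if Has S (ord k) then cells I.q (ord k) else 0) k = x at ih ⊢
    simp only [step]
    split_ifs with hS
    · have h1 := hp _ (h.lt (show k < n by omega))
      have h2 := Nat.mul_le_mul_left (I.rate (I.due (ord k)))
        (show cells I.q (ord k) - cells I.c (I.due (ord k)) ≤
          x.2 + cells I.q (ord k) - cells I.c (I.due (ord k)) by omega)
      zify at h1 h2
      push_cast
      linarith
    · have : (0 : ℤ) ≤ I.rate (I.due (ord k)) * ((x.2 + 0 - cells I.c (I.due (ord k)) : ℕ) : ℤ) := by
        positivity
      push_cast
      linarith [(Nat.cast_nonneg p₀ : (0 : ℤ) ≤ p₀)]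

theorem le_val_singleton (i : Fin n) : ((cells I.r i : ℕ) : ℤ) -
    I.rate (I.due i) * ((cells I.q i - cells I.c (I.due i) : ℕ) : ℤ) ≤ I.val {i} := by
  have hs : ∀ (f : Fin n → ℕ) τ, I.dueSum f {i} τ = if I.due i = τ then cells f i else 0 := by
    intro f τ
    simp [dueSum, Finset.sum_filter, due, cells_fin]
  have hi : I.due i < T := due_lt i.2
  have hz : ∀ (f : Fin n → ℕ) τ, I.due i ≠ τ → I.dueSum f {i} τ = 0 := fun f τ h => by
    rw [hs, if_neg h]
  rw [val, run_eq_of_zero cells_c_mono hi (fun j hj _ => hz _ j (by omega))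
    (fun j hj _ => hz _ j (by omega)), run, run_eq_of_zero (N := I.due i) (k := 0)
    (fun a b hab hb => cells_c_mono a b hab (hb.trans hi)) (Nat.zero_le _)
    (fun j _ hj => hz _ j (by omega)) (fun j _ hj => hz _ j (by omega)), hs, hs]
  simp [run, step]

theorem val_empty : I.val ∅ = 0 := by
  rw [val, run_eq_of_zero cells_c_mono (Nat.zero_le _)] <;> simp [dueSum, run]

/-! ### One guess of the optimal value -/

/-- A bound on the number of rounding errors. -/
def roundings (H n T : ℕ) : ℕ := min (2 * H + 3 * T) n

/-- `best / K` is almost optimal, provided that the optimal value is at most `2 * V`. -/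
def Covered (I : MPBKPS n T) (H K V best : ℕ) : Prop :=
  0 < V → (∀ S, I.val S ≤ 2 * V) → ∀ S,
    (H * K * I.val S : ℤ) ≤ H * (best + roundings H n T * V) + K * (T * (2 * V))

theorem Covered.mono {H K V best best' : ℕ} (h : I.Covered H K V best) (hb : best ≤ best') :
    I.Covered H K V best' := by
  intro hV h2 S
  have := h hV h2 S
  have h' : (H * best : ℤ) ≤ H * best' := by exact_mod_cast Nat.mul_le_mul_left H hb
  linarith

/-- Chains the losses: passing to bundles costs 2TV / H, pruning costs nothing, and the table costs
V / K per kept bundle. -/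
theorem Sorts.covered (h : I.Sorts ord) {H V K cap m : ℕ} {bid R Q : ℕ → ℕ} {Ld ch : ℕ → ℕ → ℕ}
    (hb : Bundled (fun k => I.due (ord k)) (fun k => cells I.r (ord k)) (fun k => cells I.q (ord k))
      (fun k => I.rate (I.due (ord k))) H V n bid R Q)
    (ht : Table (fun k => I.rate (I.due (ord k))) (fun k => cells I.c (I.due (ord k))) R Q K V cap n
      Ld ch) (hcap : cap = 2 * K) (hm : ∀ s ≤ cap, Ld n s ≠ 0 → s ≤ m) :
    I.Covered H K V (m * V) := by
  intro hV h2 S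
  obtain ⟨a, _, ha⟩ := hb.exists_selection (T := T) (c := cells I.c)
    (prefixMin_antitone (cells I.B)) (fun j hj => cells_q_pos (h.lt hj)) h.density
    (fun k => Has S (ord k))
  rw [← h.val_eq S, ← run_comp_eq_run_periodSum (b := I.rate) (t := fun k => I.due (ord k))
    cells_c_mono h.due_mono (fun k hk => due_lt (h.lt hk))] at ha
  have hc : ∀ i j, i ≤ j → j < n → cells I.c (I.due (ord i)) ≤ cells I.c (I.due (ord j)) :=
    fun i j hij hj => cells_c_mono _ _ (h.due_mono i j hij hj) (due_lt (h.lt hj))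
  have h3 := (run_le_pruned (b := fun k => I.rate (I.due (ord k))) (R := R) (Q := Q) (a := a)
    hc le_rfl).1
  -- The pruned profit is the value of an actual set of items, hence at most 2V by the assumption on
  -- the guess.
  have h4 : (pruned (fun k => I.rate (I.due (ord k))) (fun k => cells I.c (I.due (ord k))) R Q a
      n).1 ≤ 2 * V := by
    obtain ⟨S', hS'⟩ := h.exists_has_iff fun k => Kept (fun k => I.rate (I.due (ord k)))
      (fun k => cells I.c (I.due (ord k))) R Q a (bid k)
    rw [pruned_eq_run hc le_rfl, ← h.val_eq_run_bundles hb _ hS']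
    exact h2 S'
  have h5 := hb.card_kept_le (c := cells I.c) (T := T) cells_c_mono h.due_mono
    (fun k hk => due_lt (h.lt hk)) hV a h4
  obtain ⟨s, hs, hs0, -, h6⟩ := ht.complete hV hcap a h4 le_rfl
  set P := (pruned (fun k => I.rate (I.due (ord k))) (fun k => cells I.c (I.due (ord k))) R Q a
      n).1
  have h7 : (s + ((Finset.range n).filter (Kept (fun k => I.rate (I.due (ord k)))
      (fun k => cells I.c (I.due (ord k))) R Q a)).card) * V ≤ (m + roundings H n T) * V :=
    Nat.mul_le_mul_right V (Nat.add_le_add (hm s hs hs0) h5)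
  zify at h7
  have h8 := mul_le_mul_of_nonneg_left (h6.trans h7) (Nat.cast_nonneg (α := ℤ) H)
  have h9 := mul_le_mul_of_nonneg_left ha (Nat.cast_nonneg (α := ℤ) K)
  have h10 := mul_le_mul_of_nonneg_left h3
    (mul_nonneg (Nat.cast_nonneg (α := ℤ) K) (Nat.cast_nonneg (α := ℤ) H))
  push_cast at h8 h9 h10 ⊢
  simp only [rate] at h8 h9 h10 ⊢
  linarith

/-- Profits are rounded down, so a reached cell certifies real profit. This needs no assumption on
the guess V. -/
theorem Sorts.sound (h : I.Sorts ord) {H V K cap : ℕ} {bid R Q : ℕ → ℕ} {Ld ch : ℕ → ℕ → ℕ}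
    (hb : Bundled (fun k => I.due (ord k)) (fun k => cells I.r (ord k)) (fun k => cells I.q (ord k))
      (fun k => I.rate (I.due (ord k))) H V n bid R Q)
    (ht : Table (fun k => I.rate (I.due (ord k))) (fun k => cells I.c (I.due (ord k))) R Q K V cap n
      Ld ch) {bt : ℕ → ℕ} (hn : Ld n (bt n) ≠ 0) (hcap : bt n ≤ cap)
    (hbt : ∀ k < n, bt k =
      if ch (k + 1) (bt (k + 1)) = 0 then bt (k + 1) else ch (k + 1) (bt (k + 1)) - 1)
    {S : Finset (Fin n)} (hS : ∀ k < n, Has S (ord k) ↔ ch (bid k + 1) (bt (bid k + 1)) ≠ 0) :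
    (bt n * V : ℤ) ≤ I.val S * K := by
  rw [h.val_eq_run_bundles hb (fun k => ch (k + 1) (bt (k + 1)) ≠ 0) hS]
  exact ht.backtrack (fun i j hij hj => cells_c_mono _ _ (h.due_mono i j hij hj)
    (due_lt (h.lt hj))) hn hcap hbt

/-- The best solution over all guesses is good enough. -/
theorem Sorts.isApprox (h : I.Sorts ord) {p₀ H K best : ℕ} {ε : ℝ}
    (hε : 0 < ε) (hε1 : ε < 1)
    (hp : ∀ i < n, cells I.r i ≤ p₀ + I.rate (I.due i) * (cells I.q i - cells I.c (I.due i)))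
    (hp' : p₀ = 0 ∨ ∃ i < n, p₀ + I.rate (I.due i) * (cells I.q i - cells I.c (I.due i)) =
      cells I.r i) (hH : 8 * T ≤ ε * H) (hK : 4 * roundings H n T ≤ ε * K) (hH0 : 0 < H) (hK0 : 0 < K)
    {S : Finset (Fin n)} (hS : (best : ℤ) ≤ I.val S * K)
    (hcov : ∀ j, 2 ^ j ≤ n → I.Covered H K (p₀ * 2 ^ j) best) : I.IsApprox (1 + ε) S := by
  have hK0' : (0 : ℝ) < K := by exact_mod_cast hK0
  have hH0' : (0 : ℝ) < H := by exact_mod_cast hH0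
  obtain ⟨O, -, hO⟩ := Finset.exists_max_image (Finset.univ : Finset (Finset (Fin n))) I.val
    ⟨∅, Finset.mem_univ _⟩
  have hO : ∀ S', I.val S' ≤ I.val O := fun S' => hO S' (Finset.mem_univ _)
  have hS0 : (0 : ℝ) ≤ I.val S := by
    have : (0 : ℤ) ≤ I.val S * K := (Nat.cast_nonneg best).trans hS
    have := nonneg_of_mul_nonneg_left this (by exact_mod_cast hK0)
    exact_mod_cast this
  suffices hle : (I.val O : ℝ) ≤ (1 + ε) * I.val S from
    I.isApprox_of_val fun S' => le_trans (by exact_mod_cast hO S') hle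
  -- If no single item is profitable, the optimum is at most 0 and any solution of nonnegative value
  -- will do.
  rcases Nat.eq_zero_or_pos p₀ with rfl | hpos
  · have : I.val O ≤ 0 := by simpa using h.val_le hp O
    have : (I.val O : ℝ) ≤ 0 := by exact_mod_cast this
    exact this.trans (mul_nonneg (by linarith) hS0)
  have hlow : (p₀ : ℤ) ≤ I.val O := by
    obtain ⟨i, hi, e⟩ := hp'.resolve_left hpos.ne'
    refine le_trans ?_ ((le_val_singleton (I := I) ⟨i, hi⟩).trans (hO _))
    zify at e
    dsimp only
    linarith
  have hup := h.val_le hp O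
  obtain ⟨N, hN⟩ : ∃ N : ℕ, I.val O = N := ⟨_, (Int.toNat_of_nonneg (by omega)).symm⟩
  rw [hN] at hlow hup
  norm_cast at hlow hup
  -- The guess that is right up to a factor of 2; it is among those tried because N ≤ n p₀.
  obtain ⟨j, hj1, hj2⟩ : ∃ j, p₀ * 2 ^ j ≤ N ∧ N < p₀ * 2 ^ (j + 1) := by
    have hd : N / p₀ ≠ 0 := (Nat.div_pos hlow hpos).ne'
    refine ⟨Nat.log 2 (N / p₀), ?_, ?_⟩
    · rw [mul_comm]; exact (Nat.le_div_iff_mul_le hpos).1 (Nat.pow_log_le_self 2 hd)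
    · rw [mul_comm]
      exact (Nat.div_lt_iff_lt_mul hpos).1 (Nat.lt_pow_succ_log_self (by omega) _)
  have hjn : 2 ^ j ≤ n := by
    refine Nat.le_of_mul_le_mul_left ?_ hpos
    rw [mul_comm p₀ n]; exact hj1.trans hup
  have hV : 0 < p₀ * 2 ^ j := by positivity
  have hc := hcov j hjn hV (fun S' => (hO S').trans (by
    rw [hN]; rw [pow_succ] at hj2; push_cast; zify at hj2; linarith)) O
  generalize p₀ * 2 ^ j = V at hc hj1 hV
  have hc' : (H * K * I.val O : ℝ) ≤ H * (best + roundings H n T * V) + K * (T * (2 * V)) := by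
    exact_mod_cast hc
  have hS' : (best : ℝ) ≤ I.val S * K := by exact_mod_cast hS
  have hVO : (V : ℝ) ≤ I.val O := by rw [hN]; exact_mod_cast hj1
  have hV0 : (0 : ℝ) ≤ V := Nat.cast_nonneg _
  have e1 := mul_le_mul_of_nonneg_right hH (mul_nonneg hK0'.le hV0)
  have e2 := mul_le_mul_of_nonneg_right hK (mul_nonneg hH0'.le hV0)
  have e3 := mul_le_mul_of_nonneg_left hS' hH0'.le
  -- The choice of H makes the loss 2TV / H at most εV / 4, and the choice of K does the same for
  -- the roundings.
  have e4 : (H * K : ℝ) * I.val O ≤ (H * K) * (I.val S + ε / 2 * V) := by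
    ring_nf at *
    linarith
  have e5 := le_of_mul_le_mul_left e4 (mul_pos hH0' hK0')
  have e6 : ε / 2 * V ≤ ε / 2 * I.val O := mul_le_mul_of_nonneg_left hVO (by linarith)
  have e7 : (0 : ℝ) ≤ I.val O := hV0.trans hVO
  -- It remains that (1 + ε)(1 - ε / 2) ≥ 1, which is ε(1 - ε) ≥ 0.
  nlinarith [mul_nonneg hε.le e7, mul_nonneg (mul_nonneg hε.le (sub_nonneg.2 hε1.le)) e7]

end MPBKPS

/-! ### Counting loops -/

namespace WordRAM

infixr:30 " ;; " => Cmd.seq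
infix:40 " ≔ " => Cmd.assign

/-- `for x < y do p`. -/
def Cmd.forLt (x y : ℕ) (p : Cmd) : Cmd :=
  x ≔ .lit 0 ;; Cmd.loop ((Exp.var x).lt (.var y)) (p ;; x ≔ .var x + .lit 1)

variable {U : ℕ} {s : State} {Q : State → Prop}

theorem Runs.assign (hU : 2 ≤ U) (hs : s.Bdd U) {x : ℕ} {e : Exp} (he : e.leaves ≤ maxLeaves)
    (hv : e.eval s < U) (hQ : Q (s.setVar x (e.eval s))) : Runs U (x ≔ e) s (e.cost + 1) Q :=
  Runs.of_wp hU (by simpa [Cmd.straight] using he) le_rfl hs ⟨hv, hQ⟩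

/-- Each round adds 4 steps for the test and 4 for the increment; the first assignment and the last
test take 2 and 4. The invariant must survive changes of the counter, which is why `hI` is required.
-/
theorem Runs.forLt (hU : 2 ≤ U) {x y : ℕ} {p : Cmd} {b : ℕ} (hxy : x ≠ y)
    (hx : p.assigns x = false) (hy : p.assigns y = false) (I : ℕ → State → Prop)
    {N : ℕ} (hN : s.var y = N) (hI : ∀ i s v, I i s → I i (s.setVar x v)) (hs : s.Bdd U) (h₀ : I 0 s)
    (hbody : ∀ i s', i < N → s'.Bdd U → Frame (Cmd.forLt x y p) s s' → s'.var x = i → I i s' →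
      Runs U p s' b (I (i + 1))) :
    Runs U (Cmd.forLt x y p) s (N * (b + 8) + 6) (I N) := by
  subst hN
  have hyU := hs.1 y
  have h1 : Runs U (x ≔ .lit 0) s 2 fun s' => s' = s.setVar x 0 :=
    Runs.assign hU hs (by simp [Exp.leaves, maxLeaves]) (by simp; omega) (by simp)
  refine (h1.seq fun s₁ hB₁ _ e₁ => Runs.loop hU (b := b + 4) (by simp [Exp.lt, Exp.leaves, maxLeaves])
    (fun i s' => s'.var x = i ∧ I i s') (s.var y) hB₁ ?_ ?_ ?_).mono ?_ fun s' _ _ h => h.2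
  · subst e₁; exact ⟨by simp, hI _ _ _ h₀⟩
  · intro i s' hi hB hF hIi
    subst e₁
    have hys : s'.var y = s.var y := by
      rw [hF.var y (by simp [Cmd.assigns, hy, Ne.symm hxy])]; simp [Ne.symm hxy]
    refine ⟨by simp [hIi.1, hys, hi], ?_⟩
    have hF' : Frame (Cmd.forLt x y p) s s' := by
      refine Frame.trans (s₂ := s.setVar x 0) ⟨fun z hz => ?_, fun _ _ => rfl⟩
        (hF.mono (fun z hz => ?_) fun z hz => ?_)
      · have : z ≠ x := fun h => by simp [Cmd.forLt, Cmd.assigns, h] at hz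
        simp [this]
      · simp only [Cmd.forLt, Cmd.assigns, Bool.or_eq_false_iff] at hz ⊢; exact hz.2
      · simp only [Cmd.forLt, Cmd.writes, Bool.or_eq_false_iff] at hz ⊢; exact hz.2
    refine (hbody i s' hi hB hF' hIi.1 hIi.2).seq fun s₂ hB₂ hF₂ hI₂ => ?_
    have hxs : s₂.var x = i := by rw [hF₂.var x hx]; exact hIi.1
    refine Runs.assign hU hB₂ (show 1 + 2 ≤ 64 by omega) ?_ ?_
    · simp [hxs]; omega
    · exact ⟨by simp [hxs], hI _ _ _ hI₂⟩
  · intro s' hB hF hIi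
    subst e₁
    have hys : s'.var y = s.var y := by
      rw [hF.var y (by simp [Cmd.assigns, hy, Ne.symm hxy])]; simp [Ne.symm hxy]
    simp [hIi.1, hys]
  · have : (Exp.lt (.var x) (.var y)).cost = 3 := rfl
    rw [this]
    have : b + 8 = 3 + 1 + (b + 4) := by omega
    rw [this]
    omega

end WordRAM

namespace MPBKPS

open WordRAM Exp Cmd

/-! ### Input data and bounds -/

section
variable {n T : ℕ} {I : MPBKPS n T} {ε : ℚ}

/-- The state holds the input `(I, ε)`. -/
structure Env (I : MPBKPS n T) (ε : ℚ) (s : State) : Prop where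
  n : s.var 0 = n
  T : s.var 1 = T
  num : s.var 2 = ε.num.natAbs
  den : s.var 3 = ε.den
  c : s.arr 0 = cells I.c
  B : s.arr 1 = cells I.B
  r : s.arr 2 = cells I.r
  q : s.arr 3 = cells I.q
  d : s.arr 4 = I.due

theorem env_input : Env I ε (I.input ε) := ⟨rfl, rfl, rfl, rfl, rfl, rfl, rfl, rfl, rfl⟩

/-- The command does not modify the input. -/
def keepsInput (p : Cmd) : Bool :=
  !(p.assigns 0 || p.assigns 1 || p.assigns 2 || p.assigns 3 || p.writes 0 || p.writes 1 ||
    p.writes 2 || p.writes 3 || p.writes 4)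

theorem Env.frame {s s' : State} (h : Env I ε s) {p : Cmd} (hF : Frame p s s')
    (hp : keepsInput p = true) : Env I ε s' := by
  simp only [keepsInput, Bool.not_eq_true', Bool.or_eq_false_iff] at hp
  obtain ⟨⟨⟨⟨⟨⟨⟨⟨h0, h1⟩, h2⟩, h3⟩, a0⟩, a1⟩, a2⟩, a3⟩, a4⟩ := hp
  exact ⟨(hF.var 0 h0).trans h.n, (hF.var 1 h1).trans h.T, (hF.var 2 h2).trans h.num,
    (hF.var 3 h3).trans h.den, (hF.arr 0 a0).trans h.c, (hF.arr 1 a1).trans h.B,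
    (hF.arr 2 a2).trans h.r, (hF.arr 3 a3).trans h.q, (hF.arr 4 a4).trans h.d⟩

theorem cells_le_sum {m : ℕ} (f : Fin m → ℕ) (j : ℕ) : cells f j ≤ ∑ i, f i := by
  unfold cells
  split
  · exact Finset.single_le_sum (f := f) (fun _ _ => Nat.zero_le _) (Finset.mem_univ _)
  · exact Nat.zero_le _

variable (I ε)

theorem magnitude_eq : I.magnitude ε = 2 + n + T + ε.num.natAbs + ε.den +
    (∑ t, I.c t + ∑ t, I.B t) + (∑ i, I.r i + ∑ i, I.q i + ∑ i, (I.d i : ℕ)) := by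
  simp only [magnitude, Finset.sum_add_distrib]

theorem n_le_magnitude : n ≤ I.magnitude ε := by rw [magnitude_eq]; omega
theorem T_le_magnitude : T ≤ I.magnitude ε := by rw [magnitude_eq]; omega
theorem num_le_magnitude : ε.num.natAbs ≤ I.magnitude ε := by rw [magnitude_eq]; omega
theorem den_le_magnitude : ε.den ≤ I.magnitude ε := by rw [magnitude_eq]; omega
theorem two_le_magnitude : 2 ≤ I.magnitude ε := by rw [magnitude_eq]; omega

theorem c_le_magnitude (j : ℕ) : cells I.c j ≤ I.magnitude ε := by
  have := cells_le_sum I.c j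
  rw [magnitude_eq]; omega

theorem B_le_magnitude (j : ℕ) : cells I.B j ≤ I.magnitude ε := by
  have := cells_le_sum I.B j
  rw [magnitude_eq]; omega

theorem r_le_magnitude (j : ℕ) : cells I.r j ≤ I.magnitude ε := by
  have := cells_le_sum I.r j
  rw [magnitude_eq]; omega

theorem q_le_magnitude (j : ℕ) : cells I.q j ≤ I.magnitude ε := by
  have := cells_le_sum I.q j
  rw [magnitude_eq]; omega

theorem due_le_magnitude (j : ℕ) : I.due j ≤ I.magnitude ε := by
  have := cells_le_sum (fun i => (I.d i : ℕ)) j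
  rw [magnitude_eq]; unfold due; omega

/-- A bound on all words in memory. -/
def wordBound : ℕ := I.magnitude ε ^ 16

variable {I ε}

theorem lt_wordBound {x k : ℕ} (hx : x ≤ I.magnitude ε ^ k) (hk : k < 16) :
    x < wordBound I ε :=
  hx.trans_lt (Nat.pow_lt_pow_right (two_le_magnitude I ε) hk)

theorem lt_wordBound' {x : ℕ} (hx : x ≤ I.magnitude ε) : x < wordBound I ε :=
  lt_wordBound (k := 1) (by simpa using hx) (by omega)

theorem two_le_wordBound : 2 ≤ wordBound I ε :=
  (two_le_magnitude I ε).trans (Nat.le_self_pow (by omega) _)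

theorem bdd_input : (I.input ε).Bdd (wordBound I ε) := by
  refine ⟨fun x => lt_wordBound' ?_, fun a i => lt_wordBound' ?_⟩
  · simp only [input]
    split
    exacts [n_le_magnitude I ε, T_le_magnitude I ε, num_le_magnitude I ε, den_le_magnitude I ε,
      Nat.zero_le _]
  · simp only [input]
    split
    exacts [c_le_magnitude I ε i, B_le_magnitude I ε i, r_le_magnitude I ε i, q_le_magnitude I ε i,
      due_le_magnitude I ε i, Nat.zero_le _]

theorem rate_le_magnitude (t : ℕ) : I.rate t ≤ I.magnitude ε :=
  (prefixMin_le _ t).trans (B_le_magnitude I ε t)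

/-! ### Penalty rates -/

/-- Writes the lowest rates up to each period to array `6`. -/
def ratesCmd : Cmd :=
  6 ≔ load 1 (lit 0) ;;
  forLt 4 1
    (cond ((load 1 (var 4)).lt (var 6)) (6 ≔ load 1 (var 4)) skip ;; write 6 (var 4) (var 6))

theorem runs_ratesCmd {s : State} (hs : s.Bdd (wordBound I ε)) (hE : Env I ε s) :
    Runs (wordBound I ε) ratesCmd s (40 * T + 10) fun s' => ∀ t < T, s'.arr 6 t = I.rate t := by
  have h1 : Runs (wordBound I ε) (6 ≔ load 1 (lit 0)) s 3 fun s' => s'.var 6 = cells I.B 0 :=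
    Runs.assign two_le_wordBound hs (by decide) (hs.2 1 0) (by simp [hE.B])
  refine (h1.seq fun s₁ hB₁ hF₁ e₁ => Runs.forLt (x := 4) (y := 1) (b := 11) two_le_wordBound (by decide) rfl rfl
      -- Truncated subtraction makes the invariant ask for the rate of period 0 at the start,
      -- matching the initialization.
      (fun i s' => s'.var 6 = I.rate (i - 1) ∧ ∀ t < i, s'.arr 6 t = I.rate t)
      (hE.frame hF₁ rfl).T ?_ hB₁ ?_
      fun i s' hi hB hF hx hI => ?_).mono ?_ fun s' _ _ h => ?_
  · intro i s v h; simpa using h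
  · exact ⟨by simpa [rate, prefixMin] using e₁, by omega⟩
  · obtain ⟨h1, h2⟩ := hI
    have hE' := (hE.frame hF₁ rfl).frame hF rfl
    refine Runs.of_wp two_le_wordBound rfl (by decide) hB ?_
    have hw : ∀ v, v = I.rate i → (∀ t < i + 1, (if t = i then v else s'.arr 6 t) = I.rate t) := by
      rintro v rfl t ht
      split_ifs with h
      · rw [h]
      · exact h2 t (by omega)
    have hmin : i ≠ 0 → I.rate i = min (I.rate (i - 1)) (cells I.B i) := by
      intro h
      obtain ⟨j, rfl⟩ := Nat.exists_eq_succ_of_ne_zero h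
      rfl
    have hv : cells I.B i < wordBound I ε := lt_wordBound' (B_le_magnitude I ε i)
    have hv' : I.rate (i - 1) < wordBound I ε := lt_wordBound' (rate_le_magnitude (i - 1))
    have hcase : (cells I.B i < I.rate (i - 1) → cells I.B i = I.rate i) ∧
        (¬ cells I.B i < I.rate (i - 1) → I.rate (i - 1) = I.rate i) := by
      by_cases h0 : i = 0
      · subst h0; simp [rate, prefixMin]
      · rw [hmin h0]; omega
    simp only [wp, eval_lt, eval_load, eval_var, hE'.B, hx, h1, setVar_var, setVar_arr, if_true,
      setCell_var, setCell_arr, Nat.add_sub_cancel, true_and]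
    refine ⟨fun h => ⟨hv, by simpa using hv, ?_⟩, fun h => ⟨hv', ?_⟩⟩
    · have h' : cells I.B i < I.rate (i - 1) := by simpa using h
      exact ⟨hcase.1 h', by simpa using hw _ (hcase.1 h')⟩
    · have h' : ¬ cells I.B i < I.rate (i - 1) := by simpa using h
      exact ⟨hcase.2 h', by simpa using hw _ (hcase.2 h')⟩
  · omega
  · exact h.2

end

end MPBKPS

namespace MPBKPS

open WordRAM Exp Cmd Sequential

variable {n T : ℕ} {I : MPBKPS n T} {ε : ℚ}

/-! ### The best single item and the scaling parameters -/

/-- The penalty for taking item `i` alone. -/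
def penalty (I : MPBKPS n T) (i : ℕ) : ℕ :=
  I.rate (I.due i) * (cells I.q i - cells I.c (I.due i))

/-- The profit of the item whose number is in variable `4`. -/
def singleExp : Exp :=
  load 2 (var 4) - load 6 (load 4 (var 4)) * (load 3 (var 4) - load 0 (load 4 (var 4)))

/-- Stores the largest profit of a single item in variable `9`. -/
def singleCmd : Cmd :=
  9 ≔ lit 0 ;; forLt 4 0 (cond ((var 9).lt singleExp) (9 ≔ singleExp) skip)

/-- `p₀` is the largest profit of at most one item. -/
structure BestSingle (I : MPBKPS n T) (p₀ : ℕ) : Prop where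
  le : ∀ i < n, cells I.r i ≤ p₀ + I.penalty i
  eq : p₀ = 0 ∨ ∃ i < n, p₀ + I.penalty i = cells I.r i

theorem BestSingle.le_magnitude {p₀ : ℕ} (h : I.BestSingle p₀) : p₀ ≤ I.magnitude ε := by
  rcases h.eq with rfl | ⟨i, _, e⟩
  · exact Nat.zero_le _
  · have := r_le_magnitude I ε i; omega

theorem runs_singleCmd {s : State} (hs : s.Bdd (wordBound I ε)) (hE : Env I ε s)
    (hr : ∀ t < T, s.arr 6 t = I.rate t) :
    Runs (wordBound I ε) singleCmd s (40 * n + 10) fun s' => I.BestSingle (s'.var 9) := by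
  have h1 : Runs (wordBound I ε) (9 ≔ lit 0) s 2 fun s' => s'.var 9 = 0 :=
    Runs.assign two_le_wordBound hs (by decide) (lt_wordBound' (Nat.zero_le _)) (by simp)
  refine (h1.seq fun s₁ hB₁ hF₁ e₁ => Runs.forLt (x := 4) (y := 0) (b := 30) two_le_wordBound
      (by decide) rfl rfl
      (fun k s' => (∀ i < k, cells I.r i ≤ s'.var 9 + I.penalty i) ∧
        (s'.var 9 = 0 ∨ ∃ i < n, s'.var 9 + I.penalty i = cells I.r i))
      (hE.frame hF₁ rfl).n ?_ hB₁ ⟨by omega, .inl e₁⟩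
      fun k s' hk hB hF hx hI => ?_).mono (by omega) fun s' _ _ h => ⟨h.1, h.2⟩
  · intro i s v h; simpa using h
  · obtain ⟨h1, h2⟩ := hI
    have hE' := (hE.frame hF₁ rfl).frame hF rfl
    have hr' : s'.arr 6 (I.due k) = I.rate (I.due k) := by
      rw [hF.arr 6 rfl, hF₁.arr 6 rfl, hr _ (due_lt hk)]
    have hv : singleExp.eval s' = cells I.r k - I.penalty k := by
      simp only [singleExp, eval_sub, eval_mul, eval_load, eval_var, hE'.r, hE'.d, hE'.q, hE'.c, hx,
        hr']; rfl
    refine Runs.of_wp two_le_wordBound rfl (by decide) hB ?_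
    simp only [wp, eval_lt, eval_var, hv]
    refine ⟨fun h => ?_, fun h => ?_⟩
    · have h : s'.var 9 < cells I.r k - I.penalty k := ite_one_ne_zero.1 h
      refine ⟨lt_wordBound' ((Nat.sub_le _ _).trans (r_le_magnitude I ε k)), ?_, ?_⟩
      · intro i hi
        simp only [setVar_var, if_true]
        rcases Nat.lt_succ_iff_lt_or_eq.1 hi with hi | rfl
        · have := h1 i hi; omega
        · omega
      · right
        exact ⟨k, hk, by simp only [setVar_var, if_true]; omega⟩
    · have h : ¬ s'.var 9 < cells I.r k - I.penalty k := ite_one_eq_zero.1 h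
      refine ⟨fun i hi => ?_, h2⟩
      rcases Nat.lt_succ_iff_lt_or_eq.1 hi with hi | rfl
      · exact h1 i hi
      · omega

/-- Bundles have rewards of about `1 / hParam` times the guess. -/
def hParam (T : ℕ) (ε : ℚ) : ℕ := 8 * T * ε.den / ε.num.natAbs + 1

/-- Profits are rounded to multiples of `1 / kParam` times the guess. -/
def kParam (n T : ℕ) (ε : ℚ) : ℕ :=
  4 * roundings (hParam T ε) n T * ε.den / ε.num.natAbs + 1

/-- Computes the parameters and initializes the search. -/
def paramCmd : Cmd :=
  10 ≔ lit 8 * var 1 * var 3 / var 2 + lit 1 ;;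
  11 ≔ lit 2 * var 10 + lit 3 * var 1 ;;
  cond ((var 0).lt (var 11)) (11 ≔ var 0) skip ;;
  12 ≔ lit 4 * var 11 * var 3 / var 2 + lit 1 ;;
  13 ≔ lit 2 * var 12 ;;
  14 ≔ var 13 + lit 1 ;;
  15 ≔ lit 1 ;;
  16 ≔ lit 0

theorem hParam_le (I : MPBKPS n T) (ε : ℚ) : hParam T ε ≤ I.magnitude ε ^ 6 := by
  have h1 := T_le_magnitude I ε
  have h2 := den_le_magnitude I ε
  have h3 := two_le_magnitude I ε
  set M := I.magnitude ε
  calc hParam T ε ≤ 8 * T * ε.den + 1 := Nat.add_le_add_right (Nat.div_le_self _ _) 1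
    _ ≤ 8 * M * M + 8 * M * M := by
        refine Nat.add_le_add (Nat.mul_le_mul (Nat.mul_le_mul_left _ h1) h2) ?_
        nlinarith
    _ = 2 ^ 4 * M ^ 2 := by ring
    _ ≤ M ^ 4 * M ^ 2 := Nat.mul_le_mul_right _ (Nat.pow_le_pow_left h3 4)
    _ = M ^ 6 := by ring

theorem kParam_le (I : MPBKPS n T) (ε : ℚ) : kParam n T ε ≤ I.magnitude ε ^ 5 := by
  have h1 : roundings (hParam T ε) n T ≤ I.magnitude ε :=
    (min_le_right _ _).trans (n_le_magnitude I ε)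
  have h2 := den_le_magnitude I ε
  have h3 := two_le_magnitude I ε
  set M := I.magnitude ε
  calc kParam n T ε ≤ 4 * roundings (hParam T ε) n T * ε.den + 1 :=
        Nat.add_le_add_right (Nat.div_le_self _ _) 1
    _ ≤ 4 * M * M + 4 * M * M := by
        refine Nat.add_le_add (Nat.mul_le_mul (Nat.mul_le_mul_left _ h1) h2) ?_
        nlinarith
    _ = 2 ^ 3 * M ^ 2 := by ring
    _ ≤ M ^ 3 * M ^ 2 := Nat.mul_le_mul_right _ (Nat.pow_le_pow_left h3 3)
    _ = M ^ 5 := by ring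

theorem width_le (I : MPBKPS n T) (ε : ℚ) : 2 * kParam n T ε + 1 ≤ I.magnitude ε ^ 7 := by
  have h1 := kParam_le I ε
  have h3 := two_le_magnitude I ε
  have h4 : 0 < kParam n T ε := Nat.succ_pos _
  have h5 := Nat.mul_le_mul (Nat.pow_le_pow_left h3 2) h1
  rw [← pow_add] at h5
  simp only [Nat.reduceAdd, Nat.reducePow] at h5
  omega

/-- The scaling parameters are in place. -/
structure Params (I : MPBKPS n T) (ε : ℚ) (s : State) : Prop where
  H : s.var 10 = hParam T ε
  K : s.var 12 = kParam n T ε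
  cap : s.var 13 = 2 * kParam n T ε
  width : s.var 14 = 2 * kParam n T ε + 1

theorem runs_paramCmd {s : State} (hs : s.Bdd (wordBound I ε)) (hE : Env I ε s) :
    Runs (wordBound I ε) paramCmd s 70 fun s' =>
      Params I ε s' ∧ s'.var 15 = 1 ∧ s'.var 16 = 0 := by
  refine Runs.of_wp two_le_wordBound rfl (by decide) hs ?_
  have hH : 8 * T * ε.den / ε.num.natAbs + 1 = hParam T ε := rfl
  have hn : n < wordBound I ε := lt_wordBound' (n_le_magnitude I ε)
  have b1 : hParam T ε < wordBound I ε := lt_wordBound (hParam_le I ε) (by omega)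
  have b2 : kParam n T ε < wordBound I ε := lt_wordBound (kParam_le I ε) (by omega)
  have b3 : 2 * kParam n T ε + 1 < wordBound I ε := lt_wordBound (width_le I ε) (by omega)
  have b4 : 2 * hParam T ε + 3 * T < wordBound I ε := by
    refine lt_wordBound (k := 10) ?_ (by omega)
    have h1 := hParam_le I ε
    have h2 := T_le_magnitude I ε
    have h3 := two_le_magnitude I ε
    set M := I.magnitude ε
    have h4 : M ≤ M ^ 6 := Nat.le_self_pow (by omega) M
    calc 2 * hParam T ε + 3 * T ≤ 2 ^ 4 * M ^ 6 := by omega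
      _ ≤ M ^ 4 * M ^ 6 := Nat.mul_le_mul_right _ (Nat.pow_le_pow_left h3 4)
      _ = M ^ 10 := by ring
  have one : 1 < wordBound I ε := two_le_wordBound
  simp only [paramCmd, wp, eval_add, eval_mul, eval_div, eval_lt, eval_lit, eval_var, setVar_var,
    hE.n, hE.T, hE.num, hE.den, if_true, Nat.reduceEqDiff, if_false, hH]
  refine ⟨b1, b4, fun h => ⟨hn, ?_⟩, fun h => ?_⟩
  · have hk : 4 * n * ε.den / ε.num.natAbs + 1 = kParam n T ε := by
      have h : n < 2 * hParam T ε + 3 * T := by simpa using h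
      rw [kParam, roundings, min_eq_right h.le]
    rw [hk]
    exact ⟨b2, by omega, b3, one, by omega, ⟨by simp, by simp, by simp, by simp⟩, by simp, by simp⟩
  · have hk : 4 * (2 * hParam T ε + 3 * T) * ε.den / ε.num.natAbs + 1 = kParam n T ε := by
      have h : ¬ n < 2 * hParam T ε + 3 * T := by simpa using h
      rw [kParam, roundings, min_eq_left (not_lt.1 h)]
    rw [hk]
    exact ⟨b2, by omega, b3, one, by omega, ⟨by simp, by simp, by simp, by simp⟩, by simp, by simp⟩

end MPBKPS

namespace MPBKPS

open WordRAM Exp Cmd Sequential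

/-! ### Merge sort -/

/-- The values of `f` at `a, …, b - 1`. -/
def slice (f : ℕ → ℕ) (a b : ℕ) : List ℕ := (List.range' a (b - a)).map f

section slice
variable {f g : ℕ → ℕ} {a b c : ℕ}

theorem slice_of_ge (h : b ≤ a) : slice f a b = [] := by simp [slice, Nat.sub_eq_zero_of_le h]

theorem slice_cons (h : a < b) : slice f a b = f a :: slice f (a + 1) b := by
  obtain ⟨k, rfl⟩ := Nat.exists_eq_add_of_lt h
  rw [slice, slice, show a + k + 1 - a = k + 1 by omega, show a + k + 1 - (a + 1) = k by omega,
    List.range'_succ, List.map_cons]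

theorem slice_append (hab : a ≤ b) (hbc : b ≤ c) : slice f a b ++ slice f b c = slice f a c := by
  have := List.range'_append (s := a) (m := b - a) (n := c - b) (step := 1)
  rw [one_mul, show a + (b - a) = b by omega, show b - a + (c - b) = c - a by omega] at this
  rw [slice, slice, slice, ← List.map_append, this]

theorem slice_succ (h : a ≤ b) : slice f a (b + 1) = slice f a b ++ [f b] := by
  rw [← slice_append h b.le_succ, slice_cons b.lt_succ_self, slice_of_ge le_rfl]

theorem slice_congr (h : ∀ x, a ≤ x → x < b → f x = g x) : slice f a b = slice g a b := by
  refine List.map_congr_left fun x hx => ?_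
  rw [List.mem_range'_1] at hx
  exact h x hx.1 (by omega)

theorem slice_zero (n : ℕ) : slice f 0 n = (List.range n).map f := by
  rw [slice, List.range_eq_range', Nat.sub_zero]

end slice

/-- The beginning of block `m` of width `w`. -/
def bd (n w m : ℕ) : ℕ := min (m * w) n

/-- All blocks of width `w` are sorted. -/
def BlockSorted (le : ℕ → ℕ → Bool) (n w : ℕ) (f : ℕ → ℕ) : Prop :=
  ∀ m, (slice f (bd n w m) (bd n w (m + 1))).Pairwise fun a b => le a b = true

/-- The first `N` pairs of blocks of `A` are merged in `D`. -/
def Merged (le : ℕ → ℕ → Bool) (n w N : ℕ) (A D : ℕ → ℕ) : Prop :=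
  ∀ m < N, slice D (bd n w (2 * m)) (bd n w (2 * m + 2)) =
    (slice A (bd n w (2 * m)) (bd n w (2 * m + 1))).merge
      (slice A (bd n w (2 * m + 1)) (bd n w (2 * m + 2))) le

section merge
variable {le : ℕ → ℕ → Bool} {n w N : ℕ} {A D : ℕ → ℕ}

theorem bd_mono {m m' : ℕ} (h : m ≤ m') : bd n w m ≤ bd n w m' :=
  min_le_min_right _ (Nat.mul_le_mul_right w h)

theorem bd_two_mul (m : ℕ) : bd n (2 * w) m = bd n w (2 * m) := by
  rw [bd, bd]; congr 1; ring

theorem Merged.perm (h : Merged le n w N A D) {m : ℕ} (hm : m ≤ N) :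
    (slice D 0 (bd n w (2 * m))).Perm (slice A 0 (bd n w (2 * m))) := by
  induction m with
  | zero => simp [bd, slice]
  | succ m ih =>
    have e : 2 * (m + 1) = 2 * m + 2 := by ring
    rw [e, ← slice_append (Nat.zero_le _) (bd_mono (show 2 * m ≤ 2 * m + 2 by omega)),
      ← slice_append (f := A) (Nat.zero_le _) (bd_mono (show 2 * m ≤ 2 * m + 2 by omega)),
      h m (by omega), ← slice_append (f := A) (bd_mono (show 2 * m ≤ 2 * m + 1 by omega))
        (bd_mono (show 2 * m + 1 ≤ 2 * m + 2 by omega))]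
    exact (ih (by omega)).append (List.merge_perm_append _)

theorem Merged.blockSorted (h : Merged le n w N A D) (hN : n ≤ bd n w (2 * N))
    (htrans : ∀ a b c, le a b = true → le b c = true → le a c = true)
    (htotal : ∀ a b, (le a b || le b a) = true) (hA : BlockSorted le n w A) :
    BlockSorted le n (2 * w) D := by
  intro m
  rw [bd_two_mul, bd_two_mul, show 2 * (m + 1) = 2 * m + 2 by ring]
  by_cases hm : m < N
  · rw [h m hm]
    exact List.pairwise_merge htrans htotal _ _ (hA _) (hA _)
  -- The N pairs reach up to n, so later blocks are empty.
  · rw [slice_of_ge]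
    · exact List.Pairwise.nil
    · exact (min_le_right _ _).trans (hN.trans (bd_mono (by omega)))

end merge

/-- The test whether item `x` precedes item `y`. -/
def leExp (x y : Exp) : Exp :=
  (load 4 x).lt (load 4 y) +
    (load 4 x).eq (load 4 y) * (load 2 x * load 3 y |>.lt (load 2 y * load 3 x)).not

/-- Writes the next item of the merged list. -/
def mergeStepCmd : Cmd :=
  24 ≔ load 7 (var 22) ;;
  25 ≔ load 7 (var 23) ;;
  cond ((var 22).lt (var 20) * (((var 23).lt (var 21)).not + leExp (var 24) (var 25)))
    (write 8 (var 4) (var 24) ;; 22 ≔ var 22 + lit 1)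
    (write 8 (var 4) (var 25) ;; 23 ≔ var 23 + lit 1) ;;
  4 ≔ var 4 + lit 1

/-- Computes the boundaries of the next two blocks. -/
def blockInitCmd : Cmd :=
  20 ≔ var 19 + var 18 ;;
  cond ((var 0).lt (var 20)) (20 ≔ var 0) skip ;;
  21 ≔ var 20 + var 18 ;;
  cond ((var 0).lt (var 21)) (21 ≔ var 0) skip ;;
  22 ≔ var 19 ;;
  23 ≔ var 20 ;;
  4 ≔ var 19

/-- Merges two blocks. -/
def blockCmd : Cmd :=
  blockInitCmd ;; loop ((var 4).lt (var 21)) mergeStepCmd ;; 19 ≔ var 21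

/-- Merges all pairs of blocks and doubles the width. -/
def passCmd : Cmd :=
  19 ≔ lit 0 ;;
  loop ((var 19).lt (var 0)) blockCmd ;;
  forLt 4 0 (write 7 (var 4) (load 8 (var 4))) ;;
  18 ≔ var 18 + var 18

/-- Sorts the items by deadline and by reward per size into array `7`. -/
def sortCmd : Cmd :=
  forLt 4 0 (write 7 (var 4) (var 4)) ;;
  18 ≔ lit 1 ;;
  loop ((var 18).lt (var 0)) passCmd

variable {n T : ℕ} {I : MPBKPS n T} {ε : ℚ}

/-- The order of the items, made total by positive sizes for numbers that are not items. -/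
def itemLe (I : MPBKPS n T) (i j : ℕ) : Bool :=
  I.due i < I.due j || (I.due i = I.due j &&
    cells I.r j * max 1 (cells I.q i) ≤ cells I.r i * max 1 (cells I.q j))

theorem itemLe_iff {i j : ℕ} : I.itemLe i j = true ↔
    Precedes I.due (cells I.r) (fun i => max 1 (cells I.q i)) i j := by
  simp [itemLe, Precedes]

/-- Comparing fractions by cross multiplication is transitive only for a positive middle
denominator; the maximum with 1 provides it for numbers that are not items. -/
theorem itemLe_trans (a b c : ℕ) (hab : I.itemLe a b = true) (hbc : I.itemLe b c = true) :
    I.itemLe a c = true := by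
  rw [itemLe_iff] at *
  rcases hab with hab | ⟨hab, hab'⟩
  · rcases hbc with hbc | ⟨hbc, -⟩
    · exact .inl (hab.trans hbc)
    · exact .inl (hbc ▸ hab)
  · rcases hbc with hbc | ⟨hbc, hbc'⟩
    · exact .inl (hab ▸ hbc)
    · refine .inr ⟨hab.trans hbc, ?_⟩
      have hb : 0 < max 1 (cells I.q b) := lt_max_of_lt_left one_pos
      dsimp only at hab' hbc' ⊢
      generalize max 1 (cells I.q b) = y at *
      generalize max 1 (cells I.q a) = x at *
      generalize max 1 (cells I.q c) = z at *
      refine Nat.le_of_mul_le_mul_right ?_ hb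
      calc cells I.r c * x * y = cells I.r c * y * x := by ring
        _ ≤ cells I.r b * z * x := Nat.mul_le_mul_right _ hbc'
        _ = cells I.r b * x * z := by ring
        _ ≤ cells I.r a * y * z := Nat.mul_le_mul_right _ hab'
        _ = _ := by ring

theorem itemLe_total (a b : ℕ) : (I.itemLe a b || I.itemLe b a) = true := by
  rw [Bool.or_eq_true, itemLe_iff, itemLe_iff, Precedes, Precedes]
  have := Nat.le_total (cells I.r b * max 1 (cells I.q a)) (cells I.r a * max 1 (cells I.q b))
  omega

theorem itemLe_iff_precedes {i j : ℕ} (hi : i < n) (hj : j < n) :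
    I.itemLe i j = true ↔ Precedes I.due (cells I.r) (cells I.q) i j := by
  rw [itemLe_iff, Precedes, Precedes, max_eq_right (cells_q_pos (I := I) hi),
    max_eq_right (cells_q_pos (I := I) hj)]

theorem eval_leExp {s : State} (hE : Env I ε s) {x y : Exp} (hx : x.eval s < n)
    (hy : y.eval s < n) : (leExp x y).eval s ≠ 0 ↔ I.itemLe (x.eval s) (y.eval s) = true := by
  rw [itemLe_iff_precedes hx hy, Precedes]
  simp only [leExp, eval_add, eval_mul, eval_lt, eval_eq, eval_not, eval_load, hE.d, hE.r, hE.q]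
  by_cases h1 : I.due (x.eval s) < I.due (y.eval s)
  · simp [h1]
  · by_cases h2 : I.due (x.eval s) = I.due (y.eval s)
    · simp [h2]
    · simp [h1, h2]

/-- The state of merging the blocks `[lo, mid)` and `[mid, hi)` of `A` after `m` steps. -/
structure Merging (I : MPBKPS n T) (A D₀ : ℕ → ℕ) (lo mid hi m : ℕ) (s : State) : Prop where
  k : s.var 4 = lo + m
  i_ge : lo ≤ s.var 22
  i_le : s.var 22 ≤ mid
  j_ge : mid ≤ s.var 23
  j_le : s.var 23 ≤ hi
  count : s.var 22 + s.var 23 = lo + mid + m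
  merge : slice (s.arr 8) lo (lo + m) ++
    (slice A (s.var 22) mid).merge (slice A (s.var 23) hi) I.itemLe =
      (slice A lo mid).merge (slice A mid hi) I.itemLe
  old : ∀ x < lo, s.arr 8 x = D₀ x

/-- The invariant says that the part already written followed by the `List.merge` of the two
remainders is the desired list. One step performs one unfolding of `List.merge`. -/
theorem runs_mergeStepCmd {s : State} (hs : s.Bdd (wordBound I ε)) (hE : Env I ε s)
    {A D₀ : ℕ → ℕ} {lo mid hi m : ℕ} (hA : s.arr 7 = A) (hmid : s.var 20 = mid)
    (hhi : s.var 21 = hi) (hn : hi ≤ n) (hlt : ∀ x < n, A x < n) (h : Merging I A D₀ lo mid hi m s)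
    (hm : lo + m < hi) :
    Runs (wordBound I ε) mergeStepCmd s 70 (Merging I A D₀ lo mid hi (m + 1)) := by
  obtain ⟨hk, hi1, hi2, hj1, hj2, hc, hmg, hold⟩ := h
  set i := s.var 22 with ei
  set j := s.var 23 with ej
  have hnM := n_le_magnitude I ε
  have bA : ∀ x, A x < wordBound I ε := fun x => hA ▸ hs.2 7 x
  have bN : ∀ x, x ≤ n → x < wordBound I ε := fun x hx => lt_wordBound' (hx.trans hnM)
  refine Runs.of_wp two_le_wordBound rfl (by decide) hs ?_
  have hE' : Env I ε ((s.setVar 24 (A i)).setVar 25 (A j)) :=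
    ⟨by simp [hE.n], by simp [hE.T], by simp [hE.num], by simp [hE.den], by simp [hE.c],
      by simp [hE.B], by simp [hE.r], by simp [hE.q], by simp [hE.d]⟩
  have hle := eval_leExp hE' (x := var 24) (y := var 25)
  have hD : ∀ v, slice (fun x => if 8 = 8 ∧ x = lo + m then v else s.arr 8 x) lo (lo + (m + 1)) =
      slice (s.arr 8) lo (lo + m) ++ [v] := by
    intro v
    rw [← add_assoc, slice_succ (by omega)]
    simp only [true_and, if_true]
    congr 1
    exact slice_congr fun x _ hx => if_neg (by omega)
  simp only [mergeStepCmd, wp, eval_load, eval_var, eval_lit, eval_add, eval_mul, eval_lt, eval_not,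
    setVar_var, setVar_arr, setCell_var, hA, hmid, hhi, hk, ← ei, ← ej, Nat.reduceEqDiff, if_false,
    if_true] at hle ⊢
  generalize (leExp (var 24) (var 25)).eval ((s.setVar 24 (A i)).setVar 25 (A j)) = e at hle ⊢
  refine ⟨bA i, bA j, fun h => ?_, fun h => ?_⟩
  · have hlt' : i < mid := by
      by_contra hc; simp [hc] at h
    have hor : j < hi → I.itemLe (A i) (A j) = true := by
      intro hjh
      refine (hle (hlt i (by omega)) (hlt j (by omega))).1 ?_
      intro he; simp [he, hjh] at h
    refine ⟨bA i, bN _ (by omega), bN _ (by omega), ?_⟩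
    refine ⟨by simp; omega, by simp; omega, by simp; omega, by simp; omega, by simp; omega,
      by simp; omega, ?_, ?_⟩
    · simp only [setVar_var, setVar_arr, setCell_var, Nat.reduceEqDiff, if_false, if_true, ← ei,
        ← ej]
      rw [← hmg]
      conv_lhs => arg 1; arg 1; ext x; rw [setCell_arr, setVar_arr, setVar_arr]
      rw [hD, List.append_assoc, List.singleton_append, slice_cons hlt']
      congr 1
      rcases hj2.lt_or_eq with hjh | hjh
      · rw [slice_cons hjh, List.cons_merge_cons, if_pos (hor hjh)]
      · rw [slice_of_ge hjh.ge]; simp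
    · intro x hx
      simp only [setVar_arr, setCell_arr, true_and]
      rw [if_neg (by omega)]; exact hold x hx
  · have hjh : j < hi := by
      by_contra hc
      have : i < mid := by omega
      simp [hc, this] at h
    have hor : i < mid → ¬ I.itemLe (A i) (A j) = true := by
      intro him hle'
      have := (hle (hlt i (by omega)) (hlt j (by omega))).2 hle'
      simp [him, this] at h
    refine ⟨bA j, bN _ (by omega), bN _ (by omega), ?_⟩
    refine ⟨by simp; omega, by simp; omega, by simp; omega, by simp; omega, by simp; omega,
      by simp; omega, ?_, ?_⟩
    · simp only [setVar_var, setVar_arr, setCell_var, Nat.reduceEqDiff, if_false, if_true, ← ei,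
        ← ej]
      rw [← hmg]
      conv_lhs => arg 1; arg 1; ext x; rw [setCell_arr, setVar_arr, setVar_arr]
      rw [hD, List.append_assoc, List.singleton_append, slice_cons hjh]
      congr 1
      rcases hi2.lt_or_eq with him | him
      · rw [slice_cons him, List.cons_merge_cons, if_neg (hor him)]
      · rw [slice_of_ge him.ge]; simp
    · intro x hx
      simp only [setVar_arr, setCell_arr, true_and]
      rw [if_neg (by omega)]; exact hold x hx

theorem runs_blockInitCmd {s : State} (hs : s.Bdd (wordBound I ε)) (hE : Env I ε s) {w m : ℕ}
    (hw : s.var 18 = w) (hwn : w < n) (hlo : s.var 19 = bd n w (2 * m)) (hlt : m * (2 * w) < n) :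
    Runs (wordBound I ε) blockInitCmd s 40 fun s' => s'.var 20 = bd n w (2 * m + 1) ∧
      s'.var 21 = bd n w (2 * m + 2) ∧ s'.var 22 = bd n w (2 * m) ∧
      s'.var 23 = bd n w (2 * m + 1) ∧ s'.var 4 = bd n w (2 * m) := by
  have e0 : bd n w (2 * m) = m * (2 * w) := by
    rw [bd, min_eq_left] <;> nlinarith
  have e1 : bd n w (2 * m + 1) = min (m * (2 * w) + w) n := by rw [bd]; congr 1; ring
  have e2 : bd n w (2 * m + 2) = min (m * (2 * w) + w + w) n := by rw [bd]; congr 1; ring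
  have bN : ∀ x, x ≤ 2 * n → x < wordBound I ε := fun x hx => by
    have h1 := n_le_magnitude I ε
    have h2 := two_le_magnitude I ε
    exact lt_wordBound (k := 2) (by nlinarith) (by omega)
  refine Runs.of_wp two_le_wordBound rfl (by decide) hs ?_
  rw [e0, e1, e2]
  rw [e0] at hlo
  generalize m * (2 * w) = lo at *
  simp only [blockInitCmd, wp, eval_var, eval_add, eval_lt, setVar_var, hw, hlo, hE.n,
    Nat.reduceEqDiff, if_false, if_true, ite_one_ne_zero, ite_one_eq_zero]
  repeat' first
    | exact bN _ (by omega)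
    | exact trivial
    | apply And.intro
    | (intro _)
    | omega

theorem runs_blockCmd {s : State} (hs : s.Bdd (wordBound I ε)) (hE : Env I ε s) {w m : ℕ}
    (hw : s.var 18 = w) (hwn : w < n) (hlo : s.var 19 = bd n w (2 * m)) (hm : m * (2 * w) < n)
    (hlt : ∀ x < n, s.arr 7 x < n) :
    Runs (wordBound I ε) blockCmd s (80 * (2 * w) + 60) fun s' =>
      s'.var 19 = bd n w (2 * m + 2) ∧
      slice (s'.arr 8) (bd n w (2 * m)) (bd n w (2 * m + 2)) =
        (slice (s.arr 7) (bd n w (2 * m)) (bd n w (2 * m + 1))).merge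
          (slice (s.arr 7) (bd n w (2 * m + 1)) (bd n w (2 * m + 2))) I.itemLe ∧
      ∀ x < bd n w (2 * m), s'.arr 8 x = s.arr 8 x := by
  have h01 : bd n w (2 * m) ≤ bd n w (2 * m + 1) := bd_mono (by omega)
  have h12 : bd n w (2 * m + 1) ≤ bd n w (2 * m + 2) := bd_mono (by omega)
  have hhn : bd n w (2 * m + 2) ≤ n := min_le_right _ _
  have hlen : bd n w (2 * m + 2) - bd n w (2 * m) ≤ 2 * w := by
    have : (2 * m + 2) * w = 2 * m * w + 2 * w := by ring
    unfold bd; omega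
  refine ((runs_blockInitCmd hs hE hw hwn hlo hm).seq (b₂ :=
    (bd n w (2 * m + 2) - bd n w (2 * m)) * (3 + 1 + 70) + (3 + 1) + 2)
    fun s₁ hB₁ hF₁ h₁ => ?_).mono ?_ fun s' _ _ h => h
  · obtain ⟨q20, q21, q22, q23, q4⟩ := h₁
    have hE₁ := hE.frame hF₁ rfl
    have hA : s₁.arr 7 = s.arr 7 := hF₁.arr 7 rfl
    refine Runs.seq (Q₁ := Merging I (s.arr 7) (s.arr 8) (bd n w (2 * m)) (bd n w (2 * m + 1))
      (bd n w (2 * m + 2)) (bd n w (2 * m + 2) - bd n w (2 * m)))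
      (Runs.loop two_le_wordBound (by decide) (Merging I (s.arr 7) (s.arr 8) (bd n w (2 * m))
        (bd n w (2 * m + 1)) (bd n w (2 * m + 2))) _ 70 hB₁ ?_ ?_ ?_) fun s₂ hB₂ hF₂ h₂ => ?_
    · refine ⟨by simp [q4], q22.ge, by omega, q23.ge, by omega, by omega, ?_, fun x _ => ?_⟩
      · rw [q22, q23, add_zero, slice_of_ge le_rfl, List.nil_append]
      · rw [hF₁.arr 8 rfl]
    · intro i s' hi hB hF hM
      have h21 : s'.var 21 = bd n w (2 * m + 2) := (hF.var 21 rfl).trans q21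
      refine ⟨?_, ?_⟩
      · simp only [eval_lt, eval_var, ite_one_ne_zero, hM.k, h21]; omega
      · exact runs_mergeStepCmd hB (hE₁.frame hF rfl) ((hF.arr 7 rfl).trans hA)
          ((hF.var 20 rfl).trans q20) h21 hhn hlt hM (by omega)
    · intro s' hB hF hM
      have h21 : s'.var 21 = bd n w (2 * m + 2) := (hF.var 21 rfl).trans q21
      simp only [eval_lt, eval_var, ite_one_eq_zero, hM.k, h21]; omega
    · have h21 : s₂.var 21 = bd n w (2 * m + 2) := (hF₂.var 21 rfl).trans q21
      refine Runs.assign two_le_wordBound hB₂ (by decide) (hB₂.1 21) ⟨by simp [h21], ?_, ?_⟩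
      -- After all steps the count forces both inputs to be exhausted, so the part written is the
      -- whole merge.
      · obtain ⟨k4, i1, i2, j1, j2, hc, hmg, -⟩ := h₂
        rw [slice_of_ge (show bd n w (2 * m + 1) ≤ s₂.var 22 by omega),
          slice_of_ge (show bd n w (2 * m + 2) ≤ s₂.var 23 by omega),
          show bd n w (2 * m) + (bd n w (2 * m + 2) - bd n w (2 * m)) = bd n w (2 * m + 2) by omega]
          at hmg
        simpa using hmg
      · exact h₂.old
  · nlinarith

/-- The last bound says that the blocks overshoot n by at most one width, which keeps a pass linear.
-/
theorem exists_block_count {n w : ℕ} (hw : 0 < w) :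
    ∃ N, (∀ m < N, m * w < n) ∧ n ≤ N * w ∧ N * w ≤ n + w := by
  classical
  have hex : ∃ N, n ≤ N * w := ⟨n, Nat.le_mul_of_pos_right n hw⟩
  refine ⟨Nat.find hex, fun m hm => not_le.1 (Nat.find_min hex hm), Nat.find_spec hex, ?_⟩
  rcases Nat.eq_zero_or_pos (Nat.find hex) with h | h
  · rw [h]; omega
  · have := Nat.find_min hex (Nat.sub_lt h one_pos)
    obtain ⟨k, hk⟩ := Nat.exists_eq_succ_of_ne_zero h.ne'
    rw [hk] at this ⊢
    rw [Nat.succ_sub_one] at this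
    rw [Nat.succ_mul]; omega

theorem runs_passCmd {s : State} (hs : s.Bdd (wordBound I ε)) (hE : Env I ε s) {w : ℕ}
    (hw : s.var 18 = w) (hwn : w < n) (hw0 : 0 < w) (hS : BlockSorted I.itemLe n w (s.arr 7))
    (hP : ((List.range n).map (s.arr 7)).Perm (List.range n)) :
    Runs (wordBound I ε) passCmd s (700 * n) fun s' => s'.var 18 = 2 * w ∧
      BlockSorted I.itemLe n (2 * w) (s'.arr 7) ∧
      ((List.range n).map (s'.arr 7)).Perm (List.range n) := by
  obtain ⟨N, hN1, hN2, hN3⟩ := exists_block_count (n := n) (w := 2 * w) (by omega)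
  have hNe : bd n w (2 * N) = n := by rw [bd, min_eq_right]; nlinarith
  have hlt : ∀ x < n, s.arr 7 x < n := fun x hx =>
    List.mem_range.1 (hP.subset (List.mem_map.2 ⟨x, List.mem_range.2 hx, rfl⟩))
  have h1 : Runs (wordBound I ε) (19 ≔ lit 0) s 2 fun s' => s'.var 19 = 0 :=
    Runs.assign two_le_wordBound hs (by decide) (lt_wordBound' (Nat.zero_le _)) (by simp)
  refine (h1.seq (b₂ := (N * (3 + 1 + (80 * (2 * w) + 60)) + (3 + 1)) + ((n * (5 + 8) + 6) + 4))
    fun s₁ hB₁ hF₁ e₁ => ?_).mono ?_ fun s' _ _ h => h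
  · have hE₁ := hE.frame hF₁ rfl
    have hA₁ : s₁.arr 7 = s.arr 7 := hF₁.arr 7 rfl
    refine Runs.seq (Q₁ := fun s' => Merged I.itemLe n w N (s.arr 7) (s'.arr 8))
      ((Runs.loop two_le_wordBound (by decide) (fun m s' => s'.var 19 = bd n w (2 * m) ∧
        Merged I.itemLe n w m (s.arr 7) (s'.arr 8)) N _ hB₁ ?_ ?_ ?_).mono le_rfl
        fun s' _ _ h => h.2) fun s₂ hB₂ hF₂ h₂ => ?_
    · exact ⟨by simp [e₁, bd], fun m hm => by omega⟩
    · intro m s' hm hB hF ⟨i1, i2⟩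
      have hE' := hE₁.frame hF rfl
      have hA' : s'.arr 7 = s.arr 7 := (hF.arr 7 rfl).trans hA₁
      have hmn := hN1 m hm
      refine ⟨?_, ?_⟩
      · simp only [eval_lt, eval_var, ite_one_ne_zero, i1, hE'.n, bd]
        refine min_lt_iff.2 (.inl ?_)
        nlinarith
      · refine (runs_blockCmd hB hE' ((hF.var 18 rfl).trans ((hF₁.var 18 rfl).trans hw)) hwn i1 hmn
          (hA' ▸ hlt)).mono le_rfl fun s'' _ _ ⟨j1, j2, j3⟩ => ⟨by rw [j1]; ring_nf, ?_⟩
        intro m' hm'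
        rcases Nat.lt_succ_iff_lt_or_eq.1 hm' with h | rfl
        · rw [← i2 m' h]
          refine slice_congr fun x _ hx => j3 x (hx.trans_le (bd_mono (by omega)))
        · rw [j2, hA']
    · intro s' hB hF ⟨i1, _⟩
      simp only [eval_lt, eval_var, ite_one_eq_zero, i1, (hE₁.frame hF rfl).n, hNe]; omega
    · have hE₂ := hE₁.frame hF₂ rfl
      refine Runs.seq (Q₁ := fun s' => ∀ x < n, s'.arr 7 x = s₂.arr 8 x)
        (Runs.forLt (x := 4) (y := 0) (b := 5) two_le_wordBound (by decide) rfl rfl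
          (fun k s' => ∀ x < k, s'.arr 7 x = s₂.arr 8 x) hE₂.n ?_ hB₂ (by omega) ?_)
        fun s₃ hB₃ hF₃ h₃ => ?_
      · intro i s v h; simpa using h
      · intro k s' hk hB hF hx hI
        have h8 : s'.arr 8 = s₂.arr 8 := hF.arr 8 rfl
        refine Runs.of_wp two_le_wordBound rfl (by decide) hB ?_
        simp only [wp, eval_load, eval_var, hx, h8, setCell_arr, true_and]
        refine ⟨hB₂.2 8 k, fun x hxk => ?_⟩
        split_ifs with h
        · rw [h]
        · exact hI x (by omega)
      · have e18 : s₃.var 18 = w :=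
          (hF₃.var 18 rfl).trans ((hF₂.var 18 rfl).trans ((hF₁.var 18 rfl).trans hw))
        have hb : w + w < wordBound I ε := by
          have h1 := n_le_magnitude I ε
          have h2 := two_le_magnitude I ε
          exact lt_wordBound (k := 2) (by nlinarith) (by omega)
        have hsl : ∀ a b, b ≤ n → slice (s₃.arr 7) a b = slice (s₂.arr 8) a b := fun a b hb =>
          slice_congr fun x _ hx => h₃ x (hx.trans_le hb)
        refine Runs.assign two_le_wordBound hB₃ (by decide) (by simp [e18, hb])
          ⟨by simp [e18]; ring, ?_, ?_⟩
        · intro m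
          rw [setVar_arr, hsl _ (bd n (2 * w) (m + 1)) (min_le_right _ _)]
          exact h₂.blockSorted hNe.ge itemLe_trans itemLe_total hS m
        · rw [setVar_arr, ← slice_zero, hsl _ _ le_rfl]
          have := h₂.perm le_rfl
          rw [hNe, slice_zero n (f := s.arr 7)] at this
          exact this.trans hP
  -- The pairs of blocks cover at most n + 2w ≤ 3n positions.
  · have : N ≤ N * (2 * w) := Nat.le_mul_of_pos_right N (by omega)
    nlinarith

theorem runs_sortCmd {s : State} (hs : s.Bdd (wordBound I ε)) (hE : Env I ε s) (hn : 1 ≤ n) :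
    Runs (wordBound I ε) sortCmd s (800 * (n * (Nat.log 2 n + 2))) fun s' =>
      I.Sorts (s'.arr 7) := by
  have hclog : Nat.clog 2 n ≤ Nat.log 2 n + 1 :=
    Nat.clog_le_of_le_pow (Nat.lt_pow_succ_log_self (by omega) n).le
  have h1 : Runs (wordBound I ε) (forLt 4 0 (write 7 (var 4) (var 4))) s (n * (3 + 8) + 6)
      fun s' => ∀ x < n, s'.arr 7 x = x := by
    refine Runs.forLt (x := 4) (y := 0) (b := 3) two_le_wordBound (by decide) rfl rfl
      (fun k s' => ∀ x < k, s'.arr 7 x = x) hE.n ?_ hs (by omega) ?_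
    · intro i s v h; simpa using h
    · intro k s' hk hB hF hx hI
      refine Runs.of_wp two_le_wordBound rfl (by decide) hB ?_
      simp only [wp, eval_var, hx, setCell_arr, true_and]
      refine ⟨hx ▸ hB.1 4, fun x hxk => ?_⟩
      split_ifs with h
      · exact h.symm
      · exact hI x (by omega)
  refine (h1.seq (b₂ := 2 + (Nat.clog 2 n * (3 + 1 + 700 * n) + (3 + 1)))
    fun s₁ hB₁ hF₁ e₁ => ?_).mono ?_ fun s' _ _ h => h
  · have hE₁ := hE.frame hF₁ rfl
    refine Runs.seq (Q₁ := fun s' => s'.var 18 = 1 ∧ ∀ x < n, s'.arr 7 x = x)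
      (Runs.assign two_le_wordBound hB₁ (by decide) two_le_wordBound ⟨by simp, by simpa using e₁⟩)
      fun s₂ hB₂ hF₂ ⟨e18, e7⟩ => ?_
    have hE₂ := hE₁.frame hF₂ rfl
    refine (Runs.loop two_le_wordBound (by decide) (fun p s' => s'.var 18 = 2 ^ p ∧
      BlockSorted I.itemLe n (2 ^ p) (s'.arr 7) ∧
      ((List.range n).map (s'.arr 7)).Perm (List.range n)) (Nat.clog 2 n) _ hB₂ ?_ ?_ ?_).mono
      le_rfl fun s' _ _ ⟨_, j1, j2⟩ => ⟨j2, ?_⟩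
    · refine ⟨by simpa using e18, fun m => ?_, ?_⟩
      · by_cases hm : m < n
        · rw [pow_zero, show bd n 1 m = m by unfold bd; omega,
            show bd n 1 (m + 1) = m + 1 by unfold bd; omega, slice_cons m.lt_succ_self,
            slice_of_ge le_rfl]
          exact List.pairwise_singleton _ _
        · rw [slice_of_ge (by unfold bd; omega)]; exact List.Pairwise.nil
      · have : (List.range n).map (s₂.arr 7) = (List.range n).map id :=
          List.map_congr_left fun x hx => e7 x (List.mem_range.1 hx)
        rw [this, List.map_id]
    · intro p s' hp hB hF ⟨i1, i2, i3⟩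
      have hE' := hE₂.frame hF rfl
      have hpn : 2 ^ p < n := not_le.1 fun h => by
        have := Nat.clog_le_of_le_pow h; omega
      refine ⟨?_, ?_⟩
      · simp only [eval_lt, eval_var, ite_one_ne_zero, i1, hE'.n]; exact hpn
      · rw [pow_succ']
        exact runs_passCmd hB hE' i1 hpn (by positivity) i2 i3
    · intro s' hB hF ⟨i1, _⟩
      simp only [eval_lt, eval_var, ite_one_eq_zero, i1, (hE₂.frame hF rfl).n]
      exact not_lt.2 (Nat.le_pow_clog (by omega) n)
    -- At the final width block 0 is the whole array.
    · have h0 := j1 0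
      rw [show bd n (2 ^ Nat.clog 2 n) 0 = 0 by simp [bd],
        show bd n (2 ^ Nat.clog 2 n) (0 + 1) = n by
          rw [bd, zero_add, one_mul, min_eq_right (Nat.le_pow_clog (by omega) n)],
        slice_zero, List.pairwise_map, List.pairwise_iff_getElem] at h0
      intro i j hij hj
      have hlt : ∀ x < n, s'.arr 7 x < n := fun x hx =>
        List.mem_range.1 (j2.subset (List.mem_map.2 ⟨x, List.mem_range.2 hx, rfl⟩))
      have := h0 i j (by simp; omega) (by simpa using hj) hij
      rw [List.getElem_range, List.getElem_range] at this
      exact (itemLe_iff_precedes (hlt i (by omega)) (hlt j hj)).1 this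
  · have := Nat.mul_le_mul_right (4 + 700 * n) hclog
    nlinarith

end MPBKPS

namespace WordRAM

theorem setCell_arr_eq (s : State) (a i v b : ℕ) : (s.setCell a i v).arr b =
    if b = a then Function.update (s.arr a) i v else s.arr b := by
  simp only [State.setCell, Function.update_apply]

end WordRAM

namespace MPBKPS

open WordRAM Exp Cmd Sequential

variable {n T : ℕ} {I : MPBKPS n T} {ε : ℚ}

/-! ### Bundling -/

/-- Items are sorted and the penalty rates are known. -/
structure Sorted (I : MPBKPS n T) (s : State) : Prop where
  sorts : I.Sorts (s.arr 7)
  rates : ∀ t < T, s.arr 6 t = I.rate t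

theorem Sorted.frame {s s' : State} (h : Sorted I s) {p : Cmd} (hF : Frame p s s')
    (h6 : p.writes 6 = false) (h7 : p.writes 7 = false) : Sorted I s' :=
  ⟨(hF.arr 7 h7).symm ▸ h.sorts, fun t ht => by rw [hF.arr 6 h6]; exact h.rates t ht⟩

/-- The items in sorted order are bundled. -/
abbrev BundledItems (I : MPBKPS n T) (ord : ℕ → ℕ) (H V k : ℕ) (bid R Q : ℕ → ℕ) : Prop :=
  Bundled (fun k => I.due (ord k)) (fun k => cells I.r (ord k)) (fun k => cells I.q (ord k))
    (fun k => I.rate (I.due (ord k))) H V k bid R Q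

/-- The open bundle of the items in sorted order. -/
abbrev OpenItems (I : MPBKPS n T) (ord : ℕ → ℕ) (H V k : ℕ) (bid : ℕ → ℕ) (τ cur : ℕ) : Prop :=
  OpenBundle (fun k => I.due (ord k)) (fun k => cells I.r (ord k)) (fun k => cells I.q (ord k))
    (fun k => I.rate (I.due (ord k))) H V k bid τ cur

/-- Needed only to see that totals of bundles are words. -/
theorem BundledItems.le_mul {ord bid R Q : ℕ → ℕ} {H V k : ℕ}
    (h : BundledItems I ord H V k bid R Q) {z : ℕ} (hz : z < k) :
    R z ≤ k * I.magnitude ε ∧ Q z ≤ k * I.magnitude ε := by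
  have key : ∀ f : ℕ → ℕ, (∀ j, f j ≤ I.magnitude ε) →
      ∑ j ∈ Finset.range k with bid j = z, f j ≤ k * I.magnitude ε := fun f hf => by
    refine (Finset.sum_le_card_nsmul _ _ _ fun j _ => hf j).trans ?_
    rw [smul_eq_mul]
    exact Nat.mul_le_mul_right _ ((Finset.card_filter_le _ _).trans (Finset.card_range k).le)
  rw [h.sum_r z hz, h.sum_q z hz]
  exact ⟨key _ fun _ => r_le_magnitude I ε _, key _ fun _ => q_le_magnitude I ε _⟩

/-- Reads the next item and closes the open bundle at the end of a period. -/
def readItemCmd : Cmd :=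
  32 ≔ load 7 (var 4) ;;
  26 ≔ load 4 (var 32) ;;
  cond ((var 26).eq (var 7)) skip (6 ≔ lit 0 ;; 7 ≔ var 26)

/-- Assigns the item to a bundle. -/
def placeItemCmd : Cmd :=
  27 ≔ (load 2 (var 32) |>.lt (load 6 (var 26) * load 3 (var 32))).not ;;
  8 ≔ var 4 ;;
  write 9 (var 4) (lit 0) ;;
  write 10 (var 4) (lit 0) ;;
  cond (var 27 + ((var 17).lt (load 2 (var 32) * var 10)).not)
    (cond (var 6 * (var 27 + ((var 17).lt (load 9 (var 6 - lit 1) * var 10)).not))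
      (8 ≔ var 6 - lit 1) (6 ≔ var 4 + lit 1))
    skip ;;
  write 11 (var 4) (var 8) ;;
  write 9 (var 8) (load 9 (var 8) + load 2 (var 32)) ;;
  write 10 (var 8) (load 10 (var 8) + load 3 (var 32))

/-- Bundles all items. -/
def bundleCmd : Cmd :=
  6 ≔ lit 0 ;; 7 ≔ var 1 ;; forLt 4 0 (readItemCmd ;; placeItemCmd)

theorem runs_readItemCmd {s : State} (hs : s.Bdd (wordBound I ε)) (hE : Env I ε s)
    (hO : Sorted I s) {k H V : ℕ} {bid : ℕ → ℕ} (hk : s.var 4 = k) (hkn : k < n)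
    (ho : OpenItems I (s.arr 7) H V k bid (s.var 7) (s.var 6))
    (hp : 0 < k → s.var 7 = I.due (s.arr 7 (k - 1))) :
    Runs (wordBound I ε) readItemCmd s 30 fun s' => s'.var 32 = s.arr 7 k ∧
      s'.var 26 = I.due (s.arr 7 k) ∧ s'.var 7 = I.due (s.arr 7 k) ∧
      OpenItems I (s.arr 7) H V k bid (I.due (s.arr 7 k)) (s'.var 6) := by
  have h7 := hs.2 7 k
  have ht : I.due (s.arr 7 k) < wordBound I ε := lt_wordBound' (due_le_magnitude I ε _)
  refine Runs.of_wp two_le_wordBound rfl (by decide) hs ?_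
  simp only [readItemCmd, wp, eval_load, eval_var, eval_eq, eval_lit, setVar_var, setVar_arr, hk,
    hE.d, Nat.reduceEqDiff, if_false, if_true, ite_one_ne_zero, ite_one_eq_zero, true_and]
  refine ⟨h7, ht, fun h => ⟨h.symm, h ▸ ho⟩, fun h => ⟨two_le_wordBound.trans_lt' (by omega), ht, ?_⟩⟩
  -- The deadline differs from that of the preceding item, so by sortedness no earlier item has it
  -- and no bundle is open.
  refine OpenBundle.new fun j hj e => h ?_
  have hk0 : 0 < k := by omega
  rw [hp hk0] at h ⊢
  have h1 := hO.sorts.due_mono (k - 1) k (by omega) hkn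
  have h2 := hO.sorts.due_mono j (k - 1) (by omega) (by omega)
  omega

theorem runs_placeItemCmd {s : State} (hs : s.Bdd (wordBound I ε)) (hE : Env I ε s)
    (hO : Sorted I s) {k H V : ℕ} (hk : s.var 4 = k) (hkn : k < n)
    (hH : s.var 10 = H) (hV : s.var 17 = V) (hi : s.var 32 = s.arr 7 k)
    (ht : s.var 26 = I.due (s.arr 7 k)) 
    (hB : BundledItems I (s.arr 7) H V k (s.arr 11) (s.arr 9) (s.arr 10))
    (ho : OpenItems I (s.arr 7) H V k (s.arr 11) (I.due (s.arr 7 k)) (s.var 6)) :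
    Runs (wordBound I ε) placeItemCmd s 100 fun s' =>
      BundledItems I (s.arr 7) H V (k + 1) (s'.arr 11) (s'.arr 9) (s'.arr 10) ∧
      OpenItems I (s.arr 7) H V (k + 1) (s'.arr 11) (I.due (s.arr 7 k)) (s'.var 6) := by
  have hr : s.arr 6 (I.due (s.arr 7 k)) = I.rate (I.due (s.arr 7 k)) :=
    hO.rates _ (due_lt (hO.sorts.lt hkn))
  have h1 : 1 < wordBound I ε := two_le_wordBound
  have h0 : 0 < wordBound I ε := by omega
  have bN : ∀ x, x ≤ n → x < wordBound I ε := fun x hx =>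
    lt_wordBound' (hx.trans (n_le_magnitude I ε))
  have hle := fun z (hz : z < k) => BundledItems.le_mul (ε := ε) hB hz
  have hrM := r_le_magnitude I ε (s.arr 7 k)
  have hqM := q_le_magnitude I ε (s.arr 7 k)
  have hsort : ∀ j < k, I.due (s.arr 7 j) = I.due (s.arr 7 k) → _ := fun j hj e =>
    hO.sorts.forced_of_lt (β := I.rate) hj hkn e
  have bS : ∀ x, x ≤ (k + 1) * I.magnitude ε → x < wordBound I ε := fun x hx =>
    lt_wordBound (k := 2) (hx.trans (by
      have := n_le_magnitude I ε
      nlinarith)) (by omega)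
  have h27 : (if (if cells I.r (s.arr 7 k) < I.rate (I.due (s.arr 7 k)) * cells I.q (s.arr 7 k)
      then 1 else 0) = 0 then 1 else 0) < wordBound I ε := by split_ifs <;> assumption
  refine Runs.of_wp two_le_wordBound rfl (by decide) hs ?_
  simp only [placeItemCmd, wp, eval_load, eval_var, eval_lt, eval_lit, eval_not, eval_add, eval_mul,
    eval_sub, setVar_var, setVar_arr, setCell_var, setCell_arr_eq, hk, hH, hV, hi, ht, hE.r, hE.q,
    hr, Nat.reduceEqDiff, if_false, if_true]
  have hgr : ∀ {a b c d : ℕ}, ((if (if a < b then 1 else 0) = 0 then 1 else 0) +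
      (if (if c < d then 1 else 0) = 0 then 1 else 0) : ℕ) ≠ 0 ↔ b ≤ a ∨ d ≤ c := by
    intro a b c d; split_ifs <;> simp_all
  -- Both branches that start a bundle at once: a groupable item refused by the open bundle and an
  -- item that is not groupable. The totals at k were cleared because memory may hold those of an
  -- earlier guess.
  have hstart : ∀ cur, cur = (if Groupable (fun k => cells I.r (s.arr 7 k))
        (fun k => cells I.q (s.arr 7 k)) (fun k => I.rate (I.due (s.arr 7 k))) H V k
        then k + 1 else s.var 6) →
      (Groupable (fun k => cells I.r (s.arr 7 k)) (fun k => cells I.q (s.arr 7 k))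
        (fun k => I.rate (I.due (s.arr 7 k))) H V k → ∀ z, s.var 6 = z + 1 →
        ¬ (I.rate (I.due (s.arr 7 k)) * cells I.q (s.arr 7 k) ≤ cells I.r (s.arr 7 k) ∨
          s.arr 9 z * H ≤ V)) →
      k < wordBound I ε ∧ Function.update (s.arr 9) k 0 k + cells I.r (s.arr 7 k) < wordBound I ε ∧
      Function.update (s.arr 10) k 0 k + cells I.q (s.arr 7 k) < wordBound I ε ∧
      I.BundledItems (s.arr 7) H V (k + 1) (Function.update (s.arr 11) k k)
        (Function.update (Function.update (s.arr 9) k 0) k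
          (Function.update (s.arr 9) k 0 k + cells I.r (s.arr 7 k)))
        (Function.update (Function.update (s.arr 10) k 0) k
          (Function.update (s.arr 10) k 0 k + cells I.q (s.arr 7 k))) ∧
      I.OpenItems (s.arr 7) H V (k + 1) (Function.update (s.arr 11) k k) (I.due (s.arr 7 k))
        cur := by
    rintro cur rfl hj
    refine ⟨bN _ hkn.le, ?_, ?_, Bundled.start hB ho hsort hj (fun j => ?_) fun j => ?_⟩
    · rw [Function.update_self]; exact lt_wordBound' (by omega)
    · rw [Function.update_self]; exact lt_wordBound' (by omega)
    · simp only [Function.update_apply, if_true, zero_add]; split_ifs <;> rfl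
    · simp only [Function.update_apply, if_true, zero_add]; split_ifs <;> rfl
  refine ⟨h27, bN _ hkn.le, h0, h0, fun hg => ⟨fun hj => ?_, fun hj => ?_⟩, fun hg => ?_⟩
  · have hg' := hgr.1 hg
    have h6 : s.var 6 ≠ 0 := left_ne_zero_of_mul hj
    obtain ⟨z, hz⟩ := Nat.exists_eq_succ_of_ne_zero h6
    have hj' := hgr.1 (right_ne_zero_of_mul hj)
    rw [hz, Nat.succ_eq_add_one] at ho hj' ⊢
    have hzk := (ho.succ z rfl).1
    simp only [Nat.add_sub_cancel, Function.update_of_ne hzk.ne] at hj' ⊢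
    have hz' := hle z hzk
    refine ⟨bN _ (by omega), bN _ (by omega), bS _ (by rw [add_mul]; omega),
      bS _ (by rw [add_mul]; omega), Bundled.join hB ho hsort hg' hj' (fun j => ?_) fun j => ?_⟩
    · simp only [Function.update_apply]
    · simp only [Function.update_apply]
  · have hg' := hgr.1 hg
    refine ⟨bN _ (by omega), hstart _ (if_pos hg').symm fun _ z hz h => ?_⟩
    rw [hz] at ho hj
    have hzk := (ho.succ z rfl).1
    simp only [Nat.add_sub_cancel, Function.update_of_ne hzk.ne] at hj
    exact mul_ne_zero (Nat.succ_ne_zero z) (hgr.2 h) hj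
  · have hg' : ¬ Groupable (fun k => cells I.r (s.arr 7 k))
        (fun k => cells I.q (s.arr 7 k)) (fun k => I.rate (I.due (s.arr 7 k))) H V k :=
      fun h => hgr.2 h hg
    exact hstart _ (if_neg hg').symm fun h => absurd h hg'

theorem runs_bundleCmd {s : State} (hs : s.Bdd (wordBound I ε)) (hE : Env I ε s)
    (hO : Sorted I s) {H V : ℕ} (hH : s.var 10 = H) (hV : s.var 17 = V) :
    Runs (wordBound I ε) bundleCmd s (150 * n + 20) fun s' =>
      BundledItems I (s'.arr 7) H V n (s'.arr 11) (s'.arr 9) (s'.arr 10) := by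
  have h1 : Runs (wordBound I ε) (6 ≔ lit 0) s 2 fun s' => s'.var 6 = 0 :=
    Runs.assign two_le_wordBound hs (by decide) (lt_wordBound' (Nat.zero_le _)) (by simp)
  refine (h1.seq fun s₁ hB₁ hF₁ e₁ =>
    (Runs.assign two_le_wordBound hB₁ (e := var 1) (x := 7)
      (Q := fun s' => s'.var 6 = 0) (by decide) (hB₁.1 1) (by simpa using e₁)).seq
    fun s₂ hB₂ hF₂ e₂ =>
    Runs.forLt (x := 4) (y := 0) (b := 130) two_le_wordBound (by decide) rfl rfl
      (fun k s' => BundledItems I (s.arr 7) H V k (s'.arr 11) (s'.arr 9) (s'.arr 10) ∧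
        OpenItems I (s.arr 7) H V k (s'.arr 11) (s'.var 7) (s'.var 6) ∧
        (0 < k → s'.var 7 = I.due (s.arr 7 (k - 1))))
      ((hE.frame hF₁ rfl).frame hF₂ rfl).n ?_ hB₂
      ⟨Bundled.zero, by rw [e₂]; exact OpenBundle.new fun j hj => by omega, by omega⟩
      fun k s' hk hB hF hx hI => ?_).mono ?_ fun s' _ hF h => ?_
  · intro i s v h; simpa using h
  · obtain ⟨hb, ho, hp⟩ := hI
    have hE' := ((hE.frame hF₁ rfl).frame hF₂ rfl).frame hF rfl
    have hO' := ((hO.frame hF₁ rfl rfl).frame hF₂ rfl rfl).frame hF rfl rfl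
    have e7 : s'.arr 7 = s.arr 7 := by rw [hF.arr 7 rfl, hF₂.arr 7 rfl, hF₁.arr 7 rfl]
    have e10 : s'.var 10 = H := by rw [hF.var 10 rfl, hF₂.var 10 rfl, hF₁.var 10 rfl, hH]
    have e17 : s'.var 17 = V := by rw [hF.var 17 rfl, hF₂.var 17 rfl, hF₁.var 17 rfl, hV]
    rw [← e7] at hb ho hp
    refine (runs_readItemCmd hB hE' hO' hx hk ho hp).seq (b₂ := 100) fun s₃ hB₃ hF₃ ⟨i1, i2, i3, i4⟩ => ?_
    have f7 := hF₃.arr 7 rfl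
    have f9 := hF₃.arr 9 rfl
    have f10 := hF₃.arr 10 rfl
    have f11 := hF₃.arr 11 rfl
    rw [← f7] at i1 i2 i3 i4 hb
    rw [← f11] at i4 hb
    rw [← f9, ← f10] at hb
    refine (runs_placeItemCmd hB₃ (hE'.frame hF₃ rfl) (hO'.frame hF₃ rfl rfl)
      ((hF₃.var 4 rfl).trans hx) hk ((hF₃.var 10 rfl).trans e10) ((hF₃.var 17 rfl).trans e17)
      i1 i2 hb i4).mono (b' := 100) (by omega) fun s₄ _ hF₄ ⟨j1, j2⟩ => ?_
    rw [f7, e7] at j1 j2 i3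
    rw [hF₄.var 7 rfl, i3]
    exact ⟨j1, j2, fun _ => by rw [Nat.add_sub_cancel]⟩
  · simp only [cost]; omega
  · rw [hF.arr 7 rfl]; exact h.1

end MPBKPS

/-! ### Cell-by-cell construction of a table row -/

namespace Sequential

variable {b c R Q : ℕ → ℕ} {K V cap k : ℕ}

/-- The new row of the table after the cells before `j` of the old row have been processed. -/
structure RowUpdate (b c R Q : ℕ → ℕ) (K V cap k j : ℕ) (old new choice : ℕ → ℕ) : Prop where
  sound : ∀ s ≤ cap, new s ≠ 0 → (choice s = 0 ∧ new s = old s) ∨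
    ∃ s₀ ≤ cap, choice s = s₀ + 1 ∧ old s₀ ≠ 0 ∧ b k * overflow c Q k (old s₀) ≤ R k ∧
      s = target b c R Q K V cap k s₀ (old s₀) ∧
      new s = old s₀ + Q k - overflow c Q k (old s₀)
  keep : ∀ s ≤ cap, old s ≠ 0 → new s ≠ 0 ∧ new s ≤ old s
  push : ∀ s < j, old s ≠ 0 → b k * overflow c Q k (old s) ≤ R k →
    new (target b c R Q K V cap k s (old s)) ≠ 0 ∧
    new (target b c R Q K V cap k s (old s)) ≤ old s + Q k - overflow c Q k (old s)

theorem target_le {s x : ℕ} : target b c R Q K V cap k s x ≤ cap := min_le_right _ _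

theorem RowUpdate.zero {old new choice : ℕ → ℕ} (h : ∀ s ≤ cap, new s = old s)
    (h' : ∀ s ≤ cap, choice s = 0) : RowUpdate b c R Q K V cap k 0 old new choice :=
  ⟨fun s hs _ => .inl ⟨h' s hs, h s hs⟩, fun s hs h0 => by rw [h s hs]; exact ⟨h0, le_rfl⟩,
    fun s hs => by omega⟩

theorem RowUpdate.skip {j : ℕ} {old new choice : ℕ → ℕ}
    (h : RowUpdate b c R Q K V cap k j old new choice)
    (hj : old j ≠ 0 → b k * overflow c Q k (old j) ≤ R k →
      new (target b c R Q K V cap k j (old j)) ≠ 0 ∧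
      new (target b c R Q K V cap k j (old j)) ≤ old j + Q k - overflow c Q k (old j)) :
    RowUpdate b c R Q K V cap k (j + 1) old new choice := by
  refine ⟨h.sound, h.keep, fun s hs => ?_⟩
  rcases Nat.lt_succ_iff_lt_or_eq.1 hs with hs | rfl
  exacts [h.push s hs, hj]

theorem load_pos {x : ℕ} (hx : x ≠ 0) : x + Q k - overflow c Q k x ≠ 0 := by
  unfold overflow; omega

/-- A cell is overwritten only if it was unreached or gets a smaller load, so the earlier upper
bounds on loads persist. Transitions refer to the old row, which stays fixed. -/
theorem RowUpdate.write {j tg : ℕ} {old new choice new' choice' : ℕ → ℕ}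
    (h : RowUpdate b c R Q K V cap k j old new choice) (hj : j ≤ cap) (h0 : old j ≠ 0)
    (hR : b k * overflow c Q k (old j) ≤ R k) (htg : tg = target b c R Q K V cap k j (old j))
    (hlt : new tg = 0 ∨ old j + Q k - overflow c Q k (old j) < new tg)
    (hn : ∀ s ≤ cap, new' s = if s = tg then old j + Q k - overflow c Q k (old j) else new s)
    (hch : ∀ s ≤ cap, choice' s = if s = tg then j + 1 else choice s) :
    RowUpdate b c R Q K V cap k (j + 1) old new' choice' := by
  have hle : ∀ s ≤ cap, new s ≠ 0 → new' s ≠ 0 ∧ new' s ≤ new s := by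
    intro s hs h1
    rw [hn s hs]
    split_ifs with e
    · subst e; exact ⟨load_pos h0, by omega⟩
    · exact ⟨h1, le_rfl⟩
  refine ⟨fun s hs => ?_, fun s hs h1 => ?_, fun s hs h1 h2 => ?_⟩
  · rw [hn s hs, hch s hs]
    split_ifs with e
    · exact fun _ => .inr ⟨j, hj, rfl, h0, hR, e.trans htg, rfl⟩
    · exact h.sound s hs
  · obtain ⟨a1, a2⟩ := h.keep s hs h1
    obtain ⟨b1, b2⟩ := hle s hs a1
    exact ⟨b1, b2.trans a2⟩
  · rcases Nat.lt_succ_iff_lt_or_eq.1 hs with hs | rfl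
    · obtain ⟨a1, a2⟩ := h.push s hs h1 h2
      obtain ⟨b1, b2⟩ := hle _ target_le a1
      exact ⟨b1, b2.trans a2⟩
    · rw [hn _ target_le, if_pos htg.symm]
      exact ⟨load_pos h0, le_rfl⟩

theorem RowUpdate.congr {j : ℕ} {old old' new choice : ℕ → ℕ}
    (h : RowUpdate b c R Q K V cap k j old new choice) (hj : j ≤ cap + 1)
    (ho : ∀ s ≤ cap, old' s = old s) : RowUpdate b c R Q K V cap k j old' new choice := by
  refine ⟨fun s hs h0 => ?_, fun s hs => ?_, fun s hs => ?_⟩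
  · rw [ho s hs]
    rcases h.sound s hs h0 with h1 | ⟨s₀, h1, h2⟩
    · exact .inl h1
    · exact .inr ⟨s₀, h1, by rwa [ho s₀ h1]⟩
  · rw [ho s hs]; exact h.keep s hs
  · rw [ho s (by omega)]; exact h.push s hs

variable {Ld ch Ld' ch' : ℕ → ℕ → ℕ}

theorem Table.congr (h : Table b c R Q K V cap k Ld ch)
    (hL : ∀ j ≤ k, ∀ s ≤ cap, Ld' j s = Ld j s) (hC : ∀ j ≤ k, ∀ s ≤ cap, ch' j s = ch j s) :
    Table b c R Q K V cap k Ld' ch' := by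
  refine ⟨(hL 0 (Nat.zero_le _) 0 (Nat.zero_le _)).trans h.base, fun s hs h0 => ?_,
    fun j hj s hs => ?_, fun j hj s hs => ?_, fun j hj s hs => ?_⟩
  · rw [hL 0 (Nat.zero_le _) s hs]; exact h.base_zero s hs h0
  · rw [hL _ hj s hs, hC _ hj s hs, hL j hj.le s hs]
    intro h0
    rcases h.sound j hj s hs h0 with h1 | ⟨s₀, h1, h2⟩
    · exact .inl h1
    · exact .inr ⟨s₀, h1, by rwa [hL j hj.le s₀ h1]⟩
  · rw [hL _ hj s hs, hL j hj.le s hs]; exact h.keep j hj s hs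
  · rw [hL j hj.le s hs, hL _ hj _ target_le]; exact h.push j hj s hs

theorem Table.succ (h : Table b c R Q K V cap k Ld ch)
    (hr : RowUpdate b c R Q K V cap k (cap + 1) (Ld k) (Ld (k + 1)) (ch (k + 1))) :
    Table b c R Q K V cap (k + 1) Ld ch := by
  refine ⟨h.base, h.base_zero, fun j hj s hs => ?_, fun j hj s hs => ?_, fun j hj s hs => ?_⟩ <;>
    rcases Nat.lt_succ_iff_lt_or_eq.1 hj with hj | rfl
  exacts [h.sound j hj s hs, hr.sound s hs, h.keep j hj s hs, hr.keep s hs, h.push j hj s hs,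
    hr.push s (by omega)]

/-- Each transition cuts the load to the capacity; the extra 1 is the shift that reserves 0 for
unreached cells. -/
theorem Table.le (h : Table b c R Q K V cap k Ld ch) {M : ℕ} (hM : ∀ j < k, c j ≤ M) :
    ∀ j ≤ k, ∀ s ≤ cap, Ld j s ≤ M + 1 := by
  intro j
  induction j with
  | zero =>
    intro _ s hs
    by_cases h0 : s = 0
    · rw [h0, h.base]; omega
    · rw [h.base_zero s hs h0]; omega
  | succ j ih =>
    intro hj s hs
    by_cases h0 : Ld (j + 1) s = 0
    · omega
    rcases h.sound j hj s hs h0 with ⟨-, h1⟩ | ⟨s₀, h1, -, h2, -, -, h3⟩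
    · rw [h1]; exact ih (by omega) s hs
    · have := hM j hj
      rw [h3]; unfold overflow; omega

end Sequential

namespace MPBKPS

open WordRAM Exp Cmd Sequential

variable {n T : ℕ} {I : MPBKPS n T} {ε : ℚ}

/-- The command does not modify the parameters. -/
def keepsParams (p : Cmd) : Bool :=
  !(p.assigns 10 || p.assigns 12 || p.assigns 13 || p.assigns 14)

theorem Params.frame {s s' : State} (h : Params I ε s) {p : Cmd} (hF : Frame p s s')
    (hp : keepsParams p = true) : Params I ε s' := by
  simp only [keepsParams, Bool.not_eq_true', Bool.or_eq_false_iff] at hp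
  obtain ⟨⟨⟨h0, h1⟩, h2⟩, h3⟩ := hp
  exact ⟨(hF.var 10 h0).trans h.H, (hF.var 12 h1).trans h.K, (hF.var 13 h2).trans h.cap,
    (hF.var 14 h3).trans h.width⟩

/-! ### The dynamic program -/

/-- Initializes the first row of the table. -/
def initTableCmd : Cmd :=
  forLt 5 14 (write 12 (var 5) (lit 0)) ;; write 12 (lit 0) (lit 1)

/-- Prepares the item in variable `4` and the positions of the old and the new row. -/
def rowCmd : Cmd :=
  32 ≔ load 7 (var 4) ;;
  26 ≔ load 4 (var 32) ;;
  33 ≔ var 4 * var 14 ;;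
  34 ≔ var 33 + var 14

/-- Copies one cell of the old row. -/
def copyCmd : Cmd :=
  write 12 (var 34 + var 5) (load 12 (var 33 + var 5)) ;;
  write 13 (var 34 + var 5) (lit 0)

/-- Adds the bundle to the selection in one cell of the old row. -/
def pushCmd : Cmd :=
  27 ≔ load 12 (var 33 + var 5) ;;
  28 ≔ var 27 - lit 1 + load 10 (var 4) - load 0 (var 26) ;;
  cond (var 27 * ((load 9 (var 4)).lt (load 6 (var 26) * var 28)).not)
    (29 ≔ var 5 + (load 9 (var 4) - load 6 (var 26) * var 28) * var 12 / var 17 ;;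
      cond ((var 13).lt (var 29)) (29 ≔ var 13) skip ;;
      28 ≔ var 27 + load 10 (var 4) - var 28 ;;
      29 ≔ var 34 + var 29 ;;
      cond ((load 12 (var 29)).eq (lit 0) + (var 28).lt (load 12 (var 29)))
        (write 12 (var 29) (var 28) ;; write 13 (var 29) (var 5 + lit 1))
        skip)
    skip

/-- Fills the table. -/
def tableCmd : Cmd :=
  initTableCmd ;; forLt 4 0 (rowCmd ;; forLt 5 14 copyCmd ;; forLt 5 14 pushCmd)

/-- The array `A` as a table with rows of length `w`. -/
def rows (w : ℕ) (A : ℕ → ℕ) (k s : ℕ) : ℕ := A (k * w + s)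

/-- The table for the bundles with rewards `R` and sizes `Q` is filled up to row `k`. -/
abbrev TableItems (I : MPBKPS n T) (ord R Q : ℕ → ℕ) (K V k : ℕ) (L C : ℕ → ℕ) : Prop :=
  Table (fun k => I.rate (I.due (ord k))) (fun k => cells I.c (I.due (ord k))) R Q K V (2 * K) k
    (rows (2 * K + 1) L) (rows (2 * K + 1) C)

abbrev RowItems (I : MPBKPS n T) (ord R Q : ℕ → ℕ) (K V k j : ℕ) (old new choice : ℕ → ℕ) : Prop :=
  RowUpdate (fun k => I.rate (I.due (ord k))) (fun k => cells I.c (I.due (ord k))) R Q K V (2 * K) k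
    j old new choice

theorem runs_initTableCmd {s : State} (hs : s.Bdd (wordBound I ε)) (hP : Params I ε s)
    (ord R Q : ℕ → ℕ) (V : ℕ) : Runs (wordBound I ε) initTableCmd s
      ((2 * kParam n T ε + 1) * 13 + 10) fun s' =>
      TableItems I ord R Q (kParam n T ε) V 0 (s'.arr 12) (s'.arr 13) := by
  have h0 : 0 < wordBound I ε := lt_wordBound' (Nat.zero_le _)
  refine ((Runs.forLt (x := 5) (y := 14) (b := 5) two_le_wordBound (by decide) rfl rfl
    (fun i s' => ∀ j < i, s'.arr 12 j = 0) hP.width ?_ hs (by omega)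
    fun i s' hi hB hF hx hI => ?_).seq (b₂ := 4) fun s₁ hB₁ hF₁ h₁ => ?_).mono (by omega)
    fun s' _ _ h => h
  · intro i s v h; simpa using h
  · refine Runs.of_wp two_le_wordBound rfl (by decide) hB ⟨h0, fun j hj => ?_⟩
    rw [setCell_arr]
    split_ifs with h
    · rfl
    · exact hI j (by simp only [eval_var, hx, true_and] at h; omega)
  · refine Runs.of_wp two_le_wordBound rfl (by decide) hB₁ ⟨two_le_wordBound, ?_⟩
    simp only [setCell_arr_eq, eval_lit, if_true]
    refine ⟨by simp [rows], fun s hs h => ?_, fun j hj => by omega, fun j hj => by omega,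
      fun j hj => by omega⟩
    simp only [rows, zero_mul, zero_add]
    rw [Function.update_of_ne h]
    exact h₁ s (by omega)

theorem runs_rowCmd {s : State} (hs : s.Bdd (wordBound I ε)) (hE : Env I ε s) (hP : Params I ε s)
    {k : ℕ} (hk : s.var 4 = k) (hkn : k < n) :
    Runs (wordBound I ε) rowCmd s 30 fun s' => s'.var 26 = I.due (s.arr 7 k) ∧
      s'.var 33 = k * (2 * kParam n T ε + 1) ∧ s'.var 34 = (k + 1) * (2 * kParam n T ε + 1) := by
  have h7 := hs.2 7 k
  have ht : I.due (s.arr 7 k) < wordBound I ε := lt_wordBound' (due_le_magnitude I ε _)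
  have hw : (k + 1) * (2 * kParam n T ε + 1) < wordBound I ε := by
    refine lt_wordBound (k := 8) ?_ (by omega)
    rw [pow_succ']
    exact Nat.mul_le_mul (le_trans (by omega) (n_le_magnitude I ε)) (width_le I ε)
  have e : (k + 1) * (2 * kParam n T ε + 1) = k * (2 * kParam n T ε + 1) +
    (2 * kParam n T ε + 1) := Nat.succ_mul _ _
  refine Runs.of_wp two_le_wordBound rfl (by decide) hs ?_
  simp only [rowCmd, wp, eval_load, eval_var, eval_add, eval_mul, setVar_var, setVar_arr, hk,
    hE.d, hP.width, Nat.reduceEqDiff, if_false, if_true, ← e]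
  exact ⟨h7, ht, by omega, hw, trivial, trivial, trivial⟩

theorem runs_copyCmd {s : State} (hs : s.Bdd (wordBound I ε)) {k j w : ℕ} {L C : ℕ → ℕ}
    (hj : s.var 5 = j) (hjw : j < w) (h33 : s.var 33 = k * w) (h34 : s.var 34 = (k + 1) * w)
    (hL : ∀ i < (k + 1) * w, s.arr 12 i = L i) (hC : ∀ i < (k + 1) * w, s.arr 13 i = C i)
    (hcopy : ∀ i < j, rows w (s.arr 12) (k + 1) i = rows w L k i ∧ rows w (s.arr 13) (k + 1) i = 0) :
    Runs (wordBound I ε) copyCmd s 20 fun s' =>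
      (∀ i < (k + 1) * w, s'.arr 12 i = L i) ∧ (∀ i < (k + 1) * w, s'.arr 13 i = C i) ∧
      ∀ i < j + 1, rows w (s'.arr 12) (k + 1) i = rows w L k i ∧ rows w (s'.arr 13) (k + 1) i = 0 := by
  have h12 := hs.2 12 (k * w + j)
  have h0 : 0 < wordBound I ε := lt_wordBound' (Nat.zero_le _)
  refine Runs.of_wp two_le_wordBound rfl (by decide) hs ?_
  simp only [copyCmd, wp, eval_load, eval_var, eval_add, eval_lit, setCell_var, setCell_arr_eq, hj,
    h33, h34, Nat.reduceEqDiff, if_false, if_true]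
  refine ⟨h12, h0, fun i hi => ?_, fun i hi => ?_, fun i hi => ?_⟩
  · rw [Function.update_of_ne (by omega)]; exact hL i hi
  · rw [Function.update_of_ne (by omega)]; exact hC i hi
  · simp only [rows] at hcopy ⊢
    rcases Nat.lt_succ_iff_lt_or_eq.1 hi with hi | rfl
    · rw [Function.update_of_ne (by omega), Function.update_of_ne (by omega)]; exact hcopy i hi
    · rw [Function.update_self, Function.update_self]
      exact ⟨hL _ (by rw [Nat.succ_mul]; omega), rfl⟩

/-- The old row is read from cells below (k + 1) * w, and writes go to cells from there on. Hence L
and C, the finished part of the tables, are preserved. -/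
theorem runs_pushCmd {s : State} (hs : s.Bdd (wordBound I ε)) (hE : Env I ε s) (hP : Params I ε s)
    {ord L C : ℕ → ℕ} {k j V w : ℕ} (hcap : w = 2 * kParam n T ε + 1) (hr : s.arr 6 (I.due (ord k)) = I.rate (I.due (ord k)))
    (hk : s.var 4 = k) (hkn : k < n) (hV : s.var 17 = V)
    (hj : s.var 5 = j) (hjw : j < w) (ht : s.var 26 = I.due (ord k))
    (h33 : s.var 33 = k * w) (h34 : s.var 34 = (k + 1) * w)
    (hRQ : s.arr 9 k ≤ n * I.magnitude ε ∧ s.arr 10 k ≤ n * I.magnitude ε)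
    (hx : rows w L k j ≤ I.magnitude ε + 1)
    (hL : ∀ i < (k + 1) * w, s.arr 12 i = L i)
    (hC : ∀ i < (k + 1) * w, s.arr 13 i = C i)
    (hrow : RowItems I ord (s.arr 9) (s.arr 10) (kParam n T ε) V k j
      (rows w L k) (rows w (s.arr 12) (k + 1))
      (rows w (s.arr 13) (k + 1))) :
    Runs (wordBound I ε) pushCmd s 120 fun s' =>
      (∀ i < (k + 1) * w, s'.arr 12 i = L i) ∧
      (∀ i < (k + 1) * w, s'.arr 13 i = C i) ∧
      RowItems I ord (s.arr 9) (s.arr 10) (kParam n T ε) V k (j + 1)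
        (rows w L k) (rows w (s'.arr 12) (k + 1))
        (rows w (s'.arr 13) (k + 1)) := by
  have hw : w ≤ _ := hcap ▸ width_le I ε
  have hKM := kParam_le I ε
  have hnM := n_le_magnitude I ε
  have h2 := two_le_magnitude I ε
  have hcM := c_le_magnitude I ε (I.due (ord k))
  have ltW : ∀ {y : ℕ} (k : ℕ), y ≤ I.magnitude ε ^ k → k < 16 → y < wordBound I ε :=
    fun k hy hk => lt_wordBound hy hk
  generalize I.magnitude ε = M at *
  have hnM2 : n * M ≤ M ^ 2 := by rw [pow_two]; exact Nat.mul_le_mul_right _ hnM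
  have hM2 : M * 2 ≤ M ^ 2 := by rw [pow_two]; exact Nat.mul_le_mul_left _ h2
  have hM3 : M ^ 2 * 2 ≤ M ^ 3 := by rw [pow_succ M 2]; exact Nat.mul_le_mul_left _ h2
  have hrows : rows w L k j = s.arr 12 (k * w + j) := by
    rw [hL _ (by rw [Nat.succ_mul]; omega), rows]
  obtain ⟨x, hxdef⟩ : ∃ x, x = rows w L k j := ⟨_, rfl⟩
  rw [← hxdef] at hx hrows
  have b27 : x < wordBound I ε := ltW 2 (by omega) (by omega)
  have b28 : x - 1 + s.arr 10 k - cells I.c (I.due (ord k)) < wordBound I ε :=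
    ltW 3 (by omega) (by omega)
  have bK : 2 * kParam n T ε < wordBound I ε := ltW 7 (by omega) (by omega)
  have b28' : ∀ o, x + s.arr 10 k - o < wordBound I ε := fun o =>
    ltW 3 (by omega) (by omega)
  -- V may be 0; the bound uses only that a quotient does not exceed its dividend.
  have b29 : ∀ p, j + (s.arr 9 k - p) * kParam n T ε / V < wordBound I ε := fun p => by
    refine ltW 8 ?_ (by omega)
    have h1 : (s.arr 9 k - p) * kParam n T ε / V ≤ M ^ 2 * M ^ 5 :=
      (Nat.div_le_self _ _).trans (Nat.mul_le_mul (by omega) hKM)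
    have h3 : M ^ 7 * 2 ≤ M ^ 8 := by rw [pow_succ M 7]; exact Nat.mul_le_mul_left _ h2
    rw [← pow_add, show 2 + 5 = 7 from rfl] at h1
    omega
  have b29' : ∀ tg, tg ≤ 2 * kParam n T ε → (k + 1) * w + tg < wordBound I ε := fun tg htg => by
    refine ltW 9 ?_ (by omega)
    have h1 : (k + 1) * w ≤ M * M ^ 7 := Nat.mul_le_mul (by omega) hw
    have h3 : M ^ 8 * 2 ≤ M ^ 9 := by rw [pow_succ M 8]; exact Nat.mul_le_mul_left _ h2
    have h4 : M ^ 7 ≤ M ^ 8 := Nat.pow_le_pow_right (by omega) (by omega)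
    rw [← pow_succ', show 7 + 1 = 8 from rfl] at h1
    omega
  have bj : j + 1 < wordBound I ε := ltW 7 (by omega) (by omega)
  have hmul : ∀ {u a b : ℕ}, (u * if (if a < b then 1 else 0) = 0 then 1 else 0 : ℕ) ≠ 0 ↔
      u ≠ 0 ∧ b ≤ a := by
    intro u a b; split_ifs <;> simp_all
  have hor : ∀ {a b : ℕ}, ((if a = 0 then 1 else 0) + if b < a then 1 else 0 : ℕ) ≠ 0 ↔
      a = 0 ∨ b < a := by
    intro a b; split_ifs <;> simp_all
  -- The cap is a branch in the program. The code after it is analysed once, for an arbitrary state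
  -- that holds the target tg.
  have hlast : ∀ (σ : State) (tg : ℕ), σ.var 4 = k → σ.var 5 = j → σ.var 27 = x →
      σ.var 28 = x - 1 + s.arr 10 k - cells I.c (I.due (ord k)) → σ.var 29 = tg →
      σ.var 34 = (k + 1) * w → σ.arr = s.arr → x ≠ 0 → I.rate (I.due (ord k)) * (x - 1 + s.arr 10 k -
      cells I.c (I.due (ord k))) ≤ s.arr 9 k →
      tg = target (fun k => I.rate (I.due (ord k))) (fun k => cells I.c (I.due (ord k))) (s.arr 9)
        (s.arr 10) (kParam n T ε) V (2 * kParam n T ε) k j x →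
      wp (wordBound I ε) (28 ≔ var 27 + load 10 (var 4) - var 28 ;;
      29 ≔ var 34 + var 29 ;;
      cond ((load 12 (var 29)).eq (lit 0) + (var 28).lt (load 12 (var 29)))
        (write 12 (var 29) (var 28) ;; write 13 (var 29) (var 5 + lit 1))
        skip) (fun s' => (∀ i < (k + 1) * w, s'.arr 12 i = L i) ∧
      (∀ i < (k + 1) * w, s'.arr 13 i = C i) ∧
      RowItems I ord (s.arr 9) (s.arr 10) (kParam n T ε) V k (j + 1)
        (rows w L k) (rows w (s'.arr 12) (k + 1))
        (rows w (s'.arr 13) (k + 1))) σ := by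
    intro σ tg e4 e5 e27 e28 e29 e34 eA h0 hR htg
    have htgc : tg ≤ 2 * kParam n T ε := htg ▸ target_le
    simp only [wp, eval_load, eval_var, eval_lt, eval_eq, eval_lit, eval_add,
      eval_sub, setVar_var, setVar_arr, setCell_var, setCell_arr_eq, e4, e5, e27, e28, e29,
      e34, eA,
      Nat.reduceEqDiff, if_false, if_true]
    refine ⟨b28' _, b29' _ htgc, fun h => ⟨b28' _, bj, fun i hi => ?_, fun i hi => ?_, ?_⟩,
      fun h => ⟨hL, hC, hrow.skip fun _ _ => ?_⟩⟩
    · rw [Function.update_of_ne (by omega)]; exact hL i hi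
    · rw [Function.update_of_ne (by omega)]; exact hC i hi
    · have h := hor.1 h
      refine hrow.write (tg := tg) (by omega) (by rwa [← hxdef]) (by rwa [← hxdef])
        (by rwa [← hxdef]) (by rw [← hxdef]; exact h) (fun i _ => ?_) fun i _ => ?_
      · simp only [rows, Function.update_apply, Nat.add_left_cancel_iff]
        rw [hxdef]; rfl
      · simp only [rows, Function.update_apply, Nat.add_left_cancel_iff]
    · have h := mt hor.2 (not_not.2 h)
      rw [not_or, not_lt] at h
      rw [← hxdef, ← htg]
      exact h
  refine Runs.of_wp two_le_wordBound rfl (by decide) hs ?_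
  rw [pushCmd, wp, wp, wp, wp, wp]
  simp only [eval_load, eval_var, eval_lt, eval_lit, eval_not, eval_add, eval_mul,
    eval_sub, setVar_var, setVar_arr, hk, hj, ht, h33, ← hrows, hE.c,
    hr, Nat.reduceEqDiff, if_false, if_true]
  refine ⟨b27, b28, fun h => ?_, fun h => ?_⟩
  · obtain ⟨h0, hR⟩ := hmul.1 h
    rw [wp.eq_4, wp.eq_2, wp.eq_4, wp.eq_5]
    simp only [wp.eq_1, wp.eq_2, eval_load, eval_var, eval_lt, eval_add, eval_mul, eval_div,
      eval_sub, setVar_var, setVar_arr, hk, hj, ht, hV, hP.K, hP.cap, hr, Nat.reduceEqDiff,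
      if_false, if_true, ite_one_ne_zero, ite_one_eq_zero]
    refine ⟨b29 _, ?_⟩
    refine ⟨fun h1 => ⟨bK, hlast _ (2 * kParam n T ε) ?_ ?_ ?_ ?_ ?_ ?_ rfl h0 hR
      (min_eq_right h1.le).symm⟩,
      fun h1 => hlast _ _ ?_ ?_ ?_ ?_ rfl ?_ rfl h0 hR (min_eq_left (not_lt.1 h1)).symm⟩ <;>
    simp [hk, hj, h34]
  · have h := mt hmul.2 (not_not.2 h)
    exact ⟨hL, hC, hrow.skip fun h0 h1 => absurd ⟨hxdef ▸ h0, hxdef ▸ h1⟩ h⟩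

theorem runs_tableRow {s : State} (hs : s.Bdd (wordBound I ε)) (hE : Env I ε s)
    (hP : Params I ε s) (hO : Sorted I s) {k V : ℕ} (hk : s.var 4 = k) (hkn : k < n)
    (hV : s.var 17 = V)
    (hRQ : s.arr 9 k ≤ n * I.magnitude ε ∧ s.arr 10 k ≤ n * I.magnitude ε)
    (hT : TableItems I (s.arr 7) (s.arr 9) (s.arr 10) (kParam n T ε) V k (s.arr 12) (s.arr 13)) :
    Runs (wordBound I ε) (rowCmd ;; forLt 5 14 copyCmd ;; forLt 5 14 pushCmd) s
      (200 * (2 * kParam n T ε + 1)) fun s' =>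
      TableItems I (s.arr 7) (s.arr 9) (s.arr 10) (kParam n T ε) V (k + 1) (s'.arr 12) (s'.arr 13) := by
  obtain ⟨w, hw⟩ : ∃ w, w = 2 * kParam n T ε + 1 := ⟨_, rfl⟩
  have hr := hO.rates (I.due (s.arr 7 k)) (due_lt (hO.sorts.lt hkn))
  have hM := fun s hs => hT.le (M := I.magnitude ε) (fun j _ => c_le_magnitude I ε _) k le_rfl s hs
  unfold TableItems at hT hM ⊢
  simp only [← hw] at hT hM ⊢
  refine ((runs_rowCmd hs hE hP hk hkn).seq fun s₁ hB₁ hF₁ ⟨e26, e33, e34⟩ =>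
    (Runs.forLt (x := 5) (y := 14) (b := 20) two_le_wordBound (by decide) rfl rfl
    (fun j s' => (∀ i < (k + 1) * w, s'.arr 12 i = s.arr 12 i) ∧
      (∀ i < (k + 1) * w, s'.arr 13 i = s.arr 13 i) ∧
      ∀ i < j, rows w (s'.arr 12) (k + 1) i = rows w (s.arr 12) k i ∧
        rows w (s'.arr 13) (k + 1) i = 0) ((hF₁.var 14 rfl).trans (hP.width.trans hw.symm))
    (by intro i s v h; simpa using h) hB₁
    ⟨fun i _ => by rw [hF₁.arr 12 rfl], fun i _ => by rw [hF₁.arr 13 rfl], by omega⟩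
    fun j s₂ hj hB₂ hF₂ hx ⟨i1, i2, i3⟩ => ?_).seq fun s₂ hB₂ hF₂ ⟨i1, i2, i3⟩ =>
    Runs.forLt (x := 5) (y := 14) (b := 120) two_le_wordBound (by decide) rfl rfl
    (fun j s' => (∀ i < (k + 1) * w, s'.arr 12 i = s.arr 12 i) ∧
      (∀ i < (k + 1) * w, s'.arr 13 i = s.arr 13 i) ∧
      RowItems I (s.arr 7) (s.arr 9) (s.arr 10) (kParam n T ε) V k j (rows w (s.arr 12) k)
        (rows w (s'.arr 12) (k + 1)) (rows w (s'.arr 13) (k + 1)))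
    ((hF₂.var 14 rfl).trans ((hF₁.var 14 rfl).trans (hP.width.trans hw.symm)))
    (by intro i s v h; simpa using h) hB₂
    ⟨i1, i2, RowUpdate.zero (fun i hi => (i3 i (by omega)).1) fun i hi => (i3 i (by omega)).2⟩
    fun j s₃ hj hB₃ hF₃ hx ⟨j1, j2, j3⟩ => ?_).mono ?_ fun s' _ hF ⟨j1, j2, j3⟩ => ?_
  · rw [← hw] at e33 e34
    exact runs_copyCmd hB₂ hx hj ((hF₂.var 33 rfl).trans e33) ((hF₂.var 34 rfl).trans e34) i1 i2 i3
  · rw [← hw] at e33 e34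
    have v : ∀ x, pushCmd.assigns x = false → (x == 5) = false → copyCmd.assigns x = false →
      s₃.var x = s₁.var x := fun x h1 h2 h3 => by
        rw [hF₃.var x (by simp only [forLt, assigns, h1, h2, Bool.or_false]),
          hF₂.var x (by simp only [forLt, assigns, h3, h2, Bool.or_false])]
    have a : ∀ x, rowCmd.writes x = false → copyCmd.writes x = false → pushCmd.writes x = false →
      s₃.arr x = s.arr x := fun x h1 h2 h3 => by
        rw [hF₃.arr x (by simp only [forLt, writes, h3, Bool.or_false]),
          hF₂.arr x (by simp only [forLt, writes, h2, Bool.or_false]),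
          hF₁.arr x h1]
    have v' : ∀ x, rowCmd.assigns x = false → pushCmd.assigns x = false → (x == 5) = false →
      copyCmd.assigns x = false → s₃.var x = s.var x := fun x h0 h1 h2 h3 => by
        rw [v x h1 h2 h3, hF₁.var x h0]
    have hE' := ((hE.frame hF₁ rfl).frame hF₂ rfl).frame hF₃ rfl
    have hP' : Params I ε s₃ := ⟨(v' 10 rfl rfl rfl rfl).trans hP.H,
      (v' 12 rfl rfl rfl rfl).trans hP.K, (v' 13 rfl rfl rfl rfl).trans hP.cap,
      (v' 14 rfl rfl rfl rfl).trans hP.width⟩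
    have e9 := a 9 rfl rfl rfl
    have e10 := a 10 rfl rfl rfl
    have key := runs_pushCmd (ord := s.arr 7) (L := s.arr 12) (C := s.arr 13) hB₃ hE' hP' hw
      (by rw [a 6 rfl rfl rfl, hr]) ((v' 4 rfl rfl rfl rfl).trans hk) hkn
      ((v' 17 rfl rfl rfl rfl).trans hV) hx hj (V := V)
      (by rw [v 26 rfl rfl rfl]; exact e26) ((v 33 rfl rfl rfl).trans e33)
      ((v 34 rfl rfl rfl).trans e34) (by rw [e9, e10]; exact hRQ) (hM j (by omega)) j1 j2
      (by rw [e9, e10]; exact j3)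
    rw [e9, e10] at key
    exact key
  · omega
  · refine (hT.congr (fun i hi t ht => j1 _ ?_) fun i hi t ht => j2 _ ?_).succ ?_
    · have := Nat.mul_le_mul_right w hi
      rw [Nat.succ_mul]; omega
    · have := Nat.mul_le_mul_right w hi
      rw [Nat.succ_mul]; omega
    · rw [show 2 * kParam n T ε + 1 = w from hw.symm]
      refine j3.congr hw.le fun i hi => j1 _ ?_
      rw [Nat.succ_mul]; omega

theorem runs_tableCmd {s : State} (hs : s.Bdd (wordBound I ε)) (hE : Env I ε s)
    (hP : Params I ε s) (hO : Sorted I s) {H V : ℕ} (hV : s.var 17 = V) {bid : ℕ → ℕ}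
    (hb : BundledItems I (s.arr 7) H V n bid (s.arr 9) (s.arr 10)) :
    Runs (wordBound I ε) tableCmd s ((n + 1) * (210 * (2 * kParam n T ε + 1))) fun s' =>
      TableItems I (s'.arr 7) (s'.arr 9) (s'.arr 10) (kParam n T ε) V n (s'.arr 12) (s'.arr 13) := by
  refine ((runs_initTableCmd hs hP (s.arr 7) (s.arr 9) (s.arr 10) V).seq fun s₁ hB₁ hF₁ h₁ =>
    Runs.forLt (x := 4) (y := 0) (b := 200 * (2 * kParam n T ε + 1)) two_le_wordBound (by decide)
    rfl rfl (fun k s' => TableItems I (s.arr 7) (s.arr 9) (s.arr 10) (kParam n T ε) V k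
      (s'.arr 12) (s'.arr 13)) (hE.frame hF₁ rfl).n (by intro i s v h; simpa using h) hB₁ h₁
    fun k s₂ hk hB₂ hF₂ hx hI => ?_).mono ?_ fun s' _ hF h => ?_
  · have e7 : s₂.arr 7 = s.arr 7 := by rw [hF₂.arr 7 rfl, hF₁.arr 7 rfl]
    have e9 : s₂.arr 9 = s.arr 9 := by rw [hF₂.arr 9 rfl, hF₁.arr 9 rfl]
    have e10 : s₂.arr 10 = s.arr 10 := by rw [hF₂.arr 10 rfl, hF₁.arr 10 rfl]
    have e17 : s₂.var 17 = s.var 17 := by rw [hF₂.var 17 rfl, hF₁.var 17 rfl]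
    rw [← e7, ← e9, ← e10] at hI ⊢
    refine runs_tableRow hB₂ ((hE.frame hF₁ rfl).frame hF₂ rfl) ?_
      ((hO.frame hF₁ rfl rfl).frame hF₂ rfl rfl) hx hk (e17.trans hV) ?_ hI
    · exact (hP.frame hF₁ rfl).frame hF₂ rfl
    · rw [e9, e10]; exact hb.le_mul hk
  · rw [Nat.succ_mul n (210 * _)]
    have := Nat.mul_le_mul_left n (show 200 * (2 * kParam n T ε + 1) + 8 ≤
      210 * (2 * kParam n T ε + 1) by omega)
    omega
  · rw [hF.arr 7 rfl, hF.arr 9 rfl, hF.arr 10 rfl]; exact h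

end MPBKPS

namespace MPBKPS

open WordRAM Exp Cmd Sequential

variable {n T : ℕ} {I : MPBKPS n T} {ε : ℚ}

/-! ### Reading off a solution -/

/-- Finds the largest scaled profit in the last row. -/
def scanCmd : Cmd :=
  33 ≔ var 0 * var 14 ;;
  30 ≔ lit 0 ;;
  forLt 5 14 (cond (load 12 (var 33 + var 5)) (30 ≔ var 5) skip)

/-- Follows the choices backwards. -/
def backtrackCmd : Cmd :=
  forLt 4 0
    (31 ≔ var 0 - var 4 ;;
      27 ≔ load 13 (var 31 * var 14 + var 30) ;;
      write 14 (var 31 - lit 1) (var 27) ;;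
      cond (var 27) (30 ≔ var 27 - lit 1) skip)

/-- Writes the items of the selected bundles to the output array. -/
def outputCmd : Cmd :=
  forLt 4 0 (write 5 (load 7 (var 4)) (load 14 (load 11 (var 4))))

/-- Replaces the recorded solution if the new one is better. -/
def recordCmd : Cmd :=
  cond ((var 16).lt (var 30 * var 17)) (16 ≔ var 30 * var 17 ;; backtrackCmd ;; outputCmd) skip

/-- The scaled profit after the last `i` bundles are removed. -/
def backtrace (ch : ℕ → ℕ → ℕ) (n m : ℕ) : ℕ → ℕ
  | 0 => m
  | i + 1 => if ch (n - i) (backtrace ch n m i) = 0 then backtrace ch n m i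
      else ch (n - i) (backtrace ch n m i) - 1

theorem backtrace_sub (ch : ℕ → ℕ → ℕ) {n m k : ℕ} (hk : k < n) : backtrace ch n m (n - k) =
    if ch (k + 1) (backtrace ch n m (n - (k + 1))) = 0 then backtrace ch n m (n - (k + 1))
    else ch (k + 1) (backtrace ch n m (n - (k + 1))) - 1 := by
  obtain ⟨i, hi⟩ : ∃ i, n - k = i + 1 := ⟨n - k - 1, by omega⟩
  rw [hi, backtrace, show n - i = k + 1 by omega, show n - (k + 1) = i by omega]

theorem has_output {s : State} {i : ℕ} (hi : i < n) : Has (output n s) i ↔ s.arr 5 i ≠ 0 := by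
  simp [Has, output, hi]

theorem runs_scanCmd {s : State} (hs : s.Bdd (wordBound I ε)) (hE : Env I ε s)
    (hP : Params I ε s) {ord R Q : ℕ → ℕ} {V : ℕ}
    (hT : TableItems I ord R Q (kParam n T ε) V n (s.arr 12) (s.arr 13)) :
    Runs (wordBound I ε) scanCmd s (20 * (2 * kParam n T ε + 1) + 20) fun s' =>
      s'.var 30 ≤ 2 * kParam n T ε ∧
      rows (2 * kParam n T ε + 1) (s'.arr 12) n (s'.var 30) ≠ 0 ∧
      ∀ i ≤ 2 * kParam n T ε, rows (2 * kParam n T ε + 1) (s'.arr 12) n i ≠ 0 → i ≤ s'.var 30 := by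
  have h0 : 0 < wordBound I ε := lt_wordBound' (Nat.zero_le _)
  have hb : n * (2 * kParam n T ε + 1) < wordBound I ε := by
    refine lt_wordBound (k := 8) ?_ (by omega)
    rw [pow_succ']
    exact Nat.mul_le_mul (n_le_magnitude I ε) (width_le I ε)
  have h1 : Runs (wordBound I ε) (33 ≔ var 0 * var 14) s 4 fun s' =>
      s'.var 33 = n * (2 * kParam n T ε + 1) :=
    Runs.assign two_le_wordBound hs (by decide) (by simpa [hE.n, hP.width] using hb)
      (by simp [hE.n, hP.width])
  refine (h1.seq fun s₁ hB₁ hF₁ e₁ => (Runs.assign two_le_wordBound hB₁ (x := 30) (e := lit 0)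
    (Q := fun s' => s'.var 30 = 0) (by decide) h0 (by simp)).seq fun s₂ hB₂ hF₂ e₂ =>
    Runs.forLt (x := 5) (y := 14) (b := 10) two_le_wordBound (by decide) rfl rfl
      (fun j s' => s'.var 30 ≤ 2 * kParam n T ε ∧
      rows (2 * kParam n T ε + 1) (s.arr 12) n (s'.var 30) ≠ 0 ∧
      ∀ i < j, rows (2 * kParam n T ε + 1) (s.arr 12) n i ≠ 0 → i ≤ s'.var 30)
      ((hF₂.var 14 rfl).trans ((hF₁.var 14 rfl).trans hP.width)) (by intro i s v h; simpa using h)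
      -- Scaled profit 0 is always reached, by selecting nothing, so the scan may start there.
      hB₂ ⟨by omega, by rw [e₂]; exact hT.zero_ne le_rfl, by omega⟩
      fun j s₃ hj hB₃ hF₃ hx ⟨j1, j2, j3⟩ => ?_).mono ?_ fun s' _ hF ⟨j1, j2, j3⟩ => ?_
  · have e33 : s₃.var 33 = n * (2 * kParam n T ε + 1) := by
      rw [hF₃.var 33 rfl, hF₂.var 33 rfl, e₁]
    have e12 : s₃.arr 12 = s.arr 12 := by rw [hF₃.arr 12 rfl, hF₂.arr 12 rfl, hF₁.arr 12 rfl]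
    have hjb := hB₃.1 5
    rw [hx] at hjb
    refine Runs.of_wp two_le_wordBound rfl (by decide) hB₃ ?_
    simp only [wp, eval_load, eval_var, eval_add, setVar_var, hx, e33, e12, if_true]
    refine ⟨fun h => ⟨hjb, by omega, h, fun i hi _ => by omega⟩, fun h => ⟨j1, j2, fun i hi h' => ?_⟩⟩
    rcases Nat.lt_succ_iff_lt_or_eq.1 hi with hi | rfl
    exacts [j3 i hi h', absurd h h']
  · simp only [cost]; omega
  · rw [hF.arr 12 rfl]
    exact ⟨j1, j2, fun i hi => j3 i (by omega)⟩

theorem runs_backtrackCmd {s : State} (hs : s.Bdd (wordBound I ε)) (hE : Env I ε s)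
    (hP : Params I ε s) :
    Runs (wordBound I ε) backtrackCmd s (50 * n + 10) fun s' => ∀ k < n, s'.arr 14 k =
      rows (2 * kParam n T ε + 1) (s.arr 13) (k + 1)
        (backtrace (rows (2 * kParam n T ε + 1) (s.arr 13)) n (s.var 30) (n - (k + 1))) := by
  refine (Runs.forLt (x := 4) (y := 0) (b := 40) two_le_wordBound (by decide) rfl rfl
    (fun i s' => s'.var 30 = backtrace (rows (2 * kParam n T ε + 1) (s.arr 13)) n (s.var 30) i ∧
      ∀ k < n, n - i ≤ k → s'.arr 14 k = rows (2 * kParam n T ε + 1) (s.arr 13) (k + 1)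
        (backtrace (rows (2 * kParam n T ε + 1) (s.arr 13)) n (s.var 30) (n - (k + 1))))
    hE.n (by intro i s v h; simpa using h) hs ⟨rfl, by omega⟩
    fun i s' hi hB hF hx ⟨i1, i2⟩ => ?_).mono (by omega) fun s' _ _ h k hk => h.2 k hk (by omega)
  have h13 := hB.2 13 ((n - i) * (2 * kParam n T ε + 1) + s'.var 30)
  have hE' := hE.frame hF rfl
  have hP' := hP.frame hF rfl
  have hni : n - i < wordBound I ε := lt_wordBound' ((Nat.sub_le _ _).trans (n_le_magnitude I ε))
  refine Runs.of_wp two_le_wordBound rfl (by decide) hB ?_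
  simp only [wp, eval_load, eval_var, eval_add, eval_sub, eval_mul, eval_lit, setVar_var,
    setVar_arr, setCell_var, setCell_arr_eq, hx, hE'.n, hP'.width, Nat.reduceEqDiff, if_false,
    if_true]
  rw [hF.arr 13 rfl, i1] at h13 ⊢
  change rows _ (s.arr 13) (n - i) _ < _ at h13
  change _ ∧ rows _ (s.arr 13) (n - i) _ < _ ∧ rows _ (s.arr 13) (n - i) _ < _ ∧
    (rows _ (s.arr 13) (n - i) _ ≠ 0 → rows _ (s.arr 13) (n - i) _ - 1 < _ ∧
      rows _ (s.arr 13) (n - i) _ - 1 = _ ∧ _) ∧ (rows _ (s.arr 13) (n - i) _ = 0 → _ ∧ _)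
  have hcell : ∀ k < n, n - (i + 1) ≤ k → Function.update (s'.arr 14) (n - i - 1)
      (rows (2 * kParam n T ε + 1) (s.arr 13) (n - i)
        (backtrace (rows (2 * kParam n T ε + 1) (s.arr 13)) n (s.var 30) i)) k =
      rows (2 * kParam n T ε + 1) (s.arr 13) (k + 1)
        (backtrace (rows (2 * kParam n T ε + 1) (s.arr 13)) n (s.var 30) (n - (k + 1))) := by
    intro k hk hik
    rw [Function.update_apply]
    split_ifs with h
    · rw [show n - i = k + 1 by omega, show n - (k + 1) = i by omega]
    · exact i2 k hk (by omega)
  refine ⟨hni, h13, h13, fun h => ⟨by omega, ?_, hcell⟩, fun h => ⟨?_, hcell⟩⟩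
  · rw [backtrace, if_neg h]
  · rw [backtrace, if_pos h]

theorem runs_outputCmd {s : State} (hs : s.Bdd (wordBound I ε)) (hE : Env I ε s)
    (hO : Sorted I s) :
    Runs (wordBound I ε) outputCmd s (20 * n + 10) fun s' =>
      ∀ k < n, s'.arr 5 (s.arr 7 k) = s.arr 14 (s.arr 11 k) := by
  refine (Runs.forLt (x := 4) (y := 0) (b := 10) two_le_wordBound (by decide) rfl rfl
    (fun i s' => ∀ k < i, s'.arr 5 (s.arr 7 k) = s.arr 14 (s.arr 11 k))
    hE.n (by intro i s v h; simpa using h) hs (by omega)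
    fun i s' hi hB hF hx hI => ?_).mono (by omega) fun s' _ _ h => h
  have h14 := hB.2 14 (s'.arr 11 i)
  refine Runs.of_wp two_le_wordBound rfl (by decide) hB ?_
  simp only [wp, eval_load, eval_var, setCell_arr_eq, hx, if_true]
  rw [hF.arr 14 rfl, hF.arr 11 rfl] at h14
  rw [hF.arr 7 rfl, hF.arr 11 rfl, hF.arr 14 rfl]
  refine ⟨h14, fun k hk => ?_⟩
  rw [Function.update_apply]
  split_ifs with h
  -- The order is injective, so a later write never hits the cell of an earlier position.
  · rw [hO.sorts.inj (by omega) hi h]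
  · refine hI k ?_
    have : k ≠ i := fun e => h (by rw [e])
    omega

/-- The number s * V bounds K times the profit from below, and K is the same for all guesses. So
these numbers are comparable, and the recorded one certifies the recorded set. -/
theorem runs_recordCmd {s : State} (hs : s.Bdd (wordBound I ε)) (hE : Env I ε s)
    (hP : Params I ε s) (hO : Sorted I s) {H V : ℕ} (hV : s.var 17 = V)
    (hVM : V ≤ I.magnitude ε ^ 2)
    (hb : BundledItems I (s.arr 7) H V n (s.arr 11) (s.arr 9) (s.arr 10))
    (hT : TableItems I (s.arr 7) (s.arr 9) (s.arr 10) (kParam n T ε) V n (s.arr 12) (s.arr 13))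
    (hm : s.var 30 ≤ 2 * kParam n T ε)
    (hm0 : rows (2 * kParam n T ε + 1) (s.arr 12) n (s.var 30) ≠ 0)
    (hbest : (s.var 16 : ℤ) ≤ I.val (output n s) * kParam n T ε) :
    Runs (wordBound I ε) recordCmd s (70 * n + 50) fun s' =>
      (s'.var 16 : ℤ) ≤ I.val (output n s') * kParam n T ε ∧ s.var 16 ≤ s'.var 16 ∧
      s.var 30 * V ≤ s'.var 16 := by
  have hmV : s.var 30 * V < wordBound I ε := by
    refine lt_wordBound (k := 9) ?_ (by omega)
    have := Nat.mul_le_mul (show s.var 30 ≤ I.magnitude ε ^ 7 from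
      le_trans (by omega) (width_le I ε)) hVM
    rwa [← pow_add] at this
  refine (Runs.cond two_le_wordBound hs (b := 70 * n + 30) (by decide) (fun h => ?_)
    fun h => ?_).mono ?_ fun _ _ _ h => h
  · simp only [eval_lt, eval_mul, eval_var, hV, ite_one_ne_zero] at h
    refine ((Runs.assign two_le_wordBound hs (x := 16) (e := var 30 * var 17)
      (Q := fun s' => s'.var 16 = s.var 30 * V) (by decide) (by simpa [hV] using hmV)
      (by simp [hV])).seq fun s₁ hB₁ hF₁ e₁ =>
      (runs_backtrackCmd hB₁ (hE.frame hF₁ rfl) (hP.frame hF₁ rfl)).seq fun s₂ hB₂ hF₂ h₂ =>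
      (runs_outputCmd hB₂ ((hE.frame hF₁ rfl).frame hF₂ rfl)
        ((hO.frame hF₁ rfl rfl).frame hF₂ rfl rfl)).mono le_rfl
        fun s₃ _ hF₃ h₃ => ?_).mono ?_ fun _ _ _ h => h
    · have e16 : s₃.var 16 = s.var 30 * V := by rw [hF₃.var 16 rfl, hF₂.var 16 rfl, e₁]
      rw [hF₁.arr 13 rfl, hF₁.var 30 rfl] at h₂
      rw [hF₂.arr 7 rfl, hF₂.arr 11 rfl, hF₁.arr 7 rfl, hF₁.arr 11 rfl] at h₃
      rw [e16]
      refine ⟨?_, h.le, le_rfl⟩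
      have := hO.sorts.sound hb hT
        (bt := fun k => backtrace (rows (2 * kParam n T ε + 1) (s.arr 13)) n (s.var 30) (n - k))
        (by simpa [backtrace] using hm0) (by simpa [backtrace] using hm)
        (fun k hk => backtrace_sub _ hk) (S := output n s₃) fun k hk => by
          rw [has_output (hO.sorts.lt hk), h₃ k hk, h₂ _ ((hb.le k hk).trans_lt hk)]
      simpa [backtrace] using this
    · simp only [cost]; omega
  · simp only [eval_lt, eval_mul, eval_var, hV, ite_one_eq_zero] at h
    exact ⟨s, 1, .skip s, by omega, hs, hbest, le_rfl, by omega⟩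
  · simp only [cost, Exp.lt]; change 3 + 1 + 1 + 1 + _ ≤ _; omega

end MPBKPS

namespace MPBKPS

open WordRAM Exp Cmd Sequential

variable {n T : ℕ} {I : MPBKPS n T} {ε : ℚ}

/-! ### The approximation scheme -/

/-- Solves the problem for one guess of the optimal value. -/
def roundCmd : Cmd :=
  17 ≔ var 9 * var 15 ;; bundleCmd ;; tableCmd ;; scanCmd ;; recordCmd ;; 15 ≔ var 15 + var 15

/-- Doubles the guess until it exceeds the trivial upper bound. -/
def searchCmd : Cmd := loop ((var 0).lt (var 15)).not roundCmd

/-- The approximation scheme. -/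
def schemeCmd : Cmd := ratesCmd ;; sortCmd ;; singleCmd ;; paramCmd ;; searchCmd

/-- The state after `j` rounds. -/
structure Searched (I : MPBKPS n T) (ε : ℚ) (j : ℕ) (s : State) : Prop where
  guess : s.var 15 = 2 ^ j
  sound : (s.var 16 : ℤ) ≤ I.val (output n s) * kParam n T ε
  covered : ∀ i < j, I.Covered (hParam T ε) (kParam n T ε) (s.var 9 * 2 ^ i) (s.var 16)

/-- The program need not know which guess is right: the certificate holds for every guess, and
`Covered` carries the assumption on V as a premise. -/
theorem runs_roundCmd {s : State} (hs : s.Bdd (wordBound I ε)) (hE : Env I ε s)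
    (hP : Params I ε s) (hO : Sorted I s) (h9 : I.BestSingle (s.var 9)) {j : ℕ} (hj : 2 ^ j ≤ n)
    (h : Searched I ε j s) :
    Runs (wordBound I ε) roundCmd s (800 * (n * (2 * kParam n T ε + 1))) (Searched I ε (j + 1)) := by
  have hn : 1 ≤ n := Nat.one_le_two_pow.trans hj
  have hV : s.var 9 * 2 ^ j ≤ I.magnitude ε ^ 2 := by
    rw [pow_two]; exact Nat.mul_le_mul h9.le_magnitude (hj.trans (n_le_magnitude I ε))
  have hg : 2 ^ j + 2 ^ j < wordBound I ε := by
    refine lt_wordBound (k := 2) ?_ (by omega)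
    have h1 := hj.trans (n_le_magnitude I ε)
    have h2 := two_le_magnitude I ε
    nlinarith
  obtain ⟨V, eV⟩ : ∃ V, V = s.var 9 * 2 ^ j := ⟨_, rfl⟩
  refine Runs.mono (b := 4 + ((150 * n + 20) + ((n + 1) * (210 * (2 * kParam n T ε + 1)) +
    ((20 * (2 * kParam n T ε + 1) + 20) + ((70 * n + 50) + 4))))) ?_ ?_ fun _ _ _ h => h
  · refine Runs.seq (Runs.assign two_le_wordBound hs (x := 17) (e := var 9 * var 15)
      (Q := fun s' => s'.var 17 = V) (by decide)
      (by simpa [h.guess] using lt_wordBound hV (by omega)) (by simp [h.guess, eV]))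
      fun s₁ hB₁ hF₁ e₁ => ?_
    have hE₁ := hE.frame hF₁ rfl
    have hP₁ := hP.frame hF₁ rfl
    have hO₁ := hO.frame hF₁ rfl rfl
    refine (runs_bundleCmd hB₁ hE₁ hO₁ hP₁.H e₁).seq fun s₂ hB₂ hF₂ h₂ => ?_
    have hE₂ := hE₁.frame hF₂ rfl
    have hP₂ := hP₁.frame hF₂ rfl
    have hO₂ := hO₁.frame hF₂ rfl rfl
    refine (runs_tableCmd hB₂ hE₂ hP₂ hO₂ ((hF₂.var 17 rfl).trans e₁) h₂).seq
      fun s₃ hB₃ hF₃ h₃ => ?_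
    have hE₃ := hE₂.frame hF₃ rfl
    have hP₃ := hP₂.frame hF₃ rfl
    have hO₃ := hO₂.frame hF₃ rfl rfl
    rw [← hF₃.arr 7 rfl, ← hF₃.arr 9 rfl, ← hF₃.arr 10 rfl, ← hF₃.arr 11 rfl] at h₂
    refine (runs_scanCmd hB₃ hE₃ hP₃ h₃).seq fun s₄ hB₄ hF₄ ⟨m1, m2, m3⟩ => ?_
    rw [← hF₄.arr 7 rfl, ← hF₄.arr 9 rfl, ← hF₄.arr 10 rfl] at h₂ h₃
    rw [← hF₄.arr 11 rfl] at h₂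
    rw [← hF₄.arr 12 rfl, ← hF₄.arr 13 rfl] at h₃
    have hE₄ := hE₃.frame hF₄ rfl
    have hP₄ := hP₃.frame hF₄ rfl
    have hO₄ := hO₃.frame hF₄ rfl rfl
    have e16 : s₄.var 16 = s.var 16 := by
      rw [hF₄.var 16 rfl, hF₃.var 16 rfl, hF₂.var 16 rfl, hF₁.var 16 rfl]
    have e5 : s₄.arr 5 = s.arr 5 := by
      rw [hF₄.arr 5 rfl, hF₃.arr 5 rfl, hF₂.arr 5 rfl, hF₁.arr 5 rfl]
    have eo : output n s₄ = output n s := by simp only [output, e5]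
    refine (runs_recordCmd hB₄ hE₄ hP₄ hO₄ (by rw [hF₄.var 17 rfl, hF₃.var 17 rfl, hF₂.var 17 rfl, e₁])
      (eV ▸ hV) h₂ h₃ m1 m2 (by rw [e16, eo]; exact h.sound)).seq fun s₅ hB₅ hF₅ ⟨r1, r2, r3⟩ => ?_
    have e15 : s₅.var 15 = 2 ^ j := by
      rw [hF₅.var 15 rfl, hF₄.var 15 rfl, hF₃.var 15 rfl, hF₂.var 15 rfl, hF₁.var 15 rfl, h.guess]
    have e9 : s₅.var 9 = s.var 9 := by
      rw [hF₅.var 9 rfl, hF₄.var 9 rfl, hF₃.var 9 rfl, hF₂.var 9 rfl, hF₁.var 9 rfl]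
    refine Runs.assign two_le_wordBound hB₅ (e := var 15 + var 15) (by decide)
      (by simpa [e15] using hg) ⟨by simp [e15, pow_succ, mul_two], by rw [setVar_var, if_neg (by decide)]; exact r1, fun i hi => ?_⟩
    simp only [setVar_var, Nat.reduceEqDiff, if_false, e9]
    rcases Nat.lt_succ_iff_lt_or_eq.1 hi with hi | rfl
    · exact (h.covered i hi).mono (e16 ▸ r2)
    · rw [← eV]
      exact (hO₄.sorts.covered h₂ h₃ rfl m3).mono r3
  · have h1 : 2 * kParam n T ε + 1 ≤ n * (2 * kParam n T ε + 1) := Nat.le_mul_of_pos_left _ hn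
    have h2 : n ≤ n * (2 * kParam n T ε + 1) := Nat.le_mul_of_pos_right _ (by omega)
    have h3 : (n + 1) * (210 * (2 * kParam n T ε + 1)) =
      210 * (n * (2 * kParam n T ε + 1)) + 210 * (2 * kParam n T ε + 1) := by ring
    omega

theorem runs_searchCmd {s : State} (hs : s.Bdd (wordBound I ε)) (hE : Env I ε s)
    (hP : Params I ε s) (hO : Sorted I s) (h9 : I.BestSingle (s.var 9)) (hn : 1 ≤ n)
    (h : Searched I ε 0 s) :
    Runs (wordBound I ε) searchCmd s
      ((Nat.log 2 n + 2) * (810 * (n * (2 * kParam n T ε + 1)))) fun s' =>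
      s'.var 9 = s.var 9 ∧ Searched I ε (Nat.log 2 n + 1) s' := by
  have hlog : ∀ j, 2 ^ j ≤ n ↔ j < Nat.log 2 n + 1 := fun j => by
    rw [Nat.lt_succ_iff, Nat.le_log_iff_pow_le (by omega) (by omega)]
  refine (Runs.loop two_le_wordBound (by decide) (fun j s' => Searched I ε j s') (Nat.log 2 n + 1)
    (800 * (n * (2 * kParam n T ε + 1))) hs h (fun j s' hj hB hF hI => ⟨?_, ?_⟩)
    fun s' hB hF hI => ?_).mono ?_ fun s' _ hF h => ⟨hF.var 9 rfl, h⟩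
  · have := (hlog j).2 hj
    simp [(hE.frame hF rfl).n, hI.guess]; omega
  · refine runs_roundCmd hB (hE.frame hF rfl) (hP.frame hF rfl) (hO.frame hF rfl rfl) ?_
      ((hlog j).2 hj) hI
    rw [hF.var 9 rfl]; exact h9
  · have := mt (hlog (Nat.log 2 n + 1)).1 (lt_irrefl _)
    simp [(hE.frame hF rfl).n, hI.guess]; omega
  · change (Nat.log 2 n + 1) * (5 + 1 + _) + (5 + 1) ≤ _
    have h1 : 0 < n * (2 * kParam n T ε + 1) := Nat.mul_pos hn (by omega)
    generalize n * (2 * kParam n T ε + 1) = y at *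
    nlinarith

theorem runs_schemeCmd (hn : 1 ≤ n) (hT : T ≤ n) :
    Runs (wordBound I ε) schemeCmd (I.input ε)
      (2000 * ((Nat.log 2 n + 2) * (n * (2 * kParam n T ε + 1)))) fun s =>
      ∃ (ord : ℕ → ℕ) (p₀ best : ℕ), I.Sorts ord ∧ I.BestSingle p₀ ∧
        (best : ℤ) ≤ I.val (output n s) * kParam n T ε ∧
        ∀ j, 2 ^ j ≤ n → I.Covered (hParam T ε) (kParam n T ε) (p₀ * 2 ^ j) best := by
  refine Runs.mono (b := (40 * T + 10) + (800 * (n * (Nat.log 2 n + 2)) + ((40 * n + 10) + (70 +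
    (Nat.log 2 n + 2) * (810 * (n * (2 * kParam n T ε + 1))))))) ?_ ?_ fun _ _ _ h => h
  · refine (runs_ratesCmd bdd_input env_input).seq fun s₁ hB₁ hF₁ h₁ => ?_
    have hE₁ := env_input.frame hF₁ rfl
    refine (runs_sortCmd hB₁ hE₁ hn).seq fun s₂ hB₂ hF₂ h₂ => ?_
    have hE₂ := hE₁.frame hF₂ rfl
    rw [← hF₂.arr 6 rfl] at h₁
    refine (runs_singleCmd hB₂ hE₂ h₁).seq fun s₃ hB₃ hF₃ h₃ => ?_
    have hE₃ := hE₂.frame hF₃ rfl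
    refine (runs_paramCmd hB₃ hE₃).seq fun s₄ hB₄ hF₄ ⟨h₄, e15, e16⟩ => ?_
    have hO : Sorted I s₄ := by
      refine ⟨?_, ?_⟩
      · rw [hF₄.arr 7 rfl, hF₃.arr 7 rfl]; exact h₂
      · rw [hF₄.arr 6 rfl, hF₃.arr 6 rfl]; exact h₁
    have e5 : s₄.arr 5 = fun _ => 0 := by
      rw [hF₄.arr 5 rfl, hF₃.arr 5 rfl, hF₂.arr 5 rfl, hF₁.arr 5 rfl]; rfl
    rw [← hF₄.var 9 rfl] at h₃
    refine (runs_searchCmd hB₄ (hE₃.frame hF₄ rfl) h₄ hO h₃ hn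
      ⟨by rw [e15, pow_zero], ?_, by omega⟩).mono le_rfl fun s₅ _ _ ⟨e9, h₅⟩ =>
      ⟨s₄.arr 7, s₄.var 9, s₅.var 16, hO.sorts, h₃, h₅.sound, fun j hj => ?_⟩
    -- Initially the output is empty and has value 0, which the recorded 0 certifies.
    · have : output n s₄ = ∅ := by simp [output, e5]
      rw [this, e16, val_empty]; simp
    · rw [← e9]
      exact h₅.covered j (Nat.lt_succ_of_le ((Nat.le_log_iff_pow_le (by omega) (by omega)).2 hj))
  · have h1 : n * 1 ≤ n * (2 * kParam n T ε + 1) := Nat.mul_le_mul_left _ (by omega)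
    have h2 : n * (Nat.log 2 n + 2) ≤ (Nat.log 2 n + 2) * (n * (2 * kParam n T ε + 1)) := by
      rw [mul_comm]; exact Nat.mul_le_mul_left _ (by omega)
    have h3 : 2 * n ≤ n * (Nat.log 2 n + 2) := by rw [mul_comm]; exact Nat.mul_le_mul_left _ (by omega)
    have h4 : (Nat.log 2 n + 2) * (810 * (n * (2 * kParam n T ε + 1))) =
      810 * ((Nat.log 2 n + 2) * (n * (2 * kParam n T ε + 1))) := by ring
    omega

/-! ### Running time -/

/-- The integer computed is the floor of x / ε plus 1, so it lies between x / ε and x / ε + 1. -/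
theorem div_add_one_bounds (hε : 0 < ε) (x : ℕ) :
    (x : ℝ) ≤ ε * (x * ε.den / ε.num.natAbs + 1 : ℕ) ∧
      ((x * ε.den / ε.num.natAbs + 1 : ℕ) : ℝ) ≤ x / ε + 1 := by
  have hnum : 0 < ε.num.natAbs := Int.natAbs_pos.2 (Rat.num_pos.2 hε).ne'
  have hnum' : (0 : ℝ) < ε.num.natAbs := by exact_mod_cast hnum
  have hden : (0 : ℝ) < ε.den := by exact_mod_cast ε.den_pos
  have he : (ε : ℝ) = ε.num.natAbs / ε.den := by
    rw [Rat.cast_def, Nat.cast_natAbs, abs_of_pos (Rat.num_pos.2 hε)]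
  rw [he]
  constructor
  · rw [div_mul_eq_mul_div, le_div_iff₀ hden]
    exact_mod_cast (Nat.lt_mul_div_succ (x * ε.den) hnum).le
  · rw [Nat.cast_add_one, div_div_eq_mul_div]
    refine add_le_add_left (Nat.cast_div_le.trans ?_) 1
    rw [Nat.cast_mul]

theorem roundings_pos (hn : 1 ≤ n) {H : ℕ} (hH : 0 < H) : 0 < roundings H n T :=
  lt_min (by omega) (by omega)

/-- The constant is 16 + 2 + 3: twice H is at most 16T / ε + 2, and 1 ≤ T ≤ T / ε. -/
theorem roundings_le (hε : 0 < ε) (hε1 : ε < 1) (hT : 1 ≤ T) :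
    (roundings (hParam T ε) n T : ℝ) ≤ 21 * min ((T : ℝ) / ε) n := by
  have he : (0 : ℝ) < ε := by exact_mod_cast hε
  have he1 : (ε : ℝ) ≤ 1 := by exact_mod_cast hε1.le
  have hT' : (1 : ℝ) ≤ T := by exact_mod_cast hT
  have h1 : (T : ℝ) ≤ T / ε := by rw [le_div_iff₀ he]; nlinarith
  have h2 : (hParam T ε : ℝ) ≤ (8 * T : ℕ) / ε + 1 := (div_add_one_bounds hε (8 * T)).2
  rw [Nat.cast_mul, mul_div_assoc] at h2
  rw [mul_min_of_nonneg _ _ (by norm_num), roundings, Nat.cast_min]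
  refine min_le_min ?_ ?_
  · push_cast at h2 ⊢; linarith
  · have : (0 : ℝ) ≤ n := Nat.cast_nonneg n
    linarith

/-- With ρ the bound on roundings, the width is at most 8ρ / ε + 3 ≤ 11ρ / ε, because ρ / ε ≥ 1; so
315 = 15 · 21 leaves slack. -/
theorem width_real (hε : 0 < ε) (hε1 : ε < 1) (hn : 1 ≤ n) (hT : 1 ≤ T) :
    ((2 * kParam n T ε + 1 : ℕ) : ℝ) ≤ 315 * (min ((T : ℝ) / ε) n / ε) := by
  have he : (0 : ℝ) < ε := by exact_mod_cast hε
  have he1 : (ε : ℝ) ≤ 1 := by exact_mod_cast hε1.le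
  have h1 := roundings_le (n := n) hε hε1 hT
  have h2 : (1 : ℝ) ≤ roundings (hParam T ε) n T := by
    exact_mod_cast roundings_pos hn (Nat.succ_pos _)
  have h3 : (kParam n T ε : ℝ) ≤ (4 * roundings (hParam T ε) n T : ℕ) / ε + 1 :=
    (div_add_one_bounds hε _).2
  have h4 : (roundings (hParam T ε) n T : ℝ) / ε ≤ 21 * (min ((T : ℝ) / ε) n / ε) := by
    rw [← mul_div_assoc]; gcongr
  have h5 : (1 : ℝ) ≤ roundings (hParam T ε) n T / ε := by rw [le_div_iff₀ he]; linarith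
  rw [Nat.cast_mul, mul_div_assoc] at h3
  push_cast at h3 ⊢
  linarith

theorem log_add_two_le (hn : 1 ≤ n) : ((Nat.log 2 n + 2 : ℕ) : ℝ) ≤ 6 * Real.log ((n : ℝ) + 1) := by
  have hn' : (1 : ℝ) ≤ n := by exact_mod_cast hn
  have h1 : (1 : ℝ) / 2 ≤ Real.log 2 := by linarith [Real.log_two_gt_d9]
  have h2 : Real.log 2 ≤ Real.log ((n : ℝ) + 1) := Real.log_le_log (by norm_num) (by linarith)
  have h3 : Real.log ((2 : ℝ) ^ Nat.log 2 n) ≤ Real.log ((n : ℝ) + 1) := by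
    refine Real.log_le_log (by positivity) ?_
    have : ((2 ^ Nat.log 2 n : ℕ) : ℝ) ≤ n := by exact_mod_cast Nat.pow_log_le_self 2 (by omega)
    push_cast at this
    linarith
  rw [Real.log_pow] at h3
  have h4 : (Nat.log 2 n : ℝ) * (1 / 2) ≤ Nat.log 2 n * Real.log 2 := by gcongr
  push_cast
  linarith

end MPBKPS

/-! ### The main theorem -/

theorem theorem2 :
    ∃ (p : WordRAM.Cmd) (C : ℝ) (k : ℕ),
      ∀ (n T : ℕ) (I : MPBKPS n T) (ε : ℚ), 1 ≤ n → T ≤ n → 0 < ε → ε < 1 →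
        ∃ (s : WordRAM.State) (steps : ℕ),
          WordRAM.Exec (I.magnitude ε ^ k) p (I.input ε) s steps ∧
          I.IsApprox (1 + (ε : ℝ)) (MPBKPS.output n s) ∧
          (steps : ℝ) ≤
            C * ((n : ℝ) * Real.log ((n : ℝ) + 1) / (ε : ℝ) * min ((T : ℝ) / (ε : ℝ)) (n : ℝ)) := by
  -- Stored words are below the 16th power of the magnitude, and expressions have at most 64 leaves.
  -- The factors of C come from the step count, the logarithm and the width of the table.
  refine ⟨MPBKPS.schemeCmd, 2000 * (6 * 315), 16 * 64, fun n T I ε hn hTn hε hε1 => ?_⟩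
  obtain ⟨s, steps, hx, ht, -, ord, p₀, best, hord, hp, hbest, hcov⟩ :=
    MPBKPS.runs_schemeCmd (I := I) (ε := ε) hn hTn
  -- There is an item, and its deadline is a period.
  have hT : 1 ≤ T := Nat.one_le_iff_ne_zero.2 fun h => by subst h; exact (I.d ⟨0, hn⟩).elim0
  have he : (0 : ℝ) < ε := by exact_mod_cast hε
  refine ⟨s, steps, ?_, ?_, ?_⟩
  · rwa [pow_mul]
  · refine hord.isApprox he (by exact_mod_cast hε1) hp.le hp.eq ?_ ?_ (Nat.succ_pos _)
      (Nat.succ_pos _) hbest hcov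
    · exact_mod_cast (MPBKPS.div_add_one_bounds hε (8 * T)).1
    · exact_mod_cast (MPBKPS.div_add_one_bounds hε _).1
  · have h1 := MPBKPS.width_real hε hε1 hn hT
    have h2 := MPBKPS.log_add_two_le hn
    calc (steps : ℝ) ≤ ((2000 * ((Nat.log 2 n + 2) * (n * (2 * MPBKPS.kParam n T ε + 1))) : ℕ) : ℝ) := by
          exact_mod_cast ht
      _ = 2000 * (((Nat.log 2 n + 2 : ℕ) : ℝ) * (n * ((2 * MPBKPS.kParam n T ε + 1 : ℕ) : ℝ))) := by
          push_cast; ring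
      _ ≤ 2000 * (6 * Real.log ((n : ℝ) + 1) * (n * (315 * (min ((T : ℝ) / ε) n / ε)))) := by
          have h3 : (0 : ℝ) ≤ 6 * Real.log ((n : ℝ) + 1) := (Nat.cast_nonneg _).trans h2
          gcongr
      _ = _ := by ring
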